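/- **Notation.** Let $\mathbf A=\mathbf R\times\mathbf A_f$ be the adeles of $\mathbf Q$, let $J_4=\begin{pmatrix}0&\mathbf 1_2\\-\mathbf 1_2&0\end{pmatrix}$ and $\mathrm{GSp}_4=\{g\in \mathrm{GL}_4 : gJ_4{}^tg=\nu(g)J_4\}$, acting on the right on the space $W_4$ of row vectors with ordered basis $e_1,e_2,f_1,f_2$. Let $Z$ be the centre of $\mathrm{GSp}_4$, and let $U$ be the group of matrices $$u=\begin{pmatrix}\mathbf 1_2&X\\0&\mathbf 1_2\end{pmatrix},\qquad X=\begin{pmatrix}u_{11}&u_{12}\\u_{12}&u_{22}\end{pmatrix}.$$ Let $D$ be a square-free nonzero integer and let $L=\mathbf Q[x]/(x^2-D)$, presented as $\mathbf Q[x]/(x^2+x+\frac{1-D}{4})$ if $D\equiv1\pmod 4$; let $\alpha$ be the image of $x$ and $\overline{\alpha}$ its conjugate. Let $\mathrm{GL}_{2,L}^*$ be the algebraic group over $\mathbf Q$ of those $g\in\mathrm{Res}^L_{\mathbf Q}\mathrm{GL}_2$ with determinant in $\mathbf G_m$. It acts on the right on $L^2=Lc_1\oplus Lc_2$, and is embedded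 in $\mathrm{GSp}_4$ through the identification $L^2\cong W_4$ given by $e_1=c_1$, $e_2=\alpha c_1$, $f_1=-\overline{\alpha}c_2$, $f_2=c_2$. Let $N\subset U$ be the unipotent radical of the upper triangular Borel subgroup of $\mathrm{GL}_{2,L}^*$. Let $\psi:\mathbf Q\backslash\mathbf A\to\mathbf C^\times$ be the additive character with $\psi_\infty(x)=e^{2\pi i x}$ and conductor one at all finite places. Define a character $\chi$ of $U(\mathbf A)$ by $\chi(u)=\psi(-Du_{11}+u_{22})$ if $D\not\equiv1\pmod 4$, and $\chi(u)=\psi(\frac{1-D}{4}u_{11}+u_{12}+u_{22})$ if $D\equiv1\pmod 4$. For a cusp form $\phi$ on $\mathrm{GSp}_4(\mathbf A)$ put $$H(\phi)=\int_{U(\mathbf Q)\backslash U(\mathbf A)}\chi^{-1}(u)\phi(u)\,du .$$ For a Schwartz function $\Phi_\infty\in\mathcal S(W_4(\mathbf R))$ put $$f_\infty^{\Phi_\infty}(g,s)=|\nu(g)|^{2s}\int_{\mathbf R^\times}\Phi_\infty(tf_2g)\,|t|^{4s}\,\frac{dt}{|t|}.$$ Let $\pi$ be a cuspidal automorphic representation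 of $\mathrm{GSp}_4(\mathbf A)$ with trivial central character, realized on its smooth vectors: a nonzero space of smooth cusp forms, stable under right translation by $\mathrm{GSp}_4(\mathbf A)$, closed among smooth cusp forms and topologically irreducible for the topology of uniform convergence on compact sets of all derivatives. Let $\pi\cong\pi_\infty\otimes\pi_f$ be a factorization, where $\pi_\infty$ is the space of smooth vectors of an irreducible unitary representation of $\mathrm{GSp}_4(\mathbf R)$, $\pi_f$ is an irreducible smooth representation of $\mathrm{GSp}_4(\mathbf A_f)$, and the isomorphism is $\mathrm{GSp}_4(\mathbf A)$-equivariant and, for each fixed vector of $\pi_f$, continuous in $\pi_\infty$. **Proposition.** Suppose that $\phi\in\pi$ is factorizable, $\phi=v_\infty\otimes v_f$ with $v_\infty\in\pi_\infty$ and $v_f\in\pi_f$, and that $H(\phi)\neq0$. Then there are a smooth vector $v_\infty'\in\pi_\infty$ and a Schwartz function $\Phi_\infty\in\mathcal S(W_4(\mathbf R))$ such that, with $\phi'=v_\infty'\otimes v_f$, the archimedean integral $$J_\infty(\phi',s)=\int_{N(\mathbf R)Z(\mathbf R)\backslash \mathrm{GL}_{2,L}^*(\mathbf R)}H(\pi(g)\phi')\,f_\infty^{\Phi_\infty}(g,s)\,dg$$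 converges absolutely for $\mathrm{Re}(s)$ sufficiently large and is not identically zero there. -/

import Mathlib

open MeasureTheory IsDedekindDomain
open scoped ContDiff TensorProduct SchwartzMap Matrix

namespace KS

/-- The symplectic form `J₄ = (0 1₂; -1₂ 0)`; row vectors have the ordered basis `e₁, e₂, f₁, f₂`. -/
def J4 (R : Type*) [CommRing R] : Matrix (Fin 4) (Fin 4) R :=
  !![0, 0, 1, 0; 0, 0, 0, 1; -1, 0, 0, 0; 0, -1, 0, 0]

/-- `GSp₄(R) = {g ∈ GL₄(R) | g J ᵗg = ν J for some ν ∈ Rˣ}`, acting on row vectors on the right. -/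
def GSp4 (R : Type*) [CommRing R] : Subgroup (GL (Fin 4) R) where
  carrier := {g | ∃ ν : Rˣ, (g : Matrix (Fin 4) (Fin 4) R) * J4 R * (g : Matrix _ _ R)ᵀ
    = (ν : R) • J4 R}
  one_mem' := ⟨1, by simp⟩
  mul_mem' := by
    rintro g h ⟨ν, hν⟩ ⟨μ, hμ⟩
    refine ⟨ν * μ, ?_⟩
    calc ((g * h : GL (Fin 4) R) : Matrix (Fin 4) (Fin 4) R) * J4 R * ((g * h : GL (Fin 4) R) : Matrix _ _ R)ᵀ
        = (g : Matrix _ _ R) * ((h : Matrix _ _ R) * J4 R * (h : Matrix _ _ R)ᵀ) * (g : Matrix _ _ R)ᵀ := by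
          simp [Matrix.transpose_mul, Matrix.mul_assoc]
      _ = _ := by rw [hμ]; simp [hν, smul_smul, mul_comm]
  inv_mem' := by
    rintro g ⟨ν, hν⟩
    refine ⟨ν⁻¹, ?_⟩
    have h1 : ((g⁻¹ : GL (Fin 4) R) : Matrix (Fin 4) (Fin 4) R) * (g : Matrix _ _ R) = 1 := by
      rw [← Units.val_mul]; simp
    have h2 : (g : Matrix _ _ R)ᵀ * ((g⁻¹ : GL (Fin 4) R) : Matrix (Fin 4) (Fin 4) R)ᵀ = 1 := by
      rw [← Matrix.transpose_mul, h1, Matrix.transpose_one]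
    have h3 : J4 R = (ν : R) • (((g⁻¹ : GL (Fin 4) R) : Matrix (Fin 4) (Fin 4) R) * J4 R *
        ((g⁻¹ : GL (Fin 4) R) : Matrix (Fin 4) (Fin 4) R)ᵀ) := by
      rw [← Matrix.smul_mul, ← Matrix.mul_smul, ← hν]
      have h4 : ∀ A B C D E : Matrix (Fin 4) (Fin 4) R,
          A * (B * C * D) * E = (A * B) * C * (D * E) := by
        intros; simp only [Matrix.mul_assoc]
      rw [h4, h1, h2, Matrix.one_mul, Matrix.mul_one]
    change _ = ((ν⁻¹ : Rˣ) : R) • J4 R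
    conv_rhs => rw [h3, smul_smul, Units.inv_mul, one_smul]

/-- The similitude factor: `g J ᵗg = ν(g) J`, read off from the entry of `J` equal to `1`. -/
def simil {R : Type*} [CommRing R] (g : GSp4 R) : R :=
  ((g.1 : Matrix (Fin 4) (Fin 4) R) * J4 R * (g.1 : Matrix (Fin 4) (Fin 4) R)ᵀ : Matrix (Fin 4) (Fin 4) R) 0 2

theorem J4_map {R S : Type*} [CommRing R] [CommRing S] (f : R →+* S) : (J4 R).map f = J4 S := by
  ext i j; fin_cases i <;> fin_cases j <;> simp [J4]

/-- Functoriality of `GSp₄` in the ring. -/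
def GSp4.map {R S : Type*} [CommRing R] [CommRing S] (f : R →+* S) : GSp4 R →* GSp4 S :=
  ((Matrix.GeneralLinearGroup.map f).comp (GSp4 R).subtype).codRestrict (GSp4 S) (by
    rintro ⟨g, ν, hν⟩
    refine ⟨Units.map f ν, ?_⟩
    have := congrArg (fun M => M.map f) hν
    simp only [Matrix.map_mul, J4_map] at this
    refine Eq.trans this ?_
    ext i j
    have := congrFun (congrFun (J4_map f) i) j
    simp only [Matrix.map_apply] at this
    simp [this])

/-- The central element `z · 1₄`. -/
def GSp4.center {R : Type*} [CommRing R] (z : Rˣ) : GSp4 R :=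
  ⟨Units.map (algebraMap R (Matrix (Fin 4) (Fin 4) R)).toMonoidHom z, z * z, by
    simp [Algebra.algebraMap_eq_smul_one, smul_smul]⟩

/-- The element of the unipotent radical `U` of the Siegel parabolic with upper right block
the symmetric matrix `(x y; y z)`. -/
def siegelU {R : Type*} [CommRing R] (x y z : R) : GSp4 R :=
  ⟨⟨!![1, 0, x, y; 0, 1, y, z; 0, 0, 1, 0; 0, 0, 0, 1],
    !![1, 0, -x, -y; 0, 1, -y, -z; 0, 0, 1, 0; 0, 0, 0, 1],
    by ext i j; fin_cases i <;> fin_cases j <;> simp [Matrix.mul_apply, Fin.sum_univ_four],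
    by ext i j; fin_cases i <;> fin_cases j <;> simp [Matrix.mul_apply, Fin.sum_univ_four]⟩, 1, by
    ext i j; fin_cases i <;> fin_cases j <;> simp [J4, Matrix.mul_apply, Fin.sum_univ_four]⟩

/-- The elements of the (Heisenberg) unipotent radical of the Klingen parabolic, the stabilizer of
the line spanned by `f₂`. -/
def klingenU {R : Type*} [CommRing R] (x y z : R) : GSp4 R :=
  ⟨⟨!![1, 0, 0, x; y, 1, x, z; 0, 0, 1, -y; 0, 0, 0, 1],
    !![1, 0, 0, -x; -y, 1, -x, -z; 0, 0, 1, y; 0, 0, 0, 1],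
    by ext i j; fin_cases i <;> fin_cases j <;> (simp [Matrix.mul_apply, Fin.sum_univ_four]; try ring),
    by ext i j; fin_cases i <;> fin_cases j <;> simp [Matrix.mul_apply, Fin.sum_univ_four] <;> ring⟩, 1, by
    ext i j; fin_cases i <;> fin_cases j <;> simp [J4, Matrix.mul_apply, Fin.sum_univ_four]
    ring⟩

attribute [local instance 100] LieRing.ofAssociativeRing

/-- The Lie algebra of `GSp₄(ℝ)`. -/
def gsp4 : LieSubalgebra ℝ (Matrix (Fin 4) (Fin 4) ℝ) where
  carrier := {X | ∃ c : ℝ, X * J4 ℝ + J4 ℝ * Xᵀ = c • J4 ℝ}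
  add_mem' := by
    rintro X Y ⟨c, hc⟩ ⟨d, hd⟩
    refine ⟨c + d, ?_⟩
    rw [add_smul, ← hc, ← hd, Matrix.transpose_add, Matrix.add_mul, Matrix.mul_add]; abel
  zero_mem' := ⟨0, by simp⟩
  smul_mem' := by
    rintro a X ⟨c, hc⟩
    exact ⟨a * c, by rw [mul_smul, ← hc]; simp⟩
  lie_mem' := by
    rintro X Y ⟨c, hc⟩ ⟨d, hd⟩
    refine ⟨0, ?_⟩
    have h1 : J4 ℝ * Xᵀ = c • J4 ℝ - X * J4 ℝ := by rw [← hc]; abel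
    have h2 : J4 ℝ * Yᵀ = d • J4 ℝ - Y * J4 ℝ := by rw [← hd]; abel
    rw [Ring.lie_def, Matrix.transpose_sub, Matrix.transpose_mul, Matrix.transpose_mul, Matrix.mul_sub,
      ← Matrix.mul_assoc, ← Matrix.mul_assoc, h1, h2, Matrix.sub_mul, Matrix.sub_mul,
      Matrix.mul_assoc, Matrix.mul_assoc]
    simp only [Matrix.smul_mul, h1, h2, Matrix.mul_sub, Matrix.sub_mul, Matrix.mul_smul, smul_sub, Matrix.mul_assoc, zero_smul, smul_smul, mul_comm]
    abel

theorem J4_mul_J4 : J4 ℝ * J4 ℝ = -1 := by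
  ext i j; fin_cases i <;> fin_cases j <;> simp [J4, Matrix.mul_apply, Fin.sum_univ_four]

theorem exp_mul_J4 (X : Matrix (Fin 4) (Fin 4) ℝ) (c : ℝ) (h : X * J4 ℝ + J4 ℝ * Xᵀ = c • J4 ℝ) :
    NormedSpace.exp X * J4 ℝ * (NormedSpace.exp X)ᵀ = Real.exp c • J4 ℝ := by
  have hU : IsUnit (J4 ℝ) := ⟨⟨J4 ℝ, -J4 ℝ, by simp [J4_mul_J4], by simp [J4_mul_J4]⟩, rfl⟩
  have hJ : J4 ℝ * (J4 ℝ)⁻¹ = 1 := Matrix.mul_nonsing_inv _ ((Matrix.isUnit_iff_isUnit_det _).1 hU)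
  have hJ' : (J4 ℝ)⁻¹ * J4 ℝ = 1 := Matrix.nonsing_inv_mul _ ((Matrix.isUnit_iff_isUnit_det _).1 hU)
  have h1 : J4 ℝ * Xᵀ * (J4 ℝ)⁻¹ = -X + c • (1 : Matrix (Fin 4) (Fin 4) ℝ) := by
    have : J4 ℝ * Xᵀ = c • J4 ℝ - X * J4 ℝ := by rw [← h]; abel
    rw [this, Matrix.sub_mul, Matrix.mul_assoc, hJ, Matrix.smul_mul, hJ]
    simp [sub_eq_neg_add]
  have h2 : J4 ℝ * (NormedSpace.exp X)ᵀ * (J4 ℝ)⁻¹ = NormedSpace.exp (-X) * NormedSpace.exp (c • (1 : Matrix (Fin 4) (Fin 4) ℝ)) := by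
    rw [← Matrix.exp_transpose, ← Matrix.exp_conj _ _ hU, h1, Matrix.exp_add_of_commute]
    exact (Commute.one_right _).smul_right _
  have h3 : NormedSpace.exp (c • (1 : Matrix (Fin 4) (Fin 4) ℝ)) = Real.exp c • 1 := by
    have : c • (1 : Matrix (Fin 4) (Fin 4) ℝ) = Matrix.diagonal (fun _ => c) := by
      rw [Matrix.smul_one_eq_diagonal]
    rw [this, Matrix.exp_diagonal, Matrix.smul_one_eq_diagonal]
    congr 1
    funext i
    rw [Pi.coe_exp, Real.exp_eq_exp_ℝ]
  have h4 : NormedSpace.exp X * NormedSpace.exp (-X) = 1 := by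
    rw [← Matrix.exp_add_of_commute _ _ (Commute.neg_right (Commute.refl X))]; simp
  calc NormedSpace.exp X * J4 ℝ * (NormedSpace.exp X)ᵀ
      = NormedSpace.exp X * (J4 ℝ * (NormedSpace.exp X)ᵀ * (J4 ℝ)⁻¹) * J4 ℝ := by
        simp only [Matrix.mul_assoc, hJ', Matrix.mul_one]
    _ = _ := by
        rw [h2, h3, ← Matrix.mul_assoc, h4]; simp

/-- The exponential map of `GSp₄(ℝ)`. -/
noncomputable def expG (X : gsp4) : GSp4 ℝ :=
  ⟨(Matrix.isUnit_exp (X : Matrix (Fin 4) (Fin 4) ℝ)).unit, by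
    obtain ⟨c, hc⟩ := X.2
    exact ⟨Units.mk0 (Real.exp c) (Real.exp_ne_zero c), exp_mul_J4 _ c hc⟩⟩

/-- The ring of finite adeles of `ℚ`. -/
abbrev FinAdele : Type := FiniteAdeleRing ℤ ℚ
/-- The adeles of `ℚ`. -/
abbrev AdeleQ : Type := ℝ × FinAdele

/-- `GSp₄(𝔸) = GSp₄(ℝ) × GSp₄(𝔸_f)`. -/
abbrev GSp4A : Type := GSp4 ℝ × GSp4 FinAdele

/-- The diagonal embedding of `GSp₄(ℚ)` in `GSp₄(𝔸)`. -/
noncomputable def diagQ (γ : GSp4 ℚ) : GSp4A :=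
  (GSp4.map (algebraMap ℚ ℝ) γ, GSp4.map (algebraMap ℚ FinAdele) γ)

theorem compactSpace_adicCompletionIntegers (R : Type*) [CommRing R] [IsDedekindDomain R] [Algebra R ℚ]
    [IsFractionRing R ℚ] [IsIntegralClosure R ℤ ℚ] (v : HeightOneSpectrum R) :
    CompactSpace (v.adicCompletionIntegers ℚ) := 
  haveI : Fact (Nat.Prime (Rat.HeightOneSpectrum.primesEquiv v : ℕ)) := ⟨(Rat.HeightOneSpectrum.primesEquiv v).2⟩
  (Rat.HeightOneSpectrum.adicCompletionIntegers.padicIntEquiv v).toHomeomorph.symm.compactSpace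

/-- The ring `Ẑ = ∏ ℤ_p` inside the finite adeles. -/
def ZHat : Set FinAdele := {x | ∀ v : HeightOneSpectrum ℤ, x v ∈ v.adicCompletionIntegers ℚ}

theorem isOpen_ZHat : IsOpen ZHat := 
  RestrictedProduct.isOpen_forall_mem (R := fun v : HeightOneSpectrum ℤ => v.adicCompletion ℚ)
    (A := fun v => (v.adicCompletionIntegers ℚ : Set (v.adicCompletion ℚ)))
    (fun _ ↦ Valued.isOpen_valuationSubring _)

theorem isCompact_ZHat : IsCompact ZHat := by
  have : ∀ v : HeightOneSpectrum ℤ,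
      CompactSpace ((v.adicCompletionIntegers ℚ : Set (v.adicCompletion ℚ))) :=
    compactSpace_adicCompletionIntegers ℤ
  have h := isCompact_range (RestrictedProduct.isEmbedding_structureMap (R := fun v : HeightOneSpectrum ℤ => v.adicCompletion ℚ)
    (A := fun v => (v.adicCompletionIntegers ℚ : Set (v.adicCompletion ℚ))) (𝓕 := Filter.cofinite)).continuous
  rw [RestrictedProduct.range_structureMap] at h
  exact h

noncomputable instance : MeasurableSpace FinAdele := borel _
instance : BorelSpace FinAdele := ⟨rfl⟩

/-- The additive Haar measure on the finite adeles giving `Ẑ` measure one. -/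
noncomputable def haarFin : Measure FinAdele :=
  Measure.addHaarMeasure ⟨⟨ZHat, isCompact_ZHat⟩, by
    rw [isOpen_ZHat.interior_eq]; exact ⟨0, fun v => zero_mem _⟩⟩

/-- The Haar measure of `𝔸` restricted to `[0,1) × Ẑ`, which is a fundamental domain for the
translation action of `ℚ`. Integrating a `ℚ`-invariant function against it is integrating over `ℚ \ 𝔸`
with respect to the invariant measure of total mass one. -/
noncomputable def quotMeasure : Measure AdeleQ :=
  (volume.restrict (Set.Ico (0 : ℝ) 1)).prod (haarFin.restrict ZHat)


/-- The right translation action of a Lie algebra element, `(R(X)φ)(g) = d/dt φ(g exp(tX))` at `t = 0`. -/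
noncomputable def rightDeriv (X : gsp4) (φ : GSp4A → ℂ) : GSp4A → ℂ :=
  fun g => deriv (fun t : ℝ => φ (g * (expG (t • X), 1))) 0

/-- `diffOp [X₁, …, Xₙ] φ = R(X₁) ⋯ R(Xₙ) φ`. -/
noncomputable def diffOp : List gsp4 → (GSp4A → ℂ) → (GSp4A → ℂ)
  | [], φ => φ
  | X :: w, φ => rightDeriv X (diffOp w φ)

/-- Smooth functions on `GSp₄(𝔸)`: right invariant under an open subgroup of `GSp₄(𝔸_f)`, and smooth
in the real variable (tested in the exponential charts around every point). -/
def IsSmooth (φ : GSp4A → ℂ) : Prop :=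
  (∃ K : Subgroup (GSp4 FinAdele), IsOpen (K : Set (GSp4 FinAdele)) ∧
    ∀ g : GSp4A, ∀ k ∈ K, φ (g * (1, k)) = φ g) ∧
  ∀ (g : GSp4A) (n : ℕ) (X : Fin n → gsp4),
    ContDiff ℝ ∞ (fun c : Fin n → ℝ => φ (g * (expG (∑ i, c i • X i), 1)))

/-- The element of the universal enveloping algebra defined by a combination of words. -/
noncomputable def toUniv (P : List gsp4 →₀ ℝ) : UniversalEnvelopingAlgebra ℝ gsp4 :=
  P.sum fun w c => c • (w.map (UniversalEnvelopingAlgebra.ι ℝ)).prod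

/-- `φ` is finite under the centre of the universal enveloping algebra. -/
def IsZFinite (φ : GSp4A → ℂ) : Prop :=
  FiniteDimensional ℂ (Submodule.span ℂ {ψ : GSp4A → ℂ | ∃ P : List gsp4 →₀ ℝ,
    toUniv P ∈ Subalgebra.center ℝ (UniversalEnvelopingAlgebra ℝ gsp4) ∧
    ψ = P.sum fun w c => (c : ℂ) • diffOp w φ})

/-- A norm on `GSp₄(ℝ)`. -/
noncomputable def height (g : GSp4 ℝ) : ℝ :=
  ∑ i, ∑ j, (|(g.1 : Matrix (Fin 4) (Fin 4) ℝ) i j| +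
    |((g⁻¹).1 : Matrix (Fin 4) (Fin 4) ℝ) i j|)

/-- Uniform moderate growth: the exponent does not depend on the derivative. -/
def HasUniformModerateGrowth (φ : GSp4A → ℂ) : Prop :=
  ∀ gf : GSp4 FinAdele, ∃ r : ℕ, ∀ w : List gsp4, ∃ C : ℝ, ∀ g : GSp4 ℝ,
    ‖diffOp w φ (g, gf)‖ ≤ C * height g ^ r

/-- The integral over `(ℚ \ 𝔸)³` of a function given in the three coordinates of a unipotent radical. -/
noncomputable def integralQuot3 (f : AdeleQ × AdeleQ × AdeleQ → ℂ) : ℂ :=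
  ∫ x, f x ∂(quotMeasure.prod (quotMeasure.prod quotMeasure))

/-- The coordinates `𝔸³ → U(𝔸)`. -/
noncomputable def siegelUA (x : AdeleQ × AdeleQ × AdeleQ) : GSp4A :=
  (siegelU x.1.1 x.2.1.1 x.2.2.1, siegelU x.1.2 x.2.1.2 x.2.2.2)

/-- The coordinates `𝔸³ → U_Q(𝔸)`, with `U_Q` the unipotent radical of the Klingen parabolic.
Since the last coordinate is central, the cube of a fundamental domain of `ℚ \ 𝔸` is one of `U_Q(ℚ) \ U_Q(𝔸)`. -/
noncomputable def klingenUA (x : AdeleQ × AdeleQ × AdeleQ) : GSp4A :=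
  (klingenU x.1.1 x.2.1.1 x.2.2.1, klingenU x.1.2 x.2.1.2 x.2.2.2)

/-- Smooth cusp forms on `GSp₄(𝔸)` with trivial central character. Up to conjugation, every proper
rational parabolic is contained in the Siegel or the Klingen parabolic, so vanishing of these two constant
terms is cuspidality. -/
structure IsCuspForm (φ : GSp4A → ℂ) : Prop where
  left_invariant : ∀ (γ : GSp4 ℚ) (g : GSp4A), φ (diagQ γ * g) = φ g
  central : ∀ (z : ℝˣ) (zf : FinAdeleˣ) (g : GSp4A), φ ((GSp4.center z, GSp4.center zf) * g) = φ g
  smooth : IsSmooth φ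
  zFinite : IsZFinite φ
  growth : HasUniformModerateGrowth φ
  cuspidal_siegel : ∀ g : GSp4A, integralQuot3 (fun x => φ (siegelUA x * g)) = 0
  cuspidal_klingen : ∀ g : GSp4A, integralQuot3 (fun x => φ (klingenUA x * g)) = 0

/-- The action of `GSp₄(𝔸)` by right translation. -/
noncomputable def rightTranslate (h : GSp4A) (φ : GSp4A → ℂ) : GSp4A → ℂ := fun g => φ (g * h)

def IsInvariant (V : Submodule ℂ (GSp4A → ℂ)) : Prop :=
  ∀ h : GSp4A, ∀ φ ∈ V, rightTranslate h φ ∈ V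

/-- `φ` is in the closure of `V` for the topology of uniform convergence on compact sets of all
derivatives. -/
def IsAdherent (V : Submodule ℂ (GSp4A → ℂ)) (φ : GSp4A → ℂ) : Prop :=
  ∀ (C : Set GSp4A), IsCompact C → ∀ (S : Finset (List gsp4)) (ε : ℝ), 0 < ε →
    ∃ ψ ∈ V, ∀ w ∈ S, ∀ g ∈ C, ‖diffOp w (φ - ψ) g‖ < ε

/-- A cuspidal automorphic representation of `PGSp₄(𝔸)`, realised on its smooth vectors: a closed,
right translation invariant, topologically irreducible space of smooth cusp forms. -/
structure IsCuspidalAutomorphicRep (V : Submodule ℂ (GSp4A → ℂ)) : Prop where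
  isCuspForm : ∀ φ ∈ V, IsCuspForm φ
  invariant : IsInvariant V
  closed : ∀ φ, IsCuspForm φ → IsAdherent V φ → φ ∈ V
  ne_bot : V ≠ ⊥
  irreducible : ∀ W ≤ V, IsInvariant W → (∀ φ ∈ V, IsAdherent W φ → φ ∈ W) → W = ⊥ ∨ W = V


/-- An irreducible (strongly continuous) unitary representation of `GSp₄(ℝ)`. -/
structure UnitaryIrrep (E : Type*) [NormedAddCommGroup E] [InnerProductSpace ℂ E] where
  hom : GSp4 ℝ →* (E ≃ₗᵢ[ℂ] E)
  continuous_orbit : ∀ v : E, Continuous fun g => hom g v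
  nontrivial : Nontrivial E
  irreducible : ∀ W : Submodule ℂ E, IsClosed (W : Set E) → (∀ g, ∀ v ∈ W, hom g v ∈ W) →
    W = ⊥ ∨ W = ⊤

section
variable {E : Type*} [NormedAddCommGroup E] [InnerProductSpace ℂ E]

/-- The smooth vectors of a unitary representation: those whose orbit map is smooth (by translation, it
is enough to test this in the exponential chart around the identity). -/
def UnitaryIrrep.smoothVectors (π : UnitaryIrrep E) : Submodule ℂ E where
  carrier := {v | ∀ (n : ℕ) (X : Fin n → gsp4),
    ContDiff ℝ ∞ (fun c : Fin n → ℝ => π.hom (expG (∑ i, c i • X i)) v)}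
  add_mem' := by
    intro v w hv hw n X
    simpa using (hv n X).add (hw n X)
  zero_mem' := by
    intro n X
    simpa using contDiff_const
  smul_mem' := by
    intro a v hv n X
    simpa using (hv n X).const_smul a

theorem conj_mem_gsp4 (h : GSp4 ℝ) (X : gsp4) :
    (h.1 : Matrix (Fin 4) (Fin 4) ℝ) * X.1 * ((h⁻¹).1 : Matrix (Fin 4) (Fin 4) ℝ) ∈ gsp4 := by
  obtain ⟨c, hc⟩ := X.2
  obtain ⟨ν, hν⟩ := (h⁻¹).2
  obtain ⟨μ, hμ⟩ := h.2
  refine ⟨c, ?_⟩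
  set A := (h.1 : Matrix (Fin 4) (Fin 4) ℝ)
  set B := ((h⁻¹).1 : Matrix (Fin 4) (Fin 4) ℝ)
  have hAB : A * B = 1 := by
    have : h.1 * (h⁻¹).1 = 1 := by simp
    exact congrArg Units.val this
  have hJ1 : B * J4 ℝ = (ν : ℝ) • (J4 ℝ * Aᵀ) := by
    have h2 : Bᵀ * Aᵀ = 1 := by rw [← Matrix.transpose_mul, hAB, Matrix.transpose_one]
    rw [← Matrix.smul_mul, ← hν, Matrix.mul_assoc _ _ Aᵀ, h2, Matrix.mul_one]
  have hJ2 : J4 ℝ * Bᵀ = (ν : ℝ) • (A * J4 ℝ) := by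
    rw [← Matrix.mul_smul, ← hν, ← Matrix.mul_assoc, ← Matrix.mul_assoc, hAB, Matrix.one_mul]
  have hνμ : (ν : ℝ) * μ = 1 := by
    have h3 : B * (A * J4 ℝ * Aᵀ) * Bᵀ = J4 ℝ := by
      have hBA : B * A = 1 := by
        have : (h⁻¹).1 * h.1 = 1 := by simp
        exact congrArg Units.val this
      have h2 : Aᵀ * Bᵀ = 1 := by rw [← Matrix.transpose_mul, hBA, Matrix.transpose_one]
      rw [Matrix.mul_assoc, Matrix.mul_assoc _ Aᵀ, h2, Matrix.mul_one, ← Matrix.mul_assoc, hBA,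
        Matrix.one_mul]
    rw [hμ, Matrix.mul_smul, Matrix.smul_mul, hν, smul_smul] at h3
    have := congrFun (congrFun h3 0) 2
    simp [J4] at this
    linarith
  calc A * X.1 * B * J4 ℝ + J4 ℝ * (A * X.1 * B)ᵀ
      = A * X.1 * (B * J4 ℝ) + (J4 ℝ * Bᵀ) * (X.1)ᵀ * Aᵀ := by
        simp only [Matrix.transpose_mul, Matrix.mul_assoc]
    _ = (ν : ℝ) • (A * (X.1 * J4 ℝ + J4 ℝ * (X.1)ᵀ) * Aᵀ) := by
        rw [hJ1, hJ2]
        simp only [Matrix.mul_add, Matrix.add_mul, Matrix.mul_smul, Matrix.smul_mul, smul_add,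
          Matrix.mul_assoc]
    _ = c • J4 ℝ := by
        rw [hc, Matrix.mul_smul, Matrix.smul_mul, hμ, smul_smul, smul_smul]
        congr 1
        linear_combination c * hνμ

theorem UnitaryIrrep.hom_mem_smoothVectors (π : UnitaryIrrep E) (h : GSp4 ℝ) {v : E}
    (hv : v ∈ π.smoothVectors) : π.hom h v ∈ π.smoothVectors := by
  intro n X
  have key : ∀ c : Fin n → ℝ, expG (∑ i, c i • X i) * h =
      h * expG (∑ i, c i • (⟨_, conj_mem_gsp4 h⁻¹ (X i)⟩ : gsp4)) := by
    intro c
    have h1 : (h.1⁻¹ : GL (Fin 4) ℝ).1 * (∑ i, c i • X i : gsp4).1 * (h.1 : Matrix _ _ ℝ) =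
        (∑ i, c i • (⟨_, conj_mem_gsp4 h⁻¹ (X i)⟩ : gsp4) : gsp4).1 := by
      simp [Finset.mul_sum, Finset.sum_mul]
    apply Subtype.ext
    apply Units.ext
    change NormedSpace.exp (∑ i, c i • X i : gsp4).1 * (h.1 : Matrix _ _ ℝ) =
      (h.1 : Matrix _ _ ℝ) * NormedSpace.exp (_ : gsp4).1
    rw [← h1, Matrix.exp_units_conj']
    simp [← Matrix.mul_assoc]
  have : (fun c : Fin n → ℝ => π.hom (expG (∑ i, c i • X i)) (π.hom h v)) = fun c =>
      π.hom h (π.hom (expG (∑ i, c i • (⟨_, conj_mem_gsp4 h⁻¹ (X i)⟩ : gsp4))) v) := by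
    funext c
    change (π.hom _ * π.hom h) v = (π.hom h * π.hom _) v
    rw [← map_mul, key, map_mul]
  rw [this]
  exact ((π.hom h).toContinuousLinearEquiv.toContinuousLinearMap.restrictScalars ℝ).contDiff.comp
    (hv n _)

/-- The action of `GSp₄(ℝ)` on the smooth vectors. -/
def UnitaryIrrep.smoothAct (π : UnitaryIrrep E) (h : GSp4 ℝ) (v : π.smoothVectors) :
    π.smoothVectors := ⟨π.hom h v, π.hom_mem_smoothVectors h v.2⟩

/-- `diff [X₁, …, Xₙ] v = dπ(X₁) ⋯ dπ(Xₙ) v`; the seminorms `‖diff w v‖` define the topology of the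
space of smooth vectors. -/
noncomputable def UnitaryIrrep.diff (π : UnitaryIrrep E) : List gsp4 → E → E
  | [], v => v
  | X :: w, v => deriv (fun t : ℝ => π.hom (expG (t • X)) (π.diff w v)) 0
end

/-- An irreducible smooth representation of `GSp₄(𝔸_f)`. -/
structure SmoothIrrep (W : Type*) [AddCommGroup W] [Module ℂ W] where
  rep : Representation ℂ (GSp4 FinAdele) W
  smooth : ∀ v : W, ∃ K : Subgroup (GSp4 FinAdele), IsOpen (K : Set (GSp4 FinAdele)) ∧
    ∀ k ∈ K, rep k v = v
  irreducible : rep.IsIrreducible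

/-- A factorization `π ≅ π_∞ ⊗ π_f`: an equivariant isomorphism from the tensor product of the smooth
vectors of `π_∞` with `π_f` to the space `V` of `π`, continuous in the first variable. -/
structure Factorization {E W : Type*} [NormedAddCommGroup E] [InnerProductSpace ℂ E]
    [AddCommGroup W] [Module ℂ W] (V : Submodule ℂ (GSp4A → ℂ))
    (πr : UnitaryIrrep E) (πf : SmoothIrrep W) where
  iso : (πr.smoothVectors ⊗[ℂ] W) ≃ₗ[ℂ] V
  equivariant : ∀ (h : GSp4A) (v : πr.smoothVectors) (w : W),
    (iso (πr.smoothAct h.1 v ⊗ₜ[ℂ] πf.rep h.2 w) : GSp4A → ℂ) =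
      rightTranslate h (iso (v ⊗ₜ[ℂ] w) : GSp4A → ℂ)
  continuous : ∀ (w : W) (C : Set GSp4A), IsCompact C → ∀ X : List gsp4,
    ∃ (S : Finset (List gsp4)) (M : ℝ), ∀ v : πr.smoothVectors, ∀ g ∈ C,
      ‖diffOp X (iso (v ⊗ₜ[ℂ] w) : GSp4A → ℂ) g‖ ≤ M * ∑ Y ∈ S, ‖πr.diff Y v‖


/-- `L = ℚ[x]/(x² - D)`, with `x² - D` replaced by `x² + x + (1 - D)/4` if `D ≡ 1 mod 4`; the generator
`α` satisfies `α² = quadA D + quadB D * α`. -/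
def quadA (D : ℤ) : ℤ := if D % 4 = 1 then (D - 1) / 4 else D
/-- See `quadA`. -/
def quadB (D : ℤ) : ℤ := if D % 4 = 1 then -1 else 0

/-- `L ⊗ R`, with elements `re + im * α`. -/
abbrev LAlg (D : ℤ) (R : Type) [CommRing R] : Type := QuadraticAlgebra R (quadA D : R) (quadB D : R)

/-- `GL*_{2,L}(R)`: the matrices in `GL₂(L ⊗ R)` with determinant in `Rˣ`. -/
def GL2Lstar (D : ℤ) (R : Type) [CommRing R] : Subgroup (GL (Fin 2) (LAlg D R)) where
  carrier := {g | ∃ r : Rˣ, (g : Matrix (Fin 2) (Fin 2) (LAlg D R)).det = algebraMap R (LAlg D R) r}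
  one_mem' := ⟨1, by simp⟩
  mul_mem' := by
    rintro g h ⟨r, hr⟩ ⟨t, ht⟩
    exact ⟨r * t, by simp [hr, ht]⟩
  inv_mem' := by
    rintro g ⟨r, hr⟩
    refine ⟨r⁻¹, ?_⟩
    have h1 : (g : Matrix (Fin 2) (Fin 2) (LAlg D R)).det *
        ((g⁻¹ : GL (Fin 2) (LAlg D R)) : Matrix (Fin 2) (Fin 2) (LAlg D R)).det = 1 := by
      rw [← Matrix.det_mul, ← Units.val_mul]; simp
    have h2 : algebraMap R (LAlg D R) ((r⁻¹ : Rˣ) : R) * algebraMap R (LAlg D R) r = 1 := by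
      rw [← map_mul]; simp
    rw [hr] at h1
    calc _ = (algebraMap R (LAlg D R) ((r⁻¹ : Rˣ) : R) * algebraMap R (LAlg D R) r) *
          ((g⁻¹ : GL (Fin 2) (LAlg D R)) : Matrix (Fin 2) (Fin 2) (LAlg D R)).det := by rw [h2, one_mul]
      _ = _ := by rw [mul_assoc, h1, mul_one]

/-- The matrix of right multiplication by `g` on row vectors `(L ⊗ R)²`, in the basis
`e₁ = c₁, e₂ = α c₁, f₁ = -ᾱ c₂ = (α - b) c₂, f₂ = c₂`. -/
def embedMatrix (D : ℤ) (R : Type) [CommRing R] (g : Matrix (Fin 2) (Fin 2) (LAlg D R)) :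
    Matrix (Fin 4) (Fin 4) R :=
  let a : R := quadA D
  let b : R := quadB D
  !![(g 0 0).re, (g 0 0).im, (g 0 1).im, (g 0 1).re + b * (g 0 1).im;
     a * (g 0 0).im, (g 0 0).re + b * (g 0 0).im, (g 0 1).re + b * (g 0 1).im,
       a * (g 0 1).im + b * ((g 0 1).re + b * (g 0 1).im);
     a * (g 1 0).im - b * (g 1 0).re, (g 1 0).re, (g 1 1).re, a * (g 1 1).im;
     (g 1 0).re, (g 1 0).im, (g 1 1).im, (g 1 1).re + b * (g 1 1).im]

open QuadraticAlgebra in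
def embedHom (D : ℤ) (R : Type) [CommRing R] :
    Matrix (Fin 2) (Fin 2) (LAlg D R) →* Matrix (Fin 4) (Fin 4) R where
  toFun := embedMatrix D R
  map_one' := by
    ext i j; fin_cases i <;> fin_cases j <;> simp [embedMatrix]
  map_mul' g h := by
    ext i j
    fin_cases i <;> fin_cases j <;>
      simp [embedMatrix, Matrix.mul_apply, Fin.sum_univ_four, Fin.sum_univ_two] <;> ring

theorem embedMatrix_mul_J4 (D : ℤ) (R : Type) [CommRing R] (g : Matrix (Fin 2) (Fin 2) (LAlg D R)) (r : R)
    (h : g.det = algebraMap R (LAlg D R) r) :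
    embedMatrix D R g * J4 R * (embedMatrix D R g)ᵀ = r • J4 R := by
  rw [Matrix.det_fin_two] at h
  have h1 := congrArg QuadraticAlgebra.re h
  have h2 := congrArg QuadraticAlgebra.im h
  simp at h1 h2
  ext i j
  fin_cases i <;> fin_cases j <;>
      simp [embedMatrix, Matrix.mul_apply, Fin.sum_univ_four, J4] <;> first
      | ring1
      | linear_combination h1
      | linear_combination h2
      | linear_combination -h1
      | linear_combination -h2
      | grind

/-- The embedding `GL*_{2,L}(R) → GSp₄(R)`. -/
def toGSp4 (D : ℤ) (R : Type) [CommRing R] : GL2Lstar D R →* GSp4 R :=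
  ((Units.map (embedHom D R)).comp (GL2Lstar D R).subtype).codRestrict (GSp4 R) (by
    rintro ⟨g, r, hr⟩
    exact ⟨r, embedMatrix_mul_J4 D R _ _ hr⟩)


/-- The standard additive character of `ℚ \ 𝔸`: `ψ_∞(x) = exp(2πix)`, and the largest
`Ẑ`-submodule of `𝔸_f` on which `ψ` is trivial is `Ẑ` (conductor one at all finite places). -/
structure IsStandardAddChar (ψ : AddChar AdeleQ Circle) : Prop where
  continuous : Continuous ψ
  trivial_rat : ∀ q : ℚ, ψ ((q : ℝ), algebraMap ℚ FinAdele q) = 1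
  real : ∀ x : ℝ, (ψ (x, 0) : ℂ) = Complex.exp (2 * Real.pi * Complex.I * x)
  conductor : ∀ x : FinAdele, (∀ y ∈ ZHat, ψ (0, x * y) = 1) ↔ x ∈ ZHat

/-- The character `χ` of `U(𝔸)` in coordinates: `ψ(-D u₁₁ + u₂₂)`, or
`ψ((1 - D)/4 u₁₁ + u₁₂ + u₂₂)` if `D ≡ 1 mod 4`. -/
noncomputable def chiU (D : ℤ) (ψ : AddChar AdeleQ Circle) (x : AdeleQ × AdeleQ × AdeleQ) : ℂ :=
  ψ (if D % 4 = 1 then ((1 - D) / 4) • x.1 + x.2.1 + x.2.2 else -(D • x.1) + x.2.2)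

/-- `φ_χ(g) = ∫_{U(ℚ) \ U(𝔸)} χ⁻¹(u) φ(ug) du`. -/
noncomputable def fourierCoeff (D : ℤ) (ψ : AddChar AdeleQ Circle) (φ : GSp4A → ℂ) (g : GSp4A) : ℂ :=
  integralQuot3 fun x => (chiU D ψ x)⁻¹ * φ (siegelUA x * g)

/-- The functional `H : φ ↦ φ_χ(1)`. -/
noncomputable def functionalH (D : ℤ) (ψ : AddChar AdeleQ Circle) (φ : GSp4A → ℂ) : ℂ :=
  fourierCoeff D ψ φ 1

/-- `f_∞(g, s) = |ν(g)|^{2s} ∫_{ℝˣ} Φ(t f₂ g) |t|^{4s} dt/|t|`; here `f₂ g` is the last row of `g`. -/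
noncomputable def fInfty (Φ : 𝓢(Fin 4 → ℝ, ℂ)) (g : GSp4 ℝ) (s : ℂ) : ℂ :=
  ((|simil g| : ℝ) : ℂ) ^ (2 * s) *
    ∫ t : ℝ, Φ (t • (g.1 : Matrix (Fin 4) (Fin 4) ℝ) 3) * ((|t| : ℝ) : ℂ) ^ (4 * s) / (|t| : ℝ)

/-- The (conull, open) set of row vectors `w = u₃ c₁ + u₄ c₂` with `u₃` a unit. -/
def bigCell (D : ℤ) : Set (Fin 4 → ℝ) := {w | IsUnit (⟨w 0, w 1⟩ : LAlg D ℝ)}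

/-- The matrix `(0, -ε/u₃; u₃, u₄)` of determinant `ε`, where `(u₃, u₄)` is the vector `w` of `W₄(ℝ)`. -/
noncomputable def sectMatrix (D : ℤ) (ε : ℤˣ) (w : Fin 4 → ℝ) :
    Matrix (Fin 2) (Fin 2) (LAlg D ℝ) :=
  !![0, -((ε : ℤ) : LAlg D ℝ) * Ring.inverse ⟨w 0, w 1⟩;
    ⟨w 0, w 1⟩, ⟨w 3 - quadB D * w 2, w 2⟩]

theorem sectMatrix_det (D : ℤ) (ε : ℤˣ) (w : Fin 4 → ℝ) (hw : w ∈ bigCell D) :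
    (sectMatrix D ε w).det = ((ε : ℤ) : LAlg D ℝ) := by
  rw [Matrix.det_fin_two]
  simp [sectMatrix, mul_assoc, Ring.inverse_mul_cancel _ hw]

open Classical in
/-- The element of `GL*_{2,L}(ℝ)` with determinant `ε = ±1` and `f₂ g = w`. -/
noncomputable def sect (D : ℤ) (ε : ℤˣ) (w : Fin 4 → ℝ) : GL2Lstar D ℝ :=
  if hw : w ∈ bigCell D then
    ⟨Matrix.GeneralLinearGroup.mk'' (sectMatrix D ε w) (by
      rw [sectMatrix_det D ε w hw]; exact ε.isUnit.map (Int.castRingHom (LAlg D ℝ))),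
      Units.map (Int.castRingHom ℝ).toMonoidHom ε, by
        change (sectMatrix D ε w).det = _
        rw [sectMatrix_det D ε w hw]; simp⟩
  else 1

/-- The integral over `N(ℝ)Z(ℝ) \ GL*_{2,L}(ℝ)` of a left `N(ℝ)Z(ℝ)`-invariant function, for the right
invariant measure (unique up to scaling). Every coset contains an element of determinant `ε = ±1`, and
`N(ℝ) \ {det = ε}` is identified by `g ↦ f₂ g` with an open set of `W₄(ℝ)`, on which the
invariant measure is the Lebesgue measure; see `exists_eq_sect`, `volume_compl_bigCell` and
`archIntegral_mul_right`. -/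
noncomputable def archIntegral (D : ℤ) (F : GL2Lstar D ℝ → ℂ) : ℂ :=
  ∑ ε : ℤˣ, ∫ w in bigCell D, F (sect D ε w)

/-- Absolute convergence of `archIntegral`. -/
def ArchIntegrable (D : ℤ) (F : GL2Lstar D ℝ → ℂ) : Prop :=
  ∀ ε : ℤˣ, IntegrableOn (fun w => F (sect D ε w)) (bigCell D)

/-- The elements of `N(ℝ)`, the unipotent radical of the upper triangular Borel. -/
def nStar (D : ℤ) (x : LAlg D ℝ) : GL2Lstar D ℝ :=
  ⟨⟨!![1, x; 0, 1], !![1, -x; 0, 1], by simp [Matrix.one_fin_two], by simp [Matrix.one_fin_two]⟩,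
    1, by simp⟩

/-- The elements of the centre `Z(ℝ)`. -/
noncomputable def zStar (D : ℤ) (z : ℝˣ) : GL2Lstar D ℝ :=
  ⟨Units.map (algebraMap ℝ (Matrix (Fin 2) (Fin 2) (LAlg D ℝ))).toMonoidHom z, z * z, by
    simp [Matrix.algebraMap_eq_diagonal, pow_two]⟩

theorem toGSp4_nStar (D : ℤ) (x : LAlg D ℝ) :
   toGSp4 D ℝ (nStar D x) = siegelU x.im (x.re + quadB D * x.im) (quadA D * x.im + quadB D * (x.re + quadB D * x.im)) := by
  apply Subtype.ext
  apply Units.ext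
  change embedMatrix D ℝ _ = _
  ext i j; fin_cases i <;> fin_cases j <;> simp [embedMatrix, siegelU, nStar, QuadraticAlgebra.re_one,QuadraticAlgebra.im_one]

theorem toGSp4_zStar (D : ℤ) (z : ℝˣ) : toGSp4 D ℝ (zStar D z) = GSp4.center z := by
  apply Subtype.ext
  apply Units.ext
  change embedMatrix D ℝ _ = _
  ext i j; fin_cases i <;> fin_cases j <;> simp [embedMatrix, GSp4.center, zStar,Matrix.algebraMap_eq_diagonal]

theorem toGSp4_sect (D : ℤ) (ε : ℤˣ) (w : Fin 4 → ℝ) (hw : w ∈ bigCell D) :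
    ((toGSp4 D ℝ (sect D ε w)).1 : Matrix (Fin 4) (Fin 4) ℝ) 3 = w := by
  rw [sect, dif_pos hw]
  change embedMatrix D ℝ (sectMatrix D ε w) 3 = w
  ext i; fin_cases i <;> simp [embedMatrix, sectMatrix]

theorem sect_val (D : ℤ) (ε : ℤˣ) (w : Fin 4 → ℝ) (hw : w ∈ bigCell D) :
    ((sect D ε w).1 : Matrix (Fin 2) (Fin 2) (LAlg D ℝ)) = sectMatrix D ε w := by
  rw [sect, dif_pos hw]; rfl

/-- Two elements with the same bottom row and the same determinant differ by an element of `N`. -/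
theorem exists_nStar (D : ℤ) (g g' : GL2Lstar D ℝ)
    (hrow : (g.1 : Matrix (Fin 2) (Fin 2) (LAlg D ℝ)) 1 = (g'.1 : Matrix (Fin 2) (Fin 2) _) 1)
    (hdet : (g.1 : Matrix (Fin 2) (Fin 2) (LAlg D ℝ)).det = (g'.1 : Matrix (Fin 2) (Fin 2) _).det) :
    ∃ x, g = nStar D x * g' := by
  set k : GL (Fin 2) (LAlg D ℝ) := g.1 * g'.1⁻¹ with hk
  have hgg : (g'.1 : Matrix (Fin 2) (Fin 2) (LAlg D ℝ)) * ((g'.1⁻¹ : GL (Fin 2) (LAlg D ℝ)) : Matrix _ _ _)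
      = 1 := by rw [← Units.val_mul]; simp
  have hrowk : (k : Matrix (Fin 2) (Fin 2) (LAlg D ℝ)) 1 = (1 : Matrix (Fin 2) (Fin 2) (LAlg D ℝ)) 1 := by
    rw [← hgg, hk, Units.val_mul]
    ext j : 1
    simp only [Matrix.mul_apply, hrow]
  have hdetk : (k : Matrix (Fin 2) (Fin 2) (LAlg D ℝ)).det = 1 := by
    rw [hk, Units.val_mul, Matrix.det_mul, hdet, ← Matrix.det_mul, hgg, Matrix.det_one]
  have h10 : (k : Matrix (Fin 2) (Fin 2) (LAlg D ℝ)) 1 0 = 0 := by rw [hrowk]; simp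
  have h11 : (k : Matrix (Fin 2) (Fin 2) (LAlg D ℝ)) 1 1 = 1 := by rw [hrowk]; simp
  rw [Matrix.det_fin_two, h10, h11] at hdetk
  refine ⟨(k : Matrix (Fin 2) (Fin 2) (LAlg D ℝ)) 0 1, ?_⟩
  have hkn : k = (nStar D ((k : Matrix (Fin 2) (Fin 2) (LAlg D ℝ)) 0 1)).1 := by
    apply Units.ext
    refine Matrix.ext fun i j => ?_
    fin_cases i <;> fin_cases j <;> simp [nStar, h10, h11]
    simpa using hdetk
  apply Subtype.ext
  change g.1 = (nStar D _).1 * g'.1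
  rw [← hkn, hk]; simp

/-- Every element whose lower left entry is a unit is `n z (sect ε w)` with `n ∈ N`, `z ∈ Z`. -/
theorem exists_eq_sect (D : ℤ) (g : GL2Lstar D ℝ) (r : ℝˣ) (z : ℝˣ) (ε : ℤˣ)
    (hr : (g.1 : Matrix (Fin 2) (Fin 2) (LAlg D ℝ)).det = algebraMap ℝ (LAlg D ℝ) r)
    (hz : (r : ℝ) = (z : ℝ) ^ 2 * ((ε : ℤ) : ℝ))
    (hw : (z⁻¹ : ℝˣ).val • ((toGSp4 D ℝ g).1 : Matrix (Fin 4) (Fin 4) ℝ) 3 ∈ bigCell D) :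
    ∃ x, g = nStar D x * (zStar D z *
      sect D ε ((z⁻¹ : ℝˣ).val • ((toGSp4 D ℝ g).1 : Matrix (Fin 4) (Fin 4) ℝ) 3)) := by
  apply exists_nStar
  · change _ = ((algebraMap ℝ (Matrix (Fin 2) (Fin 2) (LAlg D ℝ)) z : Matrix (Fin 2) (Fin 2) (LAlg D ℝ)) * ((sect D ε _).1 : Matrix (Fin 2) (Fin 2) (LAlg D ℝ))) 1
    rw [sect_val _ _ _ hw]
    change _ = ((algebraMap ℝ (Matrix (Fin 2) (Fin 2) (LAlg D ℝ)) z : Matrix (Fin 2) (Fin 2) (LAlg D ℝ)) *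
      sectMatrix D ε ((z⁻¹ : ℝˣ).val • embedMatrix D ℝ g.1 3)) 1
    ext i : 1
    fin_cases i <;> simp [Matrix.algebraMap_eq_diagonal, sectMatrix, embedMatrix] <;>
      ext <;> simp <;> field_simp <;> ring
  · change _ = ((algebraMap ℝ (Matrix (Fin 2) (Fin 2) (LAlg D ℝ)) z : Matrix (Fin 2) (Fin 2) (LAlg D ℝ)) * ((sect D ε _).1 : Matrix (Fin 2) (Fin 2) (LAlg D ℝ))).det
    rw [sect_val _ _ _ hw, Matrix.det_mul, sectMatrix_det _ _ _ hw, hr, hz]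
    simp [Matrix.algebraMap_eq_diagonal]

theorem isUnit_iff_sq (D : ℤ) (w : Fin 4 → ℝ) :
    w ∈ bigCell D ↔ w 0 ^ 2 + quadB D * (w 0 * w 1) - quadA D * w 1 ^ 2 ≠ 0 := by
  unfold bigCell
  rw [Set.mem_ofPred_eq, QuadraticAlgebra.isUnit_iff_norm_isUnit, isUnit_iff_ne_zero,
    QuadraticAlgebra.norm_def]
  ring_nf

theorem measurableSet_bigCell (D : ℤ) : MeasurableSet (bigCell D) := by
  have : bigCell D = {w : Fin 4 → ℝ | w 0 ^ 2 + quadB D * (w 0 * w 1) - quadA D * w 1 ^ 2 ≠ 0} := by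
    ext w; exact isUnit_iff_sq D w
  rw [this]
  exact (isOpen_ne_fun (by fun_prop) continuous_const).measurableSet

theorem volume_compl_bigCell (D : ℤ) : volume (bigCell D)ᶜ = 0 := by
  set Δ : ℝ := (quadB D : ℝ) ^ 2 + 4 * quadA D
  let l : ℝ → ((Fin 4 → ℝ) →ₗ[ℝ] ℝ) := fun c =>
    (2 : ℝ) • LinearMap.proj 0 + c • LinearMap.proj 1
  have hl : ∀ c, volume ((LinearMap.ker (l c) : Submodule ℝ (Fin 4 → ℝ)) : Set (Fin 4 → ℝ)) = 0 := by
    intro c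
    apply Measure.addHaar_submodule
    intro h
    have : (Pi.single 0 1 : Fin 4 → ℝ) ∈ LinearMap.ker (l c) := by rw [h]; trivial
    simp [l] at this
  refine measure_mono_null ?_ (measure_union_null (hl (quadB D - √Δ)) (hl (quadB D + √Δ)))
  intro w hw
  rw [Set.mem_compl_iff, isUnit_iff_sq, not_not] at hw
  simp only [Set.mem_union, SetLike.mem_coe, LinearMap.mem_ker, l, LinearMap.add_apply,
    LinearMap.smul_apply, LinearMap.proj_apply, smul_eq_mul]
  have hsq : (2 * w 0 + quadB D * w 1) ^ 2 = Δ * w 1 ^ 2 := by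
    simp only [Δ]; linear_combination 4 * hw
  rcases le_or_gt 0 Δ with h | h
  · have h2 : (2 * w 0 + (quadB D - √Δ) * w 1) * (2 * w 0 + (quadB D + √Δ) * w 1) = 0 := by
      have := Real.sq_sqrt h
      linear_combination hsq - w 1 ^ 2 * this
    exact mul_eq_zero.1 h2
  · left
    rw [Real.sqrt_eq_zero_of_nonpos h.le]
    have h0 : (2 * w 0 + quadB D * w 1) ^ 2 = 0 :=
      le_antisymm (by rw [hsq]; exact mul_nonpos_of_nonpos_of_nonneg h.le (sq_nonneg _)) (sq_nonneg _)
    have := pow_eq_zero_iff (two_ne_zero) |>.1 h0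
    linarith

theorem J4_det : (J4 ℝ).det = 1 := by
  simp [J4, Matrix.det_succ_row_zero, Fin.sum_univ_succ, Fin.succAbove]

/-- `archIntegral` is an invariant integral on `N(ℝ)Z(ℝ) \ GL*_{2,L}(ℝ)`. -/
theorem archIntegral_mul_right (D : ℤ) (F : GL2Lstar D ℝ → ℂ)
    (hN : ∀ x g, F (nStar D x * g) = F g) (hZ : ∀ z g, F (zStar D z * g) = F g)
    (h : GL2Lstar D ℝ) :
    archIntegral D (fun g => F (g * h)) = archIntegral D F := by
  obtain ⟨r, hr⟩ := h.2
  obtain ⟨z, η, hz⟩ : ∃ (z : ℝˣ) (η : ℤˣ), (r : ℝ) = (z : ℝ) ^ 2 * ((η : ℤ) : ℝ) := by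
    rcases lt_or_gt_of_ne r.ne_zero with h0 | h0
    · refine ⟨Units.mk0 (√(-r)) (Real.sqrt_ne_zero'.2 (by linarith)), -1, ?_⟩
      simp [Real.sq_sqrt (by linarith : 0 ≤ -(r : ℝ))]
    · refine ⟨Units.mk0 (√r) (Real.sqrt_ne_zero'.2 h0), 1, ?_⟩
      simp [Real.sq_sqrt h0.le]
  set M : Matrix (Fin 4) (Fin 4) ℝ := (z⁻¹ : ℝˣ).val • ((toGSp4 D ℝ h).1 : Matrix (Fin 4) (Fin 4) ℝ) with hM
  let T : (Fin 4 → ℝ) →ₗ[ℝ] (Fin 4 → ℝ) := Matrix.toLin' Mᵀ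
  have hT : ∀ w, T w = Matrix.vecMul w M := by
    intro w; simp [T, Matrix.toLin'_apply, Matrix.mulVec_transpose]
  have hMJ : M * J4 ℝ * Mᵀ = ((η : ℤ) : ℝ) • J4 ℝ := by
    have := embedMatrix_mul_J4 D ℝ h.1 r hr
    change (toGSp4 D ℝ h).1.1 * _ * (toGSp4 D ℝ h).1.1ᵀ = _ at this
    rw [hM, Matrix.transpose_smul, Matrix.mul_smul, Matrix.smul_mul, Matrix.smul_mul, this, smul_smul,
      smul_smul, hz]
    congr 1
    simp
    field_simp
  have hη : (((η : ℤ) : ℝ)) ^ 4 = 1 := by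
    rcases Int.units_eq_one_or η with rfl | rfl <;> norm_num
  have hdet : |LinearMap.det T| = 1 := by
    have h1 := congrArg Matrix.det hMJ
    rw [Matrix.det_mul, Matrix.det_mul, Matrix.det_smul (J4 ℝ), J4_det, Matrix.det_transpose] at h1
    have h2 : M.det * M.det = 1 := by
      simpa only [mul_one, Fintype.card_fin, hη] using h1
    rw [LinearMap.det_toLin', Matrix.det_transpose]
    rcases mul_self_eq_one_iff.1 h2 with h3 | h3 <;> simp only [h3, abs_neg, abs_one]
  have hdet0 : LinearMap.det T ≠ 0 := by intro h0; rw [h0] at hdet; simp at hdet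
  have hmap : Measure.map T volume = volume := by
    rw [Measure.map_linearMap_addHaar_eq_smul_addHaar _ hdet0, abs_inv, hdet]; simp
  let Te : (Fin 4 → ℝ) ≃L[ℝ] (Fin 4 → ℝ) := (LinearEquiv.ofIsUnitDet (f := T) (v := Pi.basisFun ℝ (Fin 4))
    (v' := Pi.basisFun ℝ (Fin 4)) (by rw [LinearMap.det_toMatrix]; exact isUnit_iff_ne_zero.2 hdet0)).toContinuousLinearEquiv
  have hmp : MeasurePreserving Te volume volume := ⟨Te.continuous.measurable, hmap⟩
  have hae : ∀ᵐ w ∂(volume : Measure (Fin 4 → ℝ)), w ∈ bigCell D := by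
    rw [ae_iff]; exact volume_compl_bigCell D
  have hae2 : ∀ᵐ w ∂(volume : Measure (Fin 4 → ℝ)), Te w ∈ bigCell D :=
    hmp.quasiMeasurePreserving.ae hae
  have hres : volume.restrict (bigCell D) = volume := Measure.restrict_eq_self_of_ae_mem hae
  have key : ∀ ε : ℤˣ, ∫ w in bigCell D, F (sect D ε w * h) = ∫ w in bigCell D, F (sect D (ε * η) w) := by
    intro ε
    rw [hres]
    conv_rhs => rw [← hmp.integral_comp Te.toHomeomorph.measurableEmbedding]
    apply integral_congr_ae
    filter_upwards [hae, hae2] with w hw hw2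
    have hrow : (z⁻¹ : ℝˣ).val • ((toGSp4 D ℝ (sect D ε w * h)).1 : Matrix (Fin 4) (Fin 4) ℝ) 3 = Te w := by
      change _ = T w
      rw [hT, hM, map_mul]
      change (z⁻¹ : ℝˣ).val • (((toGSp4 D ℝ (sect D ε w)).1 : Matrix (Fin 4) (Fin 4) ℝ) * (toGSp4 D ℝ h).1.1) 3 = _
      rw [Matrix.vecMul_smul]
      congr 1
      conv_rhs => rw [← toGSp4_sect D ε w hw]
      rfl
    have hdet2 : ((sect D ε w * h).1 : Matrix (Fin 2) (Fin 2) (LAlg D ℝ)).det =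
        algebraMap ℝ (LAlg D ℝ) (Units.map (Int.castRingHom ℝ).toMonoidHom ε * r : ℝˣ) := by
      change (((sect D ε w).1 : Matrix (Fin 2) (Fin 2) (LAlg D ℝ)) * h.1.1).det = _
      rw [Matrix.det_mul, sect_val _ _ _ hw, sectMatrix_det _ _ _ hw, hr]
      simp
    obtain ⟨x, hx⟩ := exists_eq_sect D (sect D ε w * h) _ z (ε * η) hdet2 (by simp [hz]; ring)
      (by rw [hrow]; exact hw2)
    rw [hx, hN, hZ, hrow]
  unfold archIntegral
  simp_rw [key]
  exact Fintype.sum_equiv (Equiv.mulRight η) _ _ (fun ε => rfl)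

/-- The integrand `H(π(g)φ) f_∞(g, s)` of the archimedean integral. -/
noncomputable def archIntegrand (D : ℤ) (ψ : AddChar AdeleQ Circle) (Φ : 𝓢(Fin 4 → ℝ, ℂ))
    (φ : GSp4A → ℂ) (s : ℂ) (g : GL2Lstar D ℝ) : ℂ :=
  functionalH D ψ (rightTranslate (toGSp4 D ℝ g, 1) φ) * fInfty Φ (toGSp4 D ℝ g) s

/-- `J_∞(φ, s) = ∫_{N(ℝ)Z(ℝ) \ GL*_{2,L}(ℝ)} H(π(g)φ) f_∞(g, s) dg`. -/
noncomputable def JInfty (D : ℤ) (ψ : AddChar AdeleQ Circle) (Φ : 𝓢(Fin 4 → ℝ, ℂ))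
    (φ : GSp4A → ℂ) (s : ℂ) : ℂ :=
  archIntegral D (archIntegrand D ψ Φ φ s)

end KS

open KS

open scoped Topology

namespace KS

attribute [local instance 100] LieRing.ofAssociativeRing

/-! ### Local smoothness on `GSp₄(ℝ)` -/

section LocalSmoothness
open scoped Matrix.Norms.Operator

/-! The function `realCoeff D ψ φ g` is `H(π(g)φ)` on `GSp₄(ℝ)`. Along the section `sectG D ε w` the
archimedean integral becomes the sum over `ε = ±1` of the integrals over the big cell of `h_ε(w) ∫
Φ(tw) |t|^{4s} dt/|t|`, where `h_ε(w) = realCoeff D ψ φ (sectG D ε w)`. Take `Φ` with compact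
support in the big cell. Fubini and the substitution `k = tw` turn this into `2 ∫_0^∞ A(t) t^{4s-5}
dt`, twice a Mellin transform at `4s - 4`, where `A(t) = ∫ h(t⁻¹k) Φ(k) dk` and `h = ∑ h_ε`. If it
vanished for all large `s`, Mellin inversion would give `A(1) = ∫ hΦ = 0`, which fails for a bump
`Φ` at a point where `h ≠ 0` (`dilationAverage_one_eq_zero`, `exists_schwartz_integral_ne_zero`).

Convergence needs moderate growth of `h_ε` at infinity and rapid decay at the origin, on the cone
over the support of `Φ`. Growth is inherited from `φ`. For decay, let `X` generate the last
coordinate of `U(ℝ)`. The coefficient is an eigenfunction of left translation by `exp(sX)`, that is,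
of right translation by `exp(s g⁻¹Xg)`; hence applying `R(g⁻¹Xg)` to `φ` multiplies the coefficient
at `g` by `2πi` (`realCoeff_deriv`). On the section the entries of `g⁻¹Xg` are quadratic in `w`, so
`n` derivatives gain `‖w‖^{2n}`, while uniform moderate growth keeps the loss at a fixed power of
`‖w‖⁻¹` (`norm_realCoeff_le_pow`, `rapidOnCone_realCoeff`).

It remains to choose the archimedean vector so that the two signs of the determinant do not cancel
at one point of the big cell. The two section values there differ by an element inverting `U`;
translating the vector by `u(z)` gives them the phases `e(z)` and `e(-z)`, which separates them
(`exists_sum_realCoeff_ne_zero`). -/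

theorem simil_spec {R : Type*} [CommRing R] (g : GSp4 R) :
    (g.1 : Matrix (Fin 4) (Fin 4) R) * J4 R * (g.1 : Matrix (Fin 4) (Fin 4) R)ᵀ
      = simil g • J4 R := by
  obtain ⟨ν, hν⟩ := g.2
  have : simil g = ν := by rw [simil, hν]; simp [J4]
  rw [this, hν]

theorem GSp4.val_mul (g h : GSp4 ℝ) :
    ((g * h).1 : Matrix (Fin 4) (Fin 4) ℝ) = (g.1 : Matrix (Fin 4) (Fin 4) ℝ) * h.1.1 := rfl

theorem GSp4.val_one : ((1 : GSp4 ℝ).1 : Matrix (Fin 4) (Fin 4) ℝ) = 1 := rfl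

theorem GSp4.inv_mul_val (g : GSp4 ℝ) :
    ((g⁻¹).1 : Matrix (Fin 4) (Fin 4) ℝ) * g.1.1 = 1 := by
  rw [← GSp4.val_mul, inv_mul_cancel, GSp4.val_one]

theorem GSp4.mul_inv_val (g : GSp4 ℝ) :
    (g.1 : Matrix (Fin 4) (Fin 4) ℝ) * (g⁻¹).1.1 = 1 := by
  rw [← GSp4.val_mul, mul_inv_cancel, GSp4.val_one]

theorem GSp4.continuous_val :
    Continuous (fun g : GSp4 ℝ => (g.1.1 : Matrix (Fin 4) (Fin 4) ℝ)) :=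
  Units.continuous_val.comp continuous_subtype_val

/-- Solving `h J ᵗh = ν J` for the inverse. Up to the similitude, the entries of `h⁻¹` are those of
`h`, permuted and with signs; the logarithm, the heights and the continuity of the section all use
this. -/
theorem simil_smul_inv (h : GSp4 ℝ) :
    simil h • (h⁻¹).1.1 = J4 ℝ * (h.1.1 : Matrix (Fin 4) (Fin 4) ℝ)ᵀ * (-J4 ℝ) := by
  have hJ : J4 ℝ * -J4 ℝ = 1 := by simp [J4_mul_J4]
  have h6 := congrArg (fun M => (h⁻¹).1.1 * M * (-J4 ℝ)) (simil_spec h)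
  simp only [Matrix.mul_smul, Matrix.smul_mul] at h6
  rw [mul_assoc _ (J4 ℝ) (-J4 ℝ), hJ, mul_one] at h6
  rw [← h6, ← mul_assoc, ← mul_assoc, GSp4.inv_mul_val, one_mul]

theorem contDiff_matrix_exp :
    ContDiff ℝ ∞ (NormedSpace.exp : Matrix (Fin 4) (Fin 4) ℝ → Matrix (Fin 4) (Fin 4) ℝ) := by
  rw [contDiff_iff_contDiffAt]; intro x
  exact (NormedSpace.exp_analytic (𝕂 := ℝ) x).contDiffAt

/-- A local logarithm at the identity. -/
theorem exists_matrix_log : ∃ L : Matrix (Fin 4) (Fin 4) ℝ → Matrix (Fin 4) (Fin 4) ℝ,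
    ContDiffAt ℝ ∞ L 1 ∧ L 1 = 0 ∧ (∀ᶠ h in 𝓝 1, NormedSpace.exp (L h) = h) ∧
      ∀ᶠ x in 𝓝 0, L (NormedSpace.exp x) = x := by
  have h1 := contDiff_matrix_exp.contDiffAt (x := 0)
  have h2 : HasFDerivAt (𝕜 := ℝ)
      (NormedSpace.exp : Matrix (Fin 4) (Fin 4) ℝ → Matrix (Fin 4) (Fin 4) ℝ)
      ((ContinuousLinearEquiv.refl ℝ (Matrix (Fin 4) (Fin 4) ℝ) :
        Matrix (Fin 4) (Fin 4) ℝ ≃L[ℝ] Matrix (Fin 4) (Fin 4) ℝ) :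
        Matrix (Fin 4) (Fin 4) ℝ →L[ℝ] Matrix (Fin 4) (Fin 4) ℝ) 0 :=
    (hasStrictFDerivAt_exp_zero (𝕂 := ℝ) (𝔸 := Matrix (Fin 4) (Fin 4) ℝ)).hasFDerivAt
  have h0 : NormedSpace.exp (0 : Matrix (Fin 4) (Fin 4) ℝ) = 1 := NormedSpace.exp_zero
  refine ⟨h1.localInverse h2 (by simp), ?_, ?_, ?_, ?_⟩
  · have := h1.to_localInverse h2 (by simp)
    rwa [h0] at this
  · have := h1.localInverse_apply_image h2 (by simp)
    rwa [h0] at this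
  · have := (h1.hasStrictFDerivAt' h2 (by simp)).eventually_right_inverse
    rwa [h0] at this
  · exact (h1.hasStrictFDerivAt' h2 (by simp)).eventually_left_inverse

/-- With `X = L h`, the identity `J ᵗh J⁻¹ = ν h⁻¹` reads `exp(J ᵗX J⁻¹) = exp(log ν - X)`. Both
exponents are near `0`, where `L` is a left inverse of `exp`, so they are equal; this is the
equation defining the Lie algebra. -/
theorem eventually_log_mem {L : Matrix (Fin 4) (Fin 4) ℝ → Matrix (Fin 4) (Fin 4) ℝ}
    (hL : ContinuousAt L 1) (hL1 : L 1 = 0) (hr : ∀ᶠ h in 𝓝 1, NormedSpace.exp (L h) = h)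
    (hl : ∀ᶠ x in 𝓝 0, L (NormedSpace.exp x) = x) :
    ∀ᶠ h : GSp4 ℝ in 𝓝 1, L h.1.1 ∈ gsp4 := by
  have hval : Filter.Tendsto (fun g : GSp4 ℝ => (g.1.1 : Matrix (Fin 4) (Fin 4) ℝ)) (𝓝 1) (𝓝 1) :=
    GSp4.continuous_val.continuousAt (x := (1 : GSp4 ℝ))
  have hX : Filter.Tendsto (fun g : GSp4 ℝ => L g.1.1) (𝓝 1) (𝓝 0) := by
    have := hL.tendsto.comp hval
    rwa [hL1] at this
  have hν : Filter.Tendsto (fun g : GSp4 ℝ => simil g) (𝓝 1) (𝓝 1) := by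
    have hc : Continuous (fun M : Matrix (Fin 4) (Fin 4) ℝ => (M * J4 ℝ * Mᵀ) 0 2) := by fun_prop
    have := (hc.continuousAt (x := 1)).tendsto.comp hval
    have h1 : ((1 : Matrix (Fin 4) (Fin 4) ℝ) * J4 ℝ * (1 : Matrix (Fin 4) (Fin 4) ℝ)ᵀ) 0 2 = 1 := by
      simp [J4]
    rwa [h1] at this
  have hZ : Filter.Tendsto (fun g : GSp4 ℝ => J4 ℝ * (L g.1.1)ᵀ * (-J4 ℝ)) (𝓝 1) (𝓝 0) := by
    have hc : Continuous (fun M : Matrix (Fin 4) (Fin 4) ℝ => J4 ℝ * Mᵀ * (-J4 ℝ)) := by fun_prop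
    have := (hc.continuousAt (x := 0)).tendsto.comp hX
    simpa [Function.comp_def] using this
  have hW : Filter.Tendsto (fun g : GSp4 ℝ =>
      Real.log (simil g) • (1 : Matrix (Fin 4) (Fin 4) ℝ) + -(L g.1.1)) (𝓝 1) (𝓝 0) := by
    have := ((hν.log one_ne_zero).smul_const (1 : Matrix (Fin 4) (Fin 4) ℝ)).add hX.neg
    simpa using this
  filter_upwards [hval.eventually hr, hZ.eventually hl, hW.eventually hl,
    hν.eventually (lt_mem_nhds zero_lt_one)] with h h1 h2 h3 h4
  set X := L h.1.1
  have hJ : J4 ℝ * -J4 ℝ = 1 := by simp [J4_mul_J4]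
  have hJ' : -J4 ℝ * J4 ℝ = 1 := by simp [J4_mul_J4]
  have e1 : NormedSpace.exp (J4 ℝ * Xᵀ * (-J4 ℝ)) = J4 ℝ * h.1.1ᵀ * (-J4 ℝ) := by
    have hu := Matrix.exp_units_conj (⟨J4 ℝ, -J4 ℝ, hJ, hJ'⟩ : (Matrix (Fin 4) (Fin 4) ℝ)ˣ) Xᵀ
    change NormedSpace.exp (J4 ℝ * Xᵀ * (-J4 ℝ)) = J4 ℝ * NormedSpace.exp Xᵀ * (-J4 ℝ) at hu
    rw [hu, Matrix.exp_transpose, h1]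
  have e2 : NormedSpace.exp (Real.log (simil h) • (1 : Matrix (Fin 4) (Fin 4) ℝ) + -X) =
      simil h • (h⁻¹).1.1 := by
    rw [Matrix.exp_add_of_commute _ _ ((Commute.one_left _).smul_left _), Matrix.smul_one_eq_diagonal,
      Matrix.exp_diagonal]
    have hinv : NormedSpace.exp (-X) = (h⁻¹).1.1 := by
      have h5 : NormedSpace.exp (-X) * NormedSpace.exp X = 1 := by
        rw [← Matrix.exp_add_of_commute _ _ (Commute.neg_left (Commute.refl X))]; simp
      rw [h1] at h5
      calc _ = NormedSpace.exp (-X) * (h.1.1 * (h⁻¹).1.1) := by rw [GSp4.mul_inv_val, mul_one]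
        _ = _ := by rw [← mul_assoc, h5, one_mul]
    have hd : NormedSpace.exp (fun _ : Fin 4 => Real.log (simil h)) = fun _ => simil h := by
      funext i
      rw [Pi.coe_exp, ← Real.exp_eq_exp_ℝ, Real.exp_log h4]
    rw [hinv, hd, ← Matrix.smul_one_eq_diagonal, Matrix.smul_mul, one_mul]
  have e4 : J4 ℝ * Xᵀ * (-J4 ℝ) = Real.log (simil h) • (1 : Matrix (Fin 4) (Fin 4) ℝ) + -X := by
    rw [← h2, ← h3, e1, e2, simil_smul_inv]
  refine ⟨Real.log (simil h), ?_⟩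
  have e5 := congrArg (fun M => M * J4 ℝ) e4
  simp only [mul_assoc, hJ', mul_one, add_mul, Matrix.smul_mul, one_mul, neg_mul] at e5
  rw [e5]; simp

/-- A function on `GSp₄(ℝ)` that extends locally to a smooth function of the matrix entries. -/
def LocSmooth (f : GSp4 ℝ → ℂ) : Prop :=
  ∀ g₀ : GSp4 ℝ, ∃ G : Matrix (Fin 4) (Fin 4) ℝ → ℂ,
    ContDiffAt ℝ ∞ G g₀.1.1 ∧ ∀ᶠ g in 𝓝 g₀, f g = G g.1.1

theorem LocSmooth.continuous {f : GSp4 ℝ → ℂ} (h : LocSmooth f) : Continuous f := by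
  rw [continuous_iff_continuousAt]
  intro g₀
  obtain ⟨G, hG, he⟩ := h g₀
  have h1 : ContinuousAt (fun g : GSp4 ℝ => G g.1.1) g₀ :=
    ContinuousAt.comp (g := G) hG.continuousAt GSp4.continuous_val.continuousAt
  exact h1.congr (he.mono fun _ h => h.symm)

/-- Smoothness in the exponential charts implies local smoothness in the matrix entries. -/
theorem locSmooth_of_exp_chart {f : GSp4 ℝ → ℂ}
    (hf : ∀ (g : GSp4 ℝ) (n : ℕ) (X : Fin n → gsp4),
      ContDiff ℝ ∞ (fun c : Fin n → ℝ => f (g * expG (∑ i, c i • X i)))) : LocSmooth f := by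
  intro g₀
  obtain ⟨L, hL, hL1, hr, hl⟩ := exists_matrix_log
  let B := Module.finBasis ℝ gsp4
  let ι : gsp4 →ₗ[ℝ] Matrix (Fin 4) (Fin 4) ℝ := gsp4.toSubmodule.subtype
  obtain ⟨P, hP⟩ := LinearMap.exists_leftInverse_of_injective ι
    (LinearMap.ker_eq_bot.2 Subtype.val_injective)
  let C : Matrix (Fin 4) (Fin 4) ℝ →ₗ[ℝ] (Fin (Module.finrank ℝ gsp4) → ℝ) :=
    B.equivFun.toLinearMap ∘ₗ P
  have hC : ∀ X : gsp4, ∑ i, C X.1 i • B i = X := by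
    intro X
    have : P X.1 = X := LinearMap.congr_fun hP X
    simp only [C, LinearMap.comp_apply, this]
    exact B.sum_equivFun X
  let A : Matrix (Fin 4) (Fin 4) ℝ →ₗ[ℝ] Matrix (Fin 4) (Fin 4) ℝ :=
    LinearMap.mulLeft ℝ (g₀⁻¹).1.1
  have hA1 : A g₀.1.1 = 1 := GSp4.inv_mul_val g₀
  -- The local extension reads `f` in the exponential chart at `g₀`, after projecting the logarithm
  -- of `g₀⁻¹ M` linearly onto the Lie algebra.
  refine ⟨fun M => f (g₀ * expG (∑ i, C (L (A M)) i • B i)), ?_, ?_⟩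
  · have hA : ContDiff ℝ ∞ A := (LinearMap.toContinuousLinearMap A).contDiff
    have hC' : ContDiff ℝ ∞ C := (LinearMap.toContinuousLinearMap C).contDiff
    have h1 : ContDiffAt ℝ ∞ (fun M => L (A M)) g₀.1.1 :=
      ContDiffAt.comp (g := L) _ (by rw [hA1]; exact hL) hA.contDiffAt
    exact (hf g₀ _ B).contDiffAt.comp _ (hC'.contDiffAt.comp _ h1)
  · have ht : Filter.Tendsto (fun g : GSp4 ℝ => g₀⁻¹ * g) (𝓝 g₀) (𝓝 1) := by
      have := (continuous_const_mul (g₀⁻¹)).continuousAt (x := g₀)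
      rwa [ContinuousAt, inv_mul_cancel] at this
    have hval : Filter.Tendsto (fun g : GSp4 ℝ => (g.1.1 : Matrix (Fin 4) (Fin 4) ℝ)) (𝓝 1) (𝓝 1) :=
      GSp4.continuous_val.continuousAt (x := (1 : GSp4 ℝ))
    filter_upwards [ht.eventually (eventually_log_mem hL.continuousAt hL1 hr hl),
      ht.eventually (hval.eventually hr)] with g h1 h2
    have h3 : A g.1.1 = (g₀⁻¹ * g).1.1 := rfl
    congr 1
    rw [h3, hC ⟨_, h1⟩]
    have : expG ⟨_, h1⟩ = g₀⁻¹ * g := Subtype.ext (Units.ext h2)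
    rw [this, mul_inv_cancel_left]

end LocalSmoothness

/-! ### Right derivatives of smooth functions -/

/-- Functions on `GSp₄(𝔸)` that are locally smooth in the real variable. -/
def LocSmoothA (f : GSp4A → ℂ) : Prop := ∀ gf, LocSmooth fun g => f (g, gf)

theorem IsSmooth.locSmoothA {f : GSp4A → ℂ} (hf : IsSmooth f) : LocSmoothA f := by
  intro gf
  refine locSmooth_of_exp_chart fun g n X => ?_
  simpa using hf.2 (g, gf) n X

/-! ### One-parameter subgroups and right derivatives -/

section
open scoped Matrix.Norms.Operator

theorem expG_zero : expG 0 = 1 := by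
  apply Subtype.ext; apply Units.ext
  change NormedSpace.exp (0 : Matrix (Fin 4) (Fin 4) ℝ) = 1
  exact NormedSpace.exp_zero

theorem expG_add_smul (s t : ℝ) (X : gsp4) :
    expG ((s + t) • X) = expG (s • X) * expG (t • X) := by
  apply Subtype.ext; apply Units.ext
  change NormedSpace.exp ((s + t) • X.1) = NormedSpace.exp (s • X.1) * NormedSpace.exp (t • X.1)
  rw [add_smul, Matrix.exp_add_of_commute]
  exact ((Commute.refl X.1).smul_left s).smul_right t

theorem expG_inv (X : gsp4) : (expG X)⁻¹ = expG (-X) := by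
  rw [inv_eq_iff_mul_eq_one]
  have := expG_add_smul 1 (-1) X
  simp only [add_neg_cancel, zero_smul, expG_zero, one_smul, neg_smul] at this
  exact this.symm

theorem continuous_expG_smul (X : gsp4) : Continuous fun t : ℝ => expG (t • X) := by
  have hc : Continuous fun t : ℝ => NormedSpace.exp (t • X.1) :=
    contDiff_matrix_exp.continuous.comp (continuous_id.smul continuous_const)
  refine Continuous.subtype_mk (Units.continuous_iff.2 ⟨hc, ?_⟩) _
  have h2 : Continuous fun t : ℝ => NormedSpace.exp ((-t) • X.1) := hc.comp continuous_neg
  refine h2.congr fun t => ?_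
  have := expG_inv (t • X)
  rw [← neg_smul] at this
  exact (congrArg (fun g : GSp4 ℝ => g.1.1) this).symm

/-- Chain rule for the curve `g exp(tX)`, whose velocity at `0` is `gX`. The value is visibly linear
in `X`, which allows derivatives along a `g`-dependent direction to be expanded in a fixed basis. -/
theorem hasDerivAt_of_local_extension {f : GSp4 ℝ → ℂ} {G : Matrix (Fin 4) (Fin 4) ℝ → ℂ}
    {g : GSp4 ℝ} (hG : DifferentiableAt ℝ G g.1.1) (he : ∀ᶠ h in 𝓝 g, f h = G h.1.1) (X : gsp4) :
    HasDerivAt (fun t : ℝ => f (g * expG (t • X))) (fderiv ℝ G g.1.1 (g.1.1 * X.1)) 0 := by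
  have h1 : HasDerivAt (fun t : ℝ => g.1.1 * NormedSpace.exp (t • X.1)) (g.1.1 * X.1) 0 := by
    have h0 := hasDerivAt_exp_smul_const (𝕂 := ℝ) X.1 0
    have := h0.const_mul g.1.1
    rw [zero_smul, NormedSpace.exp_zero, one_mul] at this
    exact this
  have h2 : HasFDerivAt G (fderiv ℝ G g.1.1) (g.1.1 * NormedSpace.exp ((0 : ℝ) • X.1)) := by
    simpa using hG.hasFDerivAt
  have h3 := h2.comp_hasDerivAt (0 : ℝ) h1
  refine h3.congr_of_eventuallyEq ?_
  have hc : Filter.Tendsto (fun t : ℝ => g * expG (t • X)) (𝓝 0) (𝓝 g) := by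
    have hcont : Continuous fun t : ℝ => g * expG (t • X) :=
      continuous_const.mul (continuous_expG_smul X)
    have := hcont.tendsto 0
    rwa [zero_smul, expG_zero, mul_one] at this
  filter_upwards [hc.eventually he] with t ht
  rw [ht]; rfl

theorem mk_mul_expG (g : GSp4 ℝ) (gf : GSp4 FinAdele) (h : GSp4 ℝ) :
    ((g, gf) * (h, 1) : GSp4A) = (g * h, gf) := by simp

theorem rightDeriv_eq_fderiv {f : GSp4A → ℂ} {gf : GSp4 FinAdele}
    {G : Matrix (Fin 4) (Fin 4) ℝ → ℂ} {g : GSp4 ℝ} (hG : DifferentiableAt ℝ G g.1.1)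
    (he : ∀ᶠ h in 𝓝 g, f (h, gf) = G h.1.1) (X : gsp4) :
    rightDeriv X f (g, gf) = fderiv ℝ G g.1.1 (g.1.1 * X.1) := by
  have := (hasDerivAt_of_local_extension hG he X).deriv
  simpa [rightDeriv] using this

theorem LocSmoothA.hasDerivAt_zero {f : GSp4A → ℂ} (hf : LocSmoothA f) (X : gsp4) (g : GSp4A) :
    HasDerivAt (fun t : ℝ => f (g * (expG (t • X), 1))) (rightDeriv X f g) 0 := by
  obtain ⟨g, gf⟩ := g
  obtain ⟨G, hG, he⟩ := hf gf g
  rw [rightDeriv_eq_fderiv (hG.differentiableAt (by simp)) he]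
  simpa using hasDerivAt_of_local_extension (hG.differentiableAt (by simp)) he X

theorem LocSmoothA.hasDerivAt {f : GSp4A → ℂ} (hf : LocSmoothA f) (X : gsp4) (g : GSp4A) (t : ℝ) :
    HasDerivAt (fun t : ℝ => f (g * (expG (t • X), 1)))
      (rightDeriv X f (g * (expG (t • X), 1))) t := by
  have h := hf.hasDerivAt_zero X (g * (expG (t • X), 1))
  have h2 := HasDerivAt.comp_sub_const t t (by rw [sub_self]; exact h)
  refine h2.congr_of_eventuallyEq (Filter.Eventually.of_forall fun s => ?_)
  have e : ((expG (t • X), 1) : GSp4A) * (expG ((s - t) • X), 1) = (expG (s • X), 1) := by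
    rw [Prod.mk_mul_mk, ← expG_add_smul]; simp
  change f _ = f _
  rw [mul_assoc, e]

/-- A local extension `G` of `f` yields the local extension `M ↦ dG_M(MX)` of its right derivative.
-/
theorem LocSmoothA.deriv_right {f : GSp4A → ℂ} (hf : LocSmoothA f) (X : gsp4) :
    LocSmoothA (rightDeriv X f) := by
  intro gf g₀
  obtain ⟨G, hG, he⟩ := hf gf g₀
  refine ⟨fun M => fderiv ℝ G M (M * X.1), ?_, ?_⟩
  · refine (hG.fderiv_right (m := ∞) (by simp)).clm_apply ?_
    exact (LinearMap.toContinuousLinearMap (LinearMap.mulRight ℝ X.1)).contDiff.contDiffAt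
  · have h1 : ∀ᶠ M in 𝓝 g₀.1.1, DifferentiableAt ℝ G M := by
      have := (hG.of_le (m := 1) (by simp)).eventually (by simp)
      exact this.mono fun M h => h.differentiableAt (by simp)
    filter_upwards [GSp4.continuous_val.continuousAt.eventually h1, he.eventually_nhds] with g h2 h3
    exact rightDeriv_eq_fderiv h2 h3 X

theorem rightDeriv_linearCombination {ι : Type*} (s : Finset ι) (a : ι → ℝ) (X : ι → gsp4)
    {f : GSp4A → ℂ} (hf : LocSmoothA f) :
    rightDeriv (∑ i ∈ s, a i • X i) f = ∑ i ∈ s, (a i : ℂ) • rightDeriv (X i) f := by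
  funext ⟨g, gf⟩
  obtain ⟨G, hG, he⟩ := hf gf g
  have hd := hG.differentiableAt (by simp)
  rw [rightDeriv_eq_fderiv hd he, Finset.sum_apply]
  simp only [Pi.smul_apply, rightDeriv_eq_fderiv hd he]
  have : (g.1.1 : Matrix (Fin 4) (Fin 4) ℝ) * (∑ i ∈ s, a i • X i : gsp4).1
      = ∑ i ∈ s, a i • (g.1.1 * (X i).1) := by
    simp [Finset.mul_sum]
  rw [this, map_sum]
  simp

end

theorem rightDeriv_sum {ι : Type*} (s : Finset ι) (c : ι → ℂ) (f : ι → GSp4A → ℂ)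
    (hf : ∀ i, LocSmoothA (f i)) (X : gsp4) :
    rightDeriv X (∑ i ∈ s, c i • f i) = ∑ i ∈ s, c i • rightDeriv X (f i) := by
  funext g
  have h := HasDerivAt.fun_sum (u := s) fun i _ =>
    ((hf i).hasDerivAt_zero X g).const_mul (c i)
  simpa [rightDeriv] using h.deriv

theorem LocSmoothA.iterate {f : GSp4A → ℂ} (hf : LocSmoothA f) (X : gsp4) (n : ℕ) :
    LocSmoothA ((rightDeriv X)^[n] f) := by
  induction n with
  | zero => exact hf
  | succ n ih => rw [Function.iterate_succ_apply']; exact ih.deriv_right X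

theorem iterate_rightDeriv_sum {ι : Type*} (s : Finset ι) (c : ι → ℂ) (f : ι → GSp4A → ℂ)
    (hf : ∀ i, LocSmoothA (f i)) (X : gsp4) (n : ℕ) :
    (rightDeriv X)^[n] (∑ i ∈ s, c i • f i) = ∑ i ∈ s, c i • (rightDeriv X)^[n] (f i) := by
  induction n with
  | zero => rfl
  | succ n ih =>
    simp only [Function.iterate_succ_apply', ih]
    exact rightDeriv_sum s c _ (fun i => (hf i).iterate X n) X

theorem diffOp_append (w w' : List gsp4) (f : GSp4A → ℂ) :
    diffOp (w ++ w') f = diffOp w (diffOp w' f) := by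
  induction w with
  | nil => rfl
  | cons X w ih => simp [diffOp, ih]

/-! ### Heights and uniform growth of iterated derivatives -/

/-- The sum of the absolute values of the entries. -/
def entrySum (M : Matrix (Fin 4) (Fin 4) ℝ) : ℝ := ∑ i, ∑ j, |M i j|

theorem entrySum_nonneg (M : Matrix (Fin 4) (Fin 4) ℝ) : 0 ≤ entrySum M :=
  Finset.sum_nonneg fun _ _ => Finset.sum_nonneg fun _ _ => abs_nonneg _

theorem entrySum_mul_le (M N : Matrix (Fin 4) (Fin 4) ℝ) :
    entrySum (M * N) ≤ entrySum M * entrySum N := by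
  have h1 : ∀ k i, |M i k| ≤ ∑ k, |M i k| := fun k i =>
    Finset.single_le_sum (f := fun k => |M i k|) (fun _ _ => abs_nonneg _) (Finset.mem_univ k)
  calc entrySum (M * N) ≤ ∑ i, ∑ j, ∑ k, |M i k| * |N k j| := by
        refine Finset.sum_le_sum fun i _ => Finset.sum_le_sum fun j _ => ?_
        rw [Matrix.mul_apply]
        refine (Finset.abs_sum_le_sum_abs _ _).trans (le_of_eq ?_)
        simp [abs_mul]
    _ ≤ ∑ i, ∑ j, ∑ k, (∑ k, |M i k|) * |N k j| :=
        Finset.sum_le_sum fun i _ => Finset.sum_le_sum fun j _ => Finset.sum_le_sum fun k _ =>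
          mul_le_mul_of_nonneg_right (h1 k i) (abs_nonneg _)
    _ = entrySum M * entrySum N := by
        unfold entrySum
        rw [Finset.sum_mul]
        refine Finset.sum_congr rfl fun i _ => ?_
        rw [Finset.sum_comm]
        simp only [← Finset.mul_sum]

theorem height_eq (g : GSp4 ℝ) : height g = entrySum g.1.1 + entrySum (g⁻¹).1.1 := by
  simp [height, entrySum, Finset.sum_add_distrib]

theorem height_nonneg (g : GSp4 ℝ) : 0 ≤ height g := by
  rw [height_eq]; exact add_nonneg (entrySum_nonneg _) (entrySum_nonneg _)

theorem height_mul_le (g h : GSp4 ℝ) : height (g * h) ≤ height g * height h := by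
  simp only [height_eq, mul_inv_rev]
  have h1 := entrySum_mul_le g.1.1 h.1.1
  have h2 := entrySum_mul_le (h⁻¹).1.1 (g⁻¹).1.1
  have h3 := mul_nonneg (entrySum_nonneg g.1.1) (entrySum_nonneg (h⁻¹).1.1)
  have h4 := mul_nonneg (entrySum_nonneg (g⁻¹).1.1) (entrySum_nonneg h.1.1)
  rw [GSp4.val_mul, GSp4.val_mul]
  nlinarith

theorem one_le_height (g : GSp4 ℝ) : 1 ≤ height g := by
  have h1 : entrySum (1 : Matrix (Fin 4) (Fin 4) ℝ) = 4 := by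
    simp [entrySum, Fin.sum_univ_four]; norm_num
  have h2 := entrySum_mul_le g.1.1 (g⁻¹).1.1
  rw [GSp4.mul_inv_val, h1] at h2
  rw [height_eq]
  nlinarith [entrySum_nonneg g.1.1, entrySum_nonneg (g⁻¹).1.1]

theorem exists_linear_bound (l : Matrix (Fin 4) (Fin 4) ℝ →ₗ[ℝ] ℝ) :
    ∃ c, 0 ≤ c ∧ ∀ M, |l M| ≤ c * entrySum M := by
  refine ⟨∑ i, ∑ j, |l (Matrix.single i j 1)|, Finset.sum_nonneg fun _ _ =>
    Finset.sum_nonneg fun _ _ => abs_nonneg _, fun M => ?_⟩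
  have h1 : l M = ∑ i, ∑ j, M i j * l (Matrix.single i j 1) := by
    conv_lhs => rw [Matrix.matrix_eq_sum_single M]
    simp only [map_sum]
    refine Finset.sum_congr rfl fun i _ => Finset.sum_congr rfl fun j _ => ?_
    rw [← smul_eq_mul, ← map_smul, Matrix.smul_single, smul_eq_mul, mul_one]
  have h2 : ∀ i j, |M i j| ≤ entrySum M := fun i j =>
    (Finset.single_le_sum (f := fun j => |M i j|) (fun _ _ => abs_nonneg _) (Finset.mem_univ j)).trans
      (Finset.single_le_sum (f := fun i => ∑ j, |M i j|)
        (fun _ _ => Finset.sum_nonneg fun _ _ => abs_nonneg _) (Finset.mem_univ i))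
  rw [h1, Finset.sum_mul]
  refine (Finset.abs_sum_le_sum_abs _ _).trans (Finset.sum_le_sum fun i _ => ?_)
  rw [Finset.sum_mul]
  refine (Finset.abs_sum_le_sum_abs _ _).trans (Finset.sum_le_sum fun j _ => ?_)
  rw [abs_mul, mul_comm]
  exact mul_le_mul_of_nonneg_left (h2 i j) (abs_nonneg _)

/-- Smooth functions whose derivatives grow at most like the `r`-th power of the height, for finite
components in `T`. -/
structure HasGrowth (T : Set (GSp4 FinAdele)) (r : ℕ) (f : GSp4A → ℂ) : Prop where
  locSmooth : LocSmoothA f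
  bound : ∀ w : List gsp4, ∃ C : ℝ, ∀ g, ∀ gf ∈ T, ‖diffOp w f (g, gf)‖ ≤ C * height g ^ r

theorem HasGrowth.deriv_right {T : Set (GSp4 FinAdele)} {r : ℕ} {f : GSp4A → ℂ}
    (hf : HasGrowth T r f) (X : gsp4) : HasGrowth T r (rightDeriv X f) where
  locSmooth := hf.locSmooth.deriv_right X
  bound w := by
    obtain ⟨C, hC⟩ := hf.bound (w ++ [X])
    rw [diffOp_append] at hC
    exact ⟨C, hC⟩

/-- The direction `Y` will depend on the point, so the constant must not depend on it. Each
innermost derivative along `Y` is expanded in a fixed basis, at the cost of one factor `entrySum Y`,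
and the induction hypothesis is used for the basis derivatives of `f` with the same `Y`. The
exponent `r` never changes because growth is uniform in the derivatives. -/
theorem HasGrowth.iterate_bound {T : Set (GSp4 FinAdele)} {r : ℕ} (n : ℕ) :
    ∀ {f : GSp4A → ℂ}, HasGrowth T r f → ∃ C : ℝ, 0 ≤ C ∧ ∀ (Y : gsp4) (g : GSp4 ℝ), ∀ gf ∈ T,
      ‖(rightDeriv Y)^[n] f (g, gf)‖ ≤ C * entrySum Y.1 ^ n * height g ^ r := by
  induction n with
  | zero =>
    intro f hf
    obtain ⟨C, hC⟩ := hf.bound []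
    refine ⟨|C|, abs_nonneg _, fun Y g gf hgf => (hC g gf hgf).trans ?_⟩
    simpa using mul_le_mul_of_nonneg_right (le_abs_self C) (pow_nonneg (height_nonneg g) r)
  | succ n ih =>
    intro f hf
    let B := Module.finBasis ℝ gsp4
    obtain ⟨P, hP⟩ := LinearMap.exists_leftInverse_of_injective gsp4.toSubmodule.subtype
      (LinearMap.ker_eq_bot.2 Subtype.val_injective)
    have hb : ∀ i, ∃ c, 0 ≤ c ∧ ∀ Y : gsp4, |B.repr Y i| ≤ c * entrySum Y.1 := by
      intro i
      obtain ⟨c, hc, h⟩ := exists_linear_bound (B.coord i ∘ₗ P)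
      refine ⟨c, hc, fun Y => ?_⟩
      have h1 : P Y.1 = Y := LinearMap.congr_fun hP Y
      have h2 := h Y.1
      rwa [LinearMap.comp_apply, h1, Module.Basis.coord_apply] at h2
    choose c hc hcb using hb
    choose C hC hCb using fun i => ih (hf.deriv_right (B i))
    refine ⟨∑ i, c i * C i, Finset.sum_nonneg fun i _ => mul_nonneg (hc i) (hC i),
      fun Y g gf hgf => ?_⟩
    have h1 : rightDeriv Y f = ∑ i, ((B.repr Y i : ℝ) : ℂ) • rightDeriv (B i) f := by
      rw [← rightDeriv_linearCombination _ _ _ hf.locSmooth, B.sum_repr]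
    rw [Function.iterate_succ_apply, h1,
      iterate_rightDeriv_sum _ _ _ fun i => hf.locSmooth.deriv_right (B i), Finset.sum_apply,
      Finset.sum_mul, Finset.sum_mul]
    refine (norm_sum_le _ _).trans (Finset.sum_le_sum fun i _ => ?_)
    rw [Pi.smul_apply, norm_smul, Complex.norm_real, Real.norm_eq_abs]
    calc _ ≤ (c i * entrySum Y.1) * (C i * entrySum Y.1 ^ n * height g ^ r) :=
          mul_le_mul (hcb i Y) (hCb i Y g gf hgf) (norm_nonneg _)
            (mul_nonneg (hc i) (entrySum_nonneg _))
      _ = _ := by ring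

/-! ### Finiteness of the level on `U(Ẑ)` -/

theorem siegelU_mul {R : Type*} [CommRing R] (x y z x' y' z' : R) :
    siegelU x y z * siegelU x' y' z' = siegelU (x + x') (y + y') (z + z') := by
  apply Subtype.ext; apply Units.ext
  ext i j
  change (!![1, 0, x, y; 0, 1, y, z; 0, 0, 1, 0; 0, 0, 0, 1] *
    !![1, 0, x', y'; 0, 1, y', z'; 0, 0, 1, 0; 0, 0, 0, 1] : Matrix (Fin 4) (Fin 4) R) i j =
    !![1, 0, x + x', y + y'; 0, 1, y + y', z + z'; 0, 0, 1, 0; 0, 0, 0, 1] i j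
  fin_cases i <;> fin_cases j <;> simp [Matrix.mul_apply, Fin.sum_univ_four, add_comm]

theorem continuous_siegelU {R : Type*} [CommRing R] [TopologicalSpace R] [IsTopologicalRing R] :
    Continuous fun p : R × R × R => siegelU p.1 p.2.1 p.2.2 := by
  refine Continuous.subtype_mk (Units.continuous_iff.2 ⟨?_, ?_⟩) _
  · refine continuous_matrix fun i j => ?_
    change Continuous fun p : R × R × R => (!![1, 0, p.1, p.2.1; 0, 1, p.2.1, p.2.2; 0, 0, 1, 0;
      0, 0, 0, 1] : Matrix (Fin 4) (Fin 4) R) i j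
    fin_cases i <;> fin_cases j <;> simp <;> fun_prop
  · refine continuous_matrix fun i j => ?_
    change Continuous fun p : R × R × R => (!![1, 0, -p.1, -p.2.1; 0, 1, -p.2.1, -p.2.2; 0, 0, 1, 0;
      0, 0, 0, 1] : Matrix (Fin 4) (Fin 4) R) i j
    fin_cases i <;> fin_cases j <;> simp <;> fun_prop

/-- The image of `Ẑ³` in `U(𝔸_f)`. -/
def siegelZHat : Set (GSp4 FinAdele) :=
  (fun p : FinAdele × FinAdele × FinAdele => siegelU p.1 p.2.1 p.2.2) '' (ZHat ×ˢ ZHat ×ˢ ZHat)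

/-- `Ẑ³` is covered by finitely many open boxes on each of which `siegelU` is constant modulo the
open subgroup `K`. -/
theorem exists_finite_boxes (K : Subgroup (GSp4 FinAdele)) (hK : IsOpen (K : Set (GSp4 FinAdele))) :
    ∃ (t : Finset (FinAdele × FinAdele × FinAdele))
      (A B C : FinAdele × FinAdele × FinAdele → Set FinAdele),
      (∀ p, IsOpen (A p) ∧ IsOpen (B p) ∧ IsOpen (C p)) ∧
      (ZHat ×ˢ ZHat ×ˢ ZHat ⊆ ⋃ p ∈ t, A p ×ˢ B p ×ˢ C p) ∧
      ∀ p, ∀ x ∈ A p ×ˢ B p ×ˢ C p,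
        ∃ k ∈ K, siegelU x.1 x.2.1 x.2.2 = siegelU p.1 p.2.1 p.2.2 * k := by
  have h : ∀ p : FinAdele × FinAdele × FinAdele, ∃ A B C : Set FinAdele,
      (IsOpen A ∧ IsOpen B ∧ IsOpen C) ∧ p ∈ A ×ˢ B ×ˢ C ∧ ∀ x ∈ A ×ˢ B ×ˢ C,
        ∃ k ∈ K, siegelU x.1 x.2.1 x.2.2 = siegelU p.1 p.2.1 p.2.2 * k := by
    intro p
    have hc : Continuous fun x : FinAdele × FinAdele × FinAdele =>
        (siegelU p.1 p.2.1 p.2.2)⁻¹ * siegelU x.1 x.2.1 x.2.2 :=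
      continuous_const.mul continuous_siegelU
    have hn := (hK.preimage hc).mem_nhds (x := p) (by simp [K.one_mem])
    obtain ⟨A, A', hA, hpA, hA', hpA', hs⟩ := mem_nhds_prod_iff'.1 hn
    obtain ⟨B, C, hB, hpB, hC, hpC, hs'⟩ := mem_nhds_prod_iff'.1 (hA'.mem_nhds hpA')
    refine ⟨A, B, C, ⟨hA, hB, hC⟩, ⟨hpA, hpB, hpC⟩, fun x hx => ⟨_, hs ⟨hx.1, hs' hx.2⟩, ?_⟩⟩
    rw [mul_inv_cancel_left]
  choose A B C ho hp hx using h
  obtain ⟨t, -, hcov⟩ := (isCompact_ZHat.prod (isCompact_ZHat.prod isCompact_ZHat)).elim_nhds_subcover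
    (fun p => A p ×ˢ B p ×ˢ C p)
    (fun p _ => ((ho p).1.prod ((ho p).2.1.prod (ho p).2.2)).mem_nhds (hp p))
  exact ⟨t, A, B, C, ho, hcov, hx⟩

theorem diffOp_mul_right {f : GSp4A → ℂ} {k : GSp4 FinAdele} (hk : ∀ g, f (g * (1, k)) = f g)
    (w : List gsp4) (g : GSp4A) : diffOp w f (g * (1, k)) = diffOp w f g := by
  induction w generalizing g with
  | nil => exact hk g
  | cons X w ih =>
    simp only [diffOp, rightDeriv]
    congr 1
    funext t
    rw [← ih (g * (expG (t • X), 1)), mul_assoc, mul_assoc]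
    congr 2
    simp

theorem diffOp_mul_left {f : GSp4A → ℂ} {γ : GSp4A} (hγ : ∀ g, f (γ * g) = f g)
    (w : List gsp4) (g : GSp4A) : diffOp w f (γ * g) = diffOp w f g := by
  induction w generalizing g with
  | nil => exact hγ g
  | cons X w ih => simp only [diffOp, rightDeriv, mul_assoc, ih]

/-- The exponent and the constants of moderate growth depend on the finite component. Modulo the
level, the compact set `U(Ẑ)` meets only finitely many classes, so a maximum of exponents and a sum
of constants suffice. -/
theorem IsCuspForm.exists_hasGrowth {φ : GSp4A → ℂ} (hφ : IsCuspForm φ) :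
    ∃ r, HasGrowth siegelZHat r φ := by
  obtain ⟨K, hK, hinv⟩ := hφ.smooth.1
  obtain ⟨t, A, B, C, -, hcov, hx⟩ := exists_finite_boxes K hK
  choose r hr using hφ.growth
  choose M hM using hr
  let γ : FinAdele × FinAdele × FinAdele → GSp4 FinAdele := fun p => siegelU p.1 p.2.1 p.2.2
  refine ⟨t.sup fun p => r (γ p), hφ.smooth.locSmoothA, fun w => ⟨∑ p ∈ t, |M (γ p) w|, ?_⟩⟩
  rintro g _ ⟨x, hxZ, rfl⟩
  obtain ⟨p, hp, hxp⟩ := Set.mem_iUnion₂.1 (hcov hxZ)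
  obtain ⟨k, hk, he⟩ := hx p x hxp
  have h1 : diffOp w φ (g, siegelU x.1 x.2.1 x.2.2) = diffOp w φ (g, γ p) := by
    rw [← diffOp_mul_right (fun g => hinv g k hk) w (g, γ p), he]; simp [γ]
  change ‖diffOp w φ (g, siegelU x.1 x.2.1 x.2.2)‖ ≤ _
  rw [h1]
  calc _ ≤ M (γ p) w * height g ^ r (γ p) := hM _ _ _
    _ ≤ |M (γ p) w| * height g ^ (t.sup fun p => r (γ p)) :=
        mul_le_mul (le_abs_self _) (pow_le_pow_right₀ (one_le_height g)
          (Finset.le_sup (f := fun p => r (γ p)) hp)) (pow_nonneg (height_nonneg g) _)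
          (abs_nonneg _)
    _ ≤ _ := mul_le_mul_of_nonneg_right (Finset.single_le_sum (f := fun p => |M (γ p) w|)
        (fun _ _ => abs_nonneg _) hp) (pow_nonneg (height_nonneg g) _)

/-! ### Translation on `ℚ \ 𝔸` -/

theorem haarFin_ZHat : haarFin ZHat = 1 := Measure.addHaarMeasure_self

instance : IsProbabilityMeasure (haarFin.restrict ZHat) := ⟨by simp [haarFin_ZHat]⟩

instance : IsProbabilityMeasure (volume.restrict (Set.Ico (0 : ℝ) 1)) := ⟨by simp⟩

instance : IsProbabilityMeasure quotMeasure := by unfold quotMeasure; infer_instance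

theorem intCast_mem_ZHat (n : ℤ) : (n : FinAdele) ∈ ZHat := by
  intro v
  have : (n : FinAdele) v = (n : v.adicCompletion ℚ) := rfl
  rw [this]
  exact intCast_mem _ n

theorem add_mem_ZHat {x y : FinAdele} (hx : x ∈ ZHat) (hy : y ∈ ZHat) : x + y ∈ ZHat :=
  fun v => add_mem (hx v) (hy v)

theorem measurePreserving_add_intCast (n : ℤ) :
    MeasurePreserving (fun x : FinAdele => x + (n : FinAdele)) (haarFin.restrict ZHat)
      (haarFin.restrict ZHat) := by
  have : Measure.IsAddHaarMeasure haarFin := by unfold haarFin; infer_instance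
  have h := (measurePreserving_add_right haarFin (n : FinAdele)).restrict_preimage
    isOpen_ZHat.measurableSet
  have h2 : (fun x : FinAdele => x + (n : FinAdele)) ⁻¹' ZHat = ZHat := by
    ext x
    refine ⟨fun hx => ?_, fun hx => add_mem_ZHat hx (intCast_mem_ZHat n)⟩
    have := add_mem_ZHat hx (intCast_mem_ZHat (-n))
    simpa using this
  rwa [h2] at h

/-- Both `(0, 1]` and `(z, z + 1]` are fundamental domains for `ℤ`, and half-open intervals differ
by null sets. -/
theorem measurePreserving_fract_add (z : ℝ) :
    MeasurePreserving (fun x : ℝ => Int.fract (x + z)) (volume.restrict (Set.Ico 0 1))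
      (volume.restrict (Set.Ico 0 1)) := by
  refine ⟨by fun_prop, ?_⟩
  ext s hs
  have hA : MeasurableSet {y : ℝ | Int.fract y ∈ s} := measurable_fract hs
  rw [Measure.map_apply (by fun_prop) hs, Measure.restrict_apply (by exact (by fun_prop : Measurable fun x : ℝ => Int.fract (x + z)) hs),
    Measure.restrict_apply hs, measure_congr ((ae_eq_refl _).inter Ico_ae_eq_Ioc)]
  have h1 : volume ((fun x : ℝ => Int.fract (x + z)) ⁻¹' s ∩ Set.Ioc 0 1) =
      volume ({y : ℝ | Int.fract y ∈ s} ∩ Set.Ioc z (z + 1)) := by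
    rw [← measure_preimage_add_right volume z ({y : ℝ | Int.fract y ∈ s} ∩ Set.Ioc z (z + 1))]
    congr 1
    ext x
    simp [add_comm]
  have h2 : volume ({y : ℝ | Int.fract y ∈ s} ∩ Set.Ioc z (z + 1)) =
      volume ({y : ℝ | Int.fract y ∈ s} ∩ Set.Ioc 0 (0 + 1)) := by
    refine (isAddFundamentalDomain_Ioc one_pos z).measure_set_eq (isAddFundamentalDomain_Ioc one_pos 0)
      hA fun g => ?_
    obtain ⟨_, n, rfl⟩ := g
    ext x
    simp [AddSubgroup.vadd_def]
  rw [h1, h2, zero_add, ← measure_congr ((ae_eq_refl {y : ℝ | Int.fract y ∈ s}).inter Ico_ae_eq_Ioc)]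
  congr 1
  ext x
  refine and_congr_left fun hx => ?_
  rw [Set.mem_ofPred_eq, Int.fract_eq_self.2 hx]

/-- Translation by a real number on the fundamental domain of `ℚ \ 𝔸`. -/
noncomputable def quotShift (z : ℝ) (x : AdeleQ) : AdeleQ :=
  (Int.fract (x.1 + z), x.2 + ((-⌊x.1 + z⌋ : ℤ) : FinAdele))

/-- A skew product: rotation of the circle in the real coordinate and, for each real value,
translation of `Ẑ` by an integer. -/
theorem measurePreserving_quotShift (z : ℝ) :
    MeasurePreserving (quotShift z) quotMeasure quotMeasure := by
  refine (measurePreserving_fract_add z).skew_product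
    (g := fun a c => c + ((-⌊a + z⌋ : ℤ) : FinAdele)) ?_ (Filter.Eventually.of_forall fun a =>
      (measurePreserving_add_intCast _).map_eq)
  have h1 : Measurable fun p : ℤ × FinAdele => p.2 + ((p.1 : ℤ) : FinAdele) :=
    measurable_from_prod_countable_right fun n =>
      (measurePreserving_add_intCast n).measurable
  have h2 : Measurable fun p : ℝ × FinAdele => ((-⌊p.1 + z⌋ : ℤ), p.2) := by fun_prop
  exact h1.comp h2

theorem ae_quotMeasure : ∀ᵐ x ∂quotMeasure, x.1 ∈ Set.Ico (0 : ℝ) 1 ∧ x.2 ∈ ZHat := by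
  have h1 : ∀ᵐ x ∂quotMeasure, x.1 ∈ Set.Ico (0 : ℝ) 1 :=
    Measure.quasiMeasurePreserving_fst.ae (ae_restrict_mem measurableSet_Ico)
  have h2 : ∀ᵐ x ∂quotMeasure, x.2 ∈ ZHat :=
    Measure.quasiMeasurePreserving_snd.ae (ae_restrict_mem isOpen_ZHat.measurableSet)
  exact h1.and h2

/-- The invariant measure on `(ℚ \ 𝔸)³`. -/
noncomputable abbrev quotMeasure3 : Measure (AdeleQ × AdeleQ × AdeleQ) :=
  quotMeasure.prod (quotMeasure.prod quotMeasure)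

theorem ae_quotMeasure3 : ∀ᵐ x ∂quotMeasure3,
    (x.1.1 ∈ Set.Ico (0 : ℝ) 1 ∧ x.1.2 ∈ ZHat) ∧ (x.2.1.1 ∈ Set.Ico (0 : ℝ) 1 ∧ x.2.1.2 ∈ ZHat) ∧
      (x.2.2.1 ∈ Set.Ico (0 : ℝ) 1 ∧ x.2.2.2 ∈ ZHat) := by
  have h : ∀ᵐ x ∂(quotMeasure.prod quotMeasure), (x.1.1 ∈ Set.Ico (0 : ℝ) 1 ∧ x.1.2 ∈ ZHat) ∧
      (x.2.1 ∈ Set.Ico (0 : ℝ) 1 ∧ x.2.2 ∈ ZHat) :=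
    (Measure.quasiMeasurePreserving_fst.ae ae_quotMeasure).and
      (Measure.quasiMeasurePreserving_snd.ae ae_quotMeasure)
  exact (Measure.quasiMeasurePreserving_fst.ae ae_quotMeasure).and
    (Measure.quasiMeasurePreserving_snd.ae h)

/-- On the fundamental domain `[0,1) × Ẑ`, a real translate is brought back by a diagonal integer,
so periodicity under `ℤ` is all that is required. -/
theorem integral_quotShift {F : AdeleQ × AdeleQ × AdeleQ → ℂ}
    (hF : AEStronglyMeasurable F quotMeasure3)
    (hper : ∀ (n : ℤ) (x : AdeleQ × AdeleQ × AdeleQ),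
      F (x.1, x.2.1, x.2.2 + ((n : ℝ), (n : FinAdele))) = F x) (z : ℝ) :
    ∫ x, F (x.1, x.2.1, x.2.2 + (z, 0)) ∂quotMeasure3 = ∫ x, F x ∂quotMeasure3 := by
  have hmp : MeasurePreserving (Prod.map id (Prod.map id (quotShift z))) quotMeasure3 quotMeasure3 :=
    (MeasurePreserving.id _).prod ((MeasurePreserving.id _).prod (measurePreserving_quotShift z))
  have h1 : ∀ x : AdeleQ × AdeleQ × AdeleQ, F (x.1, x.2.1, x.2.2 + (z, 0)) =
      F (Prod.map id (Prod.map id (quotShift z)) x) := by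
    intro x
    rw [← hper ⌊x.2.2.1 + z⌋ (Prod.map id (Prod.map id (quotShift z)) x)]
    congr 1
    refine Prod.ext rfl (Prod.ext rfl (Prod.ext ?_ ?_))
    · simp [quotShift]
    · simp [quotShift]
  simp_rw [h1]
  conv_rhs => rw [← hmp.map_eq]
  rw [integral_map hmp.aemeasurable (by rwa [hmp.map_eq])]

/-! ### The Fourier coefficient along `U` as a function on `GSp₄(ℝ)` -/

/-- The properties of a cusp form that survive right derivatives and control its Fourier coefficient
along `U`: growth, a finite level, and periodicity in the last coordinate of `U`. -/
structure PeriodicWithGrowth (r : ℕ) (f : GSp4A → ℂ) : Prop extends HasGrowth siegelZHat r f where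
  level : ∃ K : Subgroup (GSp4 FinAdele), IsOpen (K : Set (GSp4 FinAdele)) ∧
    ∀ g : GSp4A, ∀ k ∈ K, f (g * (1, k)) = f g
  periodic : ∀ (n : ℤ) (g : GSp4A), f (diagQ (siegelU 0 0 n) * g) = f g

theorem IsCuspForm.exists_periodicWithGrowth {φ : GSp4A → ℂ} (hφ : IsCuspForm φ) :
    ∃ r, PeriodicWithGrowth r φ := by
  obtain ⟨r, hr⟩ := hφ.exists_hasGrowth
  exact ⟨r, { hr with level := hφ.smooth.1, periodic := fun _ g => hφ.left_invariant _ g }⟩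

theorem PeriodicWithGrowth.deriv_right {r : ℕ} {f : GSp4A → ℂ} (hf : PeriodicWithGrowth r f)
    (X : gsp4) : PeriodicWithGrowth r (rightDeriv X f) := by
  refine { hf.toHasGrowth.deriv_right X with level := ?_, periodic := ?_ }
  · obtain ⟨K, hK, h⟩ := hf.level
    exact ⟨K, hK, fun g k hk => diffOp_mul_right (fun g => h g k hk) [X] g⟩
  · exact fun n g => diffOp_mul_left (hf.periodic n) [X] g

theorem PeriodicWithGrowth.iterate {r : ℕ} {f : GSp4A → ℂ} (hf : PeriodicWithGrowth r f)
    (X : gsp4) (n : ℕ) : PeriodicWithGrowth r ((rightDeriv X)^[n] f) := by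
  induction n with
  | zero => exact hf
  | succ n ih => rw [Function.iterate_succ_apply']; exact ih.deriv_right X

/-- The integrand of the Fourier coefficient at `(g, 1)`. -/
noncomputable def translateU (f : GSp4A → ℂ) (g : GSp4 ℝ) (x : AdeleQ × AdeleQ × AdeleQ) : ℂ :=
  f (siegelU x.1.1 x.2.1.1 x.2.2.1 * g, siegelU x.1.2 x.2.1.2 x.2.2.2)

/-- The value at `(g, 1)` of the Fourier coefficient of `f` along `U`. -/
noncomputable def realCoeff (D : ℤ) (ψ : AddChar AdeleQ Circle) (f : GSp4A → ℂ) (g : GSp4 ℝ) : ℂ :=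
  ∫ x, (chiU D ψ x)⁻¹ * translateU f g x ∂quotMeasure3

theorem functionalH_rightTranslate (D : ℤ) (ψ : AddChar AdeleQ Circle) (f : GSp4A → ℂ)
    (g : GSp4 ℝ) : functionalH D ψ (rightTranslate (g, 1) f) = realCoeff D ψ f g := by
  unfold functionalH fourierCoeff integralQuot3 realCoeff
  congr 1
  funext x
  simp [rightTranslate, translateU, siegelUA]

theorem norm_chiU (D : ℤ) (ψ : AddChar AdeleQ Circle) (x : AdeleQ × AdeleQ × AdeleQ) :
    ‖chiU D ψ x‖ = 1 := Circle.norm_coe _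

theorem measurable_chiU (D : ℤ) {ψ : AddChar AdeleQ Circle} (hψ : Continuous ψ) :
    Measurable (chiU D ψ) := by
  have h0 : Measurable fun x : AdeleQ => (ψ x : ℂ) :=
    (continuous_subtype_val.comp hψ).measurable
  have h1 : Measurable fun x : AdeleQ × AdeleQ × AdeleQ => (ψ x.1 : ℂ) := h0.comp measurable_fst
  have h2 : Measurable fun x : AdeleQ × AdeleQ × AdeleQ => (ψ x.2.1 : ℂ) :=
    h0.comp (measurable_fst.comp measurable_snd)
  have h3 : Measurable fun x : AdeleQ × AdeleQ × AdeleQ => (ψ x.2.2 : ℂ) :=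
    h0.comp (measurable_snd.comp measurable_snd)
  unfold chiU
  split_ifs
  · simp only [AddChar.map_add_eq_mul, AddChar.map_zsmul_eq_zpow, Circle.coe_mul, Circle.coe_zpow]
    exact ((h1.pow_const _).mul h2).mul h3
  · simp only [AddChar.map_add_eq_mul, AddChar.map_neg_eq_inv, AddChar.map_zsmul_eq_zpow,
      Circle.coe_mul, Circle.coe_zpow, Circle.coe_inv]
    exact (h1.pow_const _).inv.mul h3

/-- In both cases of the definition of `χ` the coefficient of `u₂₂` is `1`. This is why only the
last coordinate of `U` is used in the sequel, with no distinction on `D`. -/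
theorem chiU_add (D : ℤ) (ψ : AddChar AdeleQ Circle) (x : AdeleQ × AdeleQ × AdeleQ) (y : AdeleQ) :
    chiU D ψ (x.1, x.2.1, x.2.2 + y) = chiU D ψ x * ψ y := by
  unfold chiU
  split_ifs <;> simp only [← Circle.coe_mul, ← AddChar.map_add_eq_mul, add_assoc]

/-- Finitely many boxes cover `Ẑ³`, and on each of them the finite component is constant modulo the
level, so the integrand is a continuous function of the real coordinates alone. -/
theorem PeriodicWithGrowth.aestronglyMeasurable {r : ℕ} {f : GSp4A → ℂ}
    (hf : PeriodicWithGrowth r f) (g : GSp4 ℝ) :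
    AEStronglyMeasurable (translateU f g) quotMeasure3 := by
  obtain ⟨K, hK, hinv⟩ := hf.level
  obtain ⟨t, A, B, C, ho, hcov, hx⟩ := exists_finite_boxes K hK
  let S : t → Set (AdeleQ × AdeleQ × AdeleQ) := fun p =>
    {x | x.1.2 ∈ A p ∧ x.2.1.2 ∈ B p ∧ x.2.2.2 ∈ C p}
  have hS : ∀ p, MeasurableSet (S p) := by
    intro p
    have hA := (ho p).1.measurableSet
    have hB := (ho p).2.1.measurableSet
    have hC := (ho p).2.2.measurableSet
    exact (((measurable_snd.comp measurable_fst) hA).inter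
      (((measurable_snd.comp (measurable_fst.comp measurable_snd)) hB).inter
        ((measurable_snd.comp (measurable_snd.comp measurable_snd)) hC)))
  have hres : quotMeasure3.restrict (⋃ p, S p) = quotMeasure3 := by
    refine Measure.restrict_eq_self_of_ae_mem ?_
    filter_upwards [ae_quotMeasure3] with x hx
    obtain ⟨p, hp, hxp⟩ := Set.mem_iUnion₂.1
      (hcov (show (x.1.2, x.2.1.2, x.2.2.2) ∈ ZHat ×ˢ ZHat ×ˢ ZHat from ⟨hx.1.2, hx.2.1.2, hx.2.2.2⟩))
    exact Set.mem_iUnion.2 ⟨⟨p, hp⟩, hxp⟩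
  rw [← hres]
  refine (aemeasurable_iUnion_iff.2 fun p => ?_).aestronglyMeasurable
  let γ : GSp4 FinAdele := siegelU p.1.1 p.1.2.1 p.1.2.2
  have hc : Continuous fun y : ℝ × ℝ × ℝ => f (siegelU y.1 y.2.1 y.2.2 * g, γ) :=
    (hf.locSmooth γ).continuous.comp (continuous_siegelU.mul continuous_const)
  have hm : Measurable fun x : AdeleQ × AdeleQ × AdeleQ => (x.1.1, x.2.1.1, x.2.2.1) := by fun_prop
  refine (hc.measurable.comp hm).aemeasurable.congr ?_
  filter_upwards [ae_restrict_mem (hS p)] with x hxS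
  obtain ⟨k, hk, he⟩ := hx p (x.1.2, x.2.1.2, x.2.2.2) hxS
  have := hinv (siegelU x.1.1 x.2.1.1 x.2.2.1 * g, γ) k hk
  rw [Prod.mk_mul_mk, mul_one] at this
  change f _ = f (_, siegelU x.1.2 x.2.1.2 x.2.2.2)
  rw [he, this]

theorem height_siegelU_le {x y z : ℝ} (hx : x ∈ Set.Ico (0 : ℝ) 1) (hy : y ∈ Set.Ico (0 : ℝ) 1)
    (hz : z ∈ Set.Ico (0 : ℝ) 1) : height (siegelU x y z) ≤ 16 := by
  have h : height (siegelU x y z) = ∑ i, ∑ j,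
      (|(!![1, 0, x, y; 0, 1, y, z; 0, 0, 1, 0; 0, 0, 0, 1] : Matrix (Fin 4) (Fin 4) ℝ) i j| +
       |(!![1, 0, -x, -y; 0, 1, -y, -z; 0, 0, 1, 0; 0, 0, 0, 1] : Matrix (Fin 4) (Fin 4) ℝ) i j|) := rfl
  rw [h]
  simp [Fin.sum_univ_four, abs_of_nonneg hx.1, abs_of_nonneg hy.1, abs_of_nonneg hz.1]
  -- The two diagonals contribute `8`, and the other entries `2(x + 2y + z) < 8`.
  linarith [hx.2, hy.2, hz.2]

/-- The exceptional null set is the complement of the fundamental domain, hence independent of `g`;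
domination locally uniform in `g` requires this order of quantifiers. -/
theorem ae_translateU_le {r : ℕ} {f : GSp4A → ℂ} {C : ℝ} (hC : 0 ≤ C)
    (hf : ∀ h, ∀ gf ∈ siegelZHat, ‖f (h, gf)‖ ≤ C * height h ^ r) :
    ∀ᵐ x ∂quotMeasure3, ∀ g : GSp4 ℝ, ‖translateU f g x‖ ≤ C * (16 * height g) ^ r := by
  filter_upwards [ae_quotMeasure3] with x hx g
  refine (hf _ _ ⟨(x.1.2, x.2.1.2, x.2.2.2), ⟨hx.1.2, hx.2.1.2, hx.2.2.2⟩, rfl⟩).trans ?_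
  refine mul_le_mul_of_nonneg_left (pow_le_pow_left₀ (height_nonneg _) ?_ r) hC
  exact (height_mul_le _ _).trans (mul_le_mul_of_nonneg_right
    (height_siegelU_le hx.1.1 hx.2.1.1 hx.2.2.1) (height_nonneg _))

theorem HasGrowth.exists_bound {T : Set (GSp4 FinAdele)} {r : ℕ} {f : GSp4A → ℂ}
    (hf : HasGrowth T r f) : ∃ C : ℝ, 0 ≤ C ∧ ∀ g, ∀ gf ∈ T, ‖f (g, gf)‖ ≤ C * height g ^ r := by
  obtain ⟨C, hC, h⟩ := hf.iterate_bound 0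
  exact ⟨C, hC, fun g gf hgf => by simpa using h 0 g gf hgf⟩

theorem norm_realCoeff_le {D : ℤ} {ψ : AddChar AdeleQ Circle} {r : ℕ} {f : GSp4A → ℂ} {C : ℝ}
    (hC : 0 ≤ C) (hf : ∀ h, ∀ gf ∈ siegelZHat, ‖f (h, gf)‖ ≤ C * height h ^ r) (g : GSp4 ℝ) :
    ‖realCoeff D ψ f g‖ ≤ C * (16 * height g) ^ r := by
  have := norm_integral_le_of_norm_le_const (μ := quotMeasure3)
    (f := fun x => (chiU D ψ x)⁻¹ * translateU f g x) (C := C * (16 * height g) ^ r) (by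
      filter_upwards [ae_translateU_le hC hf] with x hx
      rw [norm_mul, norm_inv, norm_chiU, inv_one, one_mul]
      exact hx g)
  simpa [realCoeff] using this

theorem PeriodicWithGrowth.aestronglyMeasurable_integrand {D : ℤ} {ψ : AddChar AdeleQ Circle}
    (hψ : Continuous ψ) {r : ℕ} {f : GSp4A → ℂ} (hf : PeriodicWithGrowth r f) (g : GSp4 ℝ) :
    AEStronglyMeasurable (fun x => (chiU D ψ x)⁻¹ * translateU f g x) quotMeasure3 :=
  (measurable_chiU D hψ).inv.aestronglyMeasurable.mul (hf.aestronglyMeasurable g)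

theorem diagQ_siegelU (n : ℤ) : diagQ (siegelU 0 0 n) =
    (siegelU 0 0 (n : ℝ), siegelU 0 0 (n : FinAdele)) := by
  refine Prod.ext ?_ ?_
  · apply Subtype.ext; apply Units.ext
    ext i j
    change algebraMap ℚ ℝ ((!![1, 0, 0, 0; 0, 1, 0, (n : ℚ); 0, 0, 1, 0; 0, 0, 0, 1] :
      Matrix (Fin 4) (Fin 4) ℚ) i j) = (!![1, 0, 0, 0; 0, 1, 0, (n : ℝ); 0, 0, 1, 0; 0, 0, 0, 1] :
      Matrix (Fin 4) (Fin 4) ℝ) i j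
    fin_cases i <;> fin_cases j <;> simp
  · apply Subtype.ext; apply Units.ext
    refine Matrix.ext fun i j => ?_
    change algebraMap ℚ FinAdele ((!![1, 0, 0, 0; 0, 1, 0, (n : ℚ); 0, 0, 1, 0; 0, 0, 0, 1] :
      Matrix (Fin 4) (Fin 4) ℚ) i j) = (!![1, 0, 0, 0; 0, 1, 0, (n : FinAdele); 0, 0, 1, 0; 0, 0, 0, 1] :
      Matrix (Fin 4) (Fin 4) FinAdele) i j
    fin_cases i <;> fin_cases j <;> simp

theorem psi_intCast {ψ : AddChar AdeleQ Circle} (hψ : IsStandardAddChar ψ) (n : ℤ) :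
    ψ ((n : ℝ), (n : FinAdele)) = 1 := by
  simpa using hψ.trivial_rat n

/-- The Fourier coefficient transforms by the character under the last coordinate of `U(ℝ)`. -/
theorem realCoeff_siegelU {D : ℤ} {ψ : AddChar AdeleQ Circle} (hψ : IsStandardAddChar ψ) {r : ℕ}
    {f : GSp4A → ℂ} (hf : PeriodicWithGrowth r f) (z : ℝ) (g : GSp4 ℝ) :
    realCoeff D ψ f (siegelU 0 0 z * g) =
      Complex.exp (2 * Real.pi * Complex.I * z) * realCoeff D ψ f g := by
  have h1 := integral_quotShift (hf.aestronglyMeasurable_integrand (D := D) hψ.continuous g) (by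
    intro n x
    rw [chiU_add, psi_intCast hψ]
    congr 1
    · simp
    · conv_rhs => rw [translateU, ← hf.periodic n, diagQ_siegelU, Prod.mk_mul_mk, ← mul_assoc,
        siegelU_mul, siegelU_mul]
      simp [translateU, add_comm]) z
  rw [realCoeff, realCoeff, ← h1, ← integral_const_mul]
  congr 1
  funext x
  rw [chiU_add, hψ.real, mul_inv, translateU, translateU, ← mul_assoc, siegelU_mul]
  simp only [add_zero, Prod.fst_add, Prod.snd_add]
  field_simp [Complex.exp_ne_zero]

/-! ### Decay of the Fourier coefficient -/

theorem continuous_height : Continuous height := by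
  have h1 : ∀ i j, Continuous fun g : GSp4 ℝ => (g.1.1 : Matrix (Fin 4) (Fin 4) ℝ) i j :=
    fun i j => (continuous_apply_apply i j).comp GSp4.continuous_val
  have h2 : ∀ i j, Continuous fun g : GSp4 ℝ => ((g⁻¹).1.1 : Matrix (Fin 4) (Fin 4) ℝ) i j :=
    fun i j => (h1 i j).comp continuous_inv
  exact continuous_finsetSum _ fun i _ => continuous_finsetSum _ fun j _ =>
    (h1 i j).abs.add (h2 i j).abs

/-- Dominated convergence: the height is bounded near `x₀`, and a constant is integrable for a
probability measure. Sequences suffice by first countability of the parameter space. -/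
theorem continuous_realCoeff_comp {D : ℤ} {ψ : AddChar AdeleQ Circle} (hψ : Continuous ψ) {r : ℕ}
    {f : GSp4A → ℂ} (hf : PeriodicWithGrowth r f) {X : Type*} [TopologicalSpace X]
    [FirstCountableTopology X] {γ : X → GSp4 ℝ} (hγ : Continuous γ) :
    Continuous fun x => realCoeff D ψ f (γ x) := by
  rw [continuous_iff_continuousAt]
  intro x₀
  obtain ⟨C, hC, hb⟩ := hf.toHasGrowth.exists_bound
  have hnear : ∀ᶠ x in 𝓝 x₀, height (γ x) ≤ height (γ x₀) + 1 :=
    ((continuous_height.comp hγ).continuousAt.eventually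
      (gt_mem_nhds (show height (γ x₀) < height (γ x₀) + 1 by linarith))).mono fun _ h => h.le
  refine continuousAt_of_dominated (bound := fun _ => C * (16 * (height (γ x₀) + 1)) ^ r)
    (Filter.Eventually.of_forall fun x => hf.aestronglyMeasurable_integrand hψ _) ?_
    (integrable_const _) (Filter.Eventually.of_forall fun a => ?_)
  · filter_upwards [hnear] with x hx
    filter_upwards [ae_translateU_le hC hb] with a ha
    rw [norm_mul, norm_inv, norm_chiU, inv_one, one_mul]
    refine (ha _).trans (mul_le_mul_of_nonneg_left (pow_le_pow_left₀ ?_ ?_ r) hC)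
    · exact mul_nonneg (by norm_num) (height_nonneg _)
    · linarith
  · refine continuousAt_const.mul (Continuous.continuousAt ?_)
    exact (hf.locSmooth _).continuous.comp (continuous_const.mul hγ)

theorem exp_of_mul_self_eq_zero {X : Matrix (Fin 4) (Fin 4) ℝ} (h : X * X = 0) :
    NormedSpace.exp X = 1 + X := by
  rw [NormedSpace.exp_eq_tsum ℝ]
  change ∑' n : ℕ, ((n.factorial : ℝ)⁻¹) • X ^ n = _
  rw [tsum_eq_sum (s := Finset.range 2)]
  · simp [Finset.sum_range_succ]
  · intro n hn
    obtain ⟨m, rfl⟩ := Nat.exists_eq_add_of_le (not_lt.1 (fun h => hn (Finset.mem_range.2 h)))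
    rw [pow_add, pow_two, h, zero_mul, smul_zero]

/-- The infinitesimal generator of the last coordinate of `U(ℝ)`. -/
def siegelLie : gsp4 := ⟨Matrix.single 1 3 1, 0, by
  ext i j
  fin_cases i <;> fin_cases j <;>
    simp [J4, Matrix.mul_apply, Matrix.vecMul, dotProduct, Matrix.single]⟩

/-- The conjugate `g⁻¹ X g` of the generator of the last coordinate of `U(ℝ)`. -/
def siegelLieConj (g : GSp4 ℝ) : gsp4 := ⟨_, conj_mem_gsp4 g⁻¹ siegelLie⟩

theorem siegelLieConj_val (g : GSp4 ℝ) :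
    (siegelLieConj g).1 = (g⁻¹).1.1 * Matrix.single 1 3 1 * g.1.1 := by
  change (g⁻¹).1.1 * Matrix.single 1 3 1 * ((g⁻¹)⁻¹).1.1 = _
  rw [inv_inv]

/-- Right translation along `g⁻¹Xg` is left translation along `X`. Since `X² = 0`, both exponential
series stop after the linear term. -/
theorem mul_expG_siegelLieConj (g : GSp4 ℝ) (s : ℝ) :
    g * expG (s • siegelLieConj g) = siegelU 0 0 s * g := by
  apply Subtype.ext; apply Units.ext
  change (g.1.1 : Matrix (Fin 4) (Fin 4) ℝ) * NormedSpace.exp (s • (siegelLieConj g).1) =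
    !![1, 0, 0, 0; 0, 1, 0, s; 0, 0, 1, 0; 0, 0, 0, 1] * g.1.1
  have h1 : (!![1, 0, 0, 0; 0, 1, 0, s; 0, 0, 1, 0; 0, 0, 0, 1] : Matrix (Fin 4) (Fin 4) ℝ) =
      1 + s • Matrix.single 1 3 1 := by
    ext i j; fin_cases i <;> fin_cases j <;> simp [Matrix.single]
  have h2 : (Matrix.single 1 3 1 : Matrix (Fin 4) (Fin 4) ℝ) * Matrix.single 1 3 1 = 0 := by
    rw [Matrix.single_mul_single_of_ne]; decide
  have h3 : (siegelLieConj g).1 * (siegelLieConj g).1 = 0 := by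
    rw [siegelLieConj_val]
    calc _ = (g⁻¹).1.1 * (Matrix.single 1 3 1 * (g.1.1 * (g⁻¹).1.1) * Matrix.single 1 3 1) * g.1.1 := by
          simp only [mul_assoc]
      _ = 0 := by rw [GSp4.mul_inv_val, mul_one, h2, mul_zero, zero_mul]
  rw [exp_of_mul_self_eq_zero (by rw [Matrix.smul_mul, Matrix.mul_smul, h3]; simp), h1, add_mul,
    mul_add, mul_one, one_mul, siegelLieConj_val, Matrix.mul_smul, Matrix.smul_mul, ← mul_assoc,
    ← mul_assoc, GSp4.mul_inv_val, one_mul]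

/-- Differentiation under the integral sign. For `s` in the compact interval `[-1, 1]` the heights
of `g exp(sY)` are bounded, and so is the derivative of the integrand by moderate growth. -/
theorem hasDerivAt_realCoeff {D : ℤ} {ψ : AddChar AdeleQ Circle} (hψ : Continuous ψ) {r : ℕ}
    {f : GSp4A → ℂ} (hf : PeriodicWithGrowth r f) (Y : gsp4) (g : GSp4 ℝ) :
    HasDerivAt (fun s : ℝ => realCoeff D ψ f (g * expG (s • Y)))
      (realCoeff D ψ (rightDeriv Y f) g) 0 := by
  have hf' := hf.deriv_right Y
  obtain ⟨C, hC, hb⟩ := hf.toHasGrowth.exists_bound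
  obtain ⟨C', hC', hb'⟩ := hf'.toHasGrowth.exists_bound
  have hcont : Continuous fun s : ℝ => height (g * expG (s • Y)) :=
    continuous_height.comp (continuous_const.mul (continuous_expG_smul Y))
  obtain ⟨M, hM⟩ := (isCompact_closedBall (0 : ℝ) 1).bddAbove_image hcont.continuousOn
  have key := hasDerivAt_integral_of_dominated_loc_of_deriv_le (μ := quotMeasure3) (x₀ := (0 : ℝ))
    (s := Metric.closedBall (0 : ℝ) 1)
    (F := fun s x => (chiU D ψ x)⁻¹ * translateU f (g * expG (s • Y)) x)
    (F' := fun s x => (chiU D ψ x)⁻¹ * translateU (rightDeriv Y f) (g * expG (s • Y)) x)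
    (bound := fun _ => C' * (16 * M) ^ r) (Metric.closedBall_mem_nhds _ one_pos)
    (Filter.Eventually.of_forall fun s => hf.aestronglyMeasurable_integrand hψ _)
    ?_ (hf'.aestronglyMeasurable_integrand hψ _) ?_ (integrable_const _) ?_
  · have := key.2
    simp only [zero_smul, expG_zero, mul_one] at this
    exact this
  · refine Integrable.of_bound (hf.aestronglyMeasurable_integrand hψ _)
      (C * (16 * height (g * expG ((0 : ℝ) • Y))) ^ r) ?_
    filter_upwards [ae_translateU_le hC hb] with x hx
    rw [norm_mul, norm_inv, norm_chiU, inv_one, one_mul]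
    exact hx _
  · filter_upwards [ae_translateU_le hC' hb'] with x hx s hs
    rw [norm_mul, norm_inv, norm_chiU, inv_one, one_mul]
    refine (hx _).trans (mul_le_mul_of_nonneg_left (pow_le_pow_left₀ ?_ ?_ r) hC')
    · exact mul_nonneg (by norm_num) (height_nonneg _)
    · exact mul_le_mul_of_nonneg_left (hM (Set.mem_image_of_mem _ hs)) (by norm_num)
  · refine Filter.Eventually.of_forall fun x s _ => HasDerivAt.const_mul _ ?_
    have := hf.locSmooth.hasDerivAt Y (siegelU x.1.1 x.2.1.1 x.2.2.1 * g,
      siegelU x.1.2 x.2.1.2 x.2.2.2) s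
    simp only [mk_mul_expG, mul_assoc] at this
    unfold translateU
    exact this

/-- The curve `g exp(s g⁻¹Xg) = u(s) g` is differentiated in two ways: under the integral sign, and
through the equivariance `e(s)`. -/
theorem realCoeff_deriv {D : ℤ} {ψ : AddChar AdeleQ Circle} (hψ : IsStandardAddChar ψ) {r : ℕ}
    {f : GSp4A → ℂ} (hf : PeriodicWithGrowth r f) (g : GSp4 ℝ) :
    realCoeff D ψ (rightDeriv (siegelLieConj g) f) g =
      (2 * Real.pi * Complex.I) * realCoeff D ψ f g := by
  have h1 := hasDerivAt_realCoeff (D := D) hψ.continuous hf (siegelLieConj g) g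
  simp only [mul_expG_siegelLieConj, realCoeff_siegelU hψ hf] at h1
  have h2 : HasDerivAt (fun s : ℝ => Complex.exp (2 * Real.pi * Complex.I * s) * realCoeff D ψ f g)
      ((2 * Real.pi * Complex.I) * realCoeff D ψ f g) 0 := by
    have h3 : HasDerivAt (fun s : ℝ => 2 * Real.pi * Complex.I * (s : ℂ)) (2 * Real.pi * Complex.I) 0 := by
      simpa using (Complex.ofRealCLM.hasDerivAt (x := (0 : ℝ))).const_mul (2 * Real.pi * Complex.I)
    simpa using (h3.cexp).mul_const (realCoeff D ψ f g)
  exact h1.unique h2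

theorem realCoeff_iterate {D : ℤ} {ψ : AddChar AdeleQ Circle} (hψ : IsStandardAddChar ψ) {r : ℕ}
    {f : GSp4A → ℂ} (hf : PeriodicWithGrowth r f) (g : GSp4 ℝ) (n : ℕ) :
    realCoeff D ψ ((rightDeriv (siegelLieConj g))^[n] f) g =
      (2 * Real.pi * Complex.I) ^ n * realCoeff D ψ f g := by
  induction n with
  | zero => simp
  | succ n ih =>
    rw [Function.iterate_succ_apply', realCoeff_deriv hψ (hf.iterate _ n), ih]; ring

/-- The Fourier coefficient is bounded by any power of the size of `g⁻¹ X g` times a fixed power of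
the height. -/
theorem norm_realCoeff_le_pow {ψ : AddChar AdeleQ Circle} (hψ : IsStandardAddChar ψ) {r : ℕ}
    {f : GSp4A → ℂ} (hf : PeriodicWithGrowth r f) (D : ℤ) (n : ℕ) : ∃ C : ℝ, 0 ≤ C ∧ ∀ g : GSp4 ℝ,
      ‖realCoeff D ψ f g‖ ≤ C * entrySum (siegelLieConj g).1 ^ n * height g ^ r := by
  obtain ⟨C, hC, hb⟩ := hf.toHasGrowth.iterate_bound n
  refine ⟨C * 16 ^ r, by positivity, fun g => ?_⟩
  have h1 := norm_realCoeff_le (D := D) (ψ := ψ) (f := (rightDeriv (siegelLieConj g))^[n] f)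
    (mul_nonneg hC (pow_nonneg (entrySum_nonneg (siegelLieConj g).1) n))
    (fun h gf hgf => hb (siegelLieConj g) h gf hgf) g
  rw [realCoeff_iterate hψ hf, norm_mul, norm_pow] at h1
  -- The eigenvalue has absolute value `2π ≥ 1`, so its powers may be dropped from the bound.
  have h2 : (1 : ℝ) ≤ ‖(2 * Real.pi * Complex.I : ℂ)‖ ^ n := by
    refine one_le_pow₀ ?_
    simp only [norm_mul, Complex.norm_ofNat, Complex.norm_real, Complex.norm_I, mul_one,
      Real.norm_eq_abs, abs_of_pos Real.pi_pos]
    linarith [Real.pi_gt_three]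
  calc _ ≤ ‖(2 * Real.pi * Complex.I : ℂ)‖ ^ n * ‖realCoeff D ψ f g‖ :=
        le_mul_of_one_le_left (norm_nonneg _) h2
    _ ≤ _ := h1
    _ = _ := by rw [mul_pow]; ring

/-! ### Homogeneous Mellin integrals on a cone -/

/-- Rapid decay at the origin and growth of order `r` at infinity, on the cone over `K`. -/
structure RapidOnCone {E : Type*} [NormedAddCommGroup E] [NormedSpace ℝ E] (K : Set E) (r : ℕ)
    (h : E → ℂ) : Prop where
  near : ∀ n : ℕ, ∃ C, ∀ w, (∃ t : ℝ, t • w ∈ K) → ‖w‖ ≤ 1 → ‖h w‖ ≤ C * ‖w‖ ^ n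
  far : ∃ C, ∀ w, (∃ t : ℝ, t • w ∈ K) → 1 ≤ ‖w‖ → ‖h w‖ ≤ C * ‖w‖ ^ r

/-- The kernel of the Mellin integral over the lines through the origin. -/
noncomputable def lineKernel {E : Type*} [NormedAddCommGroup E] [NormedSpace ℝ E] (Φ : E → ℂ)
    (s : ℂ) (w : E) (t : ℝ) : ℂ :=
  Φ (t • w) * ((|t| : ℝ) : ℂ) ^ (4 * s) / (|t| : ℝ)

/-- The exponent `-5` makes the right side integrable on `ℝ⁴`. Near the origin, decay of order `n ≥
x` absorbs `‖w‖^{-x}`; at infinity `r - x ≤ -5`. -/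
theorem RapidOnCone.exists_bound {K : Set (Fin 4 → ℝ)} {r : ℕ} {h : (Fin 4 → ℝ) → ℂ}
    (hh : RapidOnCone K r h) {x : ℝ} (hx : (r + 5 : ℝ) ≤ x) : ∃ C, 0 ≤ C ∧ ∀ w,
      (∃ t : ℝ, t • w ∈ K) → w ≠ 0 → ‖h w‖ * ‖w‖ ^ (-x) ≤ C * (1 + ‖w‖) ^ (-5 : ℝ) := by
  obtain ⟨n, hn⟩ := exists_nat_ge x
  obtain ⟨C₁, h₁⟩ := hh.near n
  obtain ⟨C₂, h₂⟩ := hh.far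
  -- The factor `32 = 2⁵` comes from `1 + ‖w‖ ≤ 2` near the origin and `1 + ‖w‖ ≤ 2‖w‖` far from it.
  refine ⟨(|C₁| + |C₂|) * 32, by positivity, fun w hw hw0 => ?_⟩
  have hpos : 0 < ‖w‖ := norm_pos_iff.2 hw0
  have e32 : (2 : ℝ) ^ (-5 : ℝ) * 32 = 1 := by
    rw [Real.rpow_neg (by norm_num)]; norm_num
  have h32 : (0 : ℝ) < 2 ^ (-5 : ℝ) := by positivity
  rcases le_total ‖w‖ 1 with hw1 | hw1
  · have h3 : ‖h w‖ * ‖w‖ ^ (-x) ≤ |C₁| := by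
      calc _ ≤ (|C₁| * ‖w‖ ^ n) * ‖w‖ ^ (-x) :=
            mul_le_mul_of_nonneg_right ((h₁ w hw hw1).trans (mul_le_mul_of_nonneg_right
              (le_abs_self _) (by positivity))) (by positivity)
        _ = |C₁| * ‖w‖ ^ ((n : ℝ) - x) := by
            rw [mul_assoc, ← Real.rpow_natCast, ← Real.rpow_add hpos]; rfl
        _ ≤ |C₁| * 1 := mul_le_mul_of_nonneg_left
            (Real.rpow_le_one hpos.le hw1 (by linarith)) (abs_nonneg _)
        _ = _ := mul_one _
    have h4 : (2 : ℝ) ^ (-5 : ℝ) ≤ (1 + ‖w‖) ^ (-5 : ℝ) :=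
      Real.rpow_le_rpow_of_nonpos (by linarith) (by linarith) (by norm_num)
    calc _ ≤ |C₁| * (2 ^ (-5 : ℝ) * 32) := by rw [e32, mul_one]; exact h3
      _ ≤ (|C₁| + |C₂|) * ((1 + ‖w‖) ^ (-5 : ℝ) * 32) := by
          gcongr; linarith [abs_nonneg C₂]
      _ = _ := by ring
  · have h3 : ‖h w‖ * ‖w‖ ^ (-x) ≤ |C₂| * ‖w‖ ^ (-5 : ℝ) := by
      calc _ ≤ (|C₂| * ‖w‖ ^ r) * ‖w‖ ^ (-x) :=
            mul_le_mul_of_nonneg_right ((h₂ w hw hw1).trans (mul_le_mul_of_nonneg_right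
              (le_abs_self _) (by positivity))) (by positivity)
        _ = |C₂| * ‖w‖ ^ ((r : ℝ) - x) := by
            rw [mul_assoc, ← Real.rpow_natCast, ← Real.rpow_add hpos]; rfl
        _ ≤ |C₂| * ‖w‖ ^ (-5 : ℝ) := mul_le_mul_of_nonneg_left
            (Real.rpow_le_rpow_of_exponent_le hw1 (by linarith)) (abs_nonneg _)
    have h4 : 2 ^ (-5 : ℝ) * ‖w‖ ^ (-5 : ℝ) ≤ (1 + ‖w‖) ^ (-5 : ℝ) := by
      rw [← Real.mul_rpow (by norm_num) hpos.le]
      exact Real.rpow_le_rpow_of_nonpos (by linarith) (by linarith) (by norm_num)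
    calc _ ≤ |C₂| * ‖w‖ ^ (-5 : ℝ) * (2 ^ (-5 : ℝ) * 32) := by rw [e32, mul_one]; exact h3
      _ = |C₂| * (2 ^ (-5 : ℝ) * ‖w‖ ^ (-5 : ℝ)) * 32 := by ring
      _ ≤ (|C₁| + |C₂|) * (1 + ‖w‖) ^ (-5 : ℝ) * 32 := by
          gcongr; linarith [abs_nonneg C₁]
      _ = _ := by ring

/-! ### Bounds for the line kernel, Fubini and Mellin inversion -/

section
variable {U : Set (Fin 4 → ℝ)} {r : ℕ} {h : (Fin 4 → ℝ) → ℂ} {Φ : (Fin 4 → ℝ) → ℂ}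

theorem norm_lineKernel (s : ℂ) (w : Fin 4 → ℝ) {t : ℝ} (ht : t ≠ 0) :
    ‖lineKernel Φ s w t‖ = ‖Φ (t • w)‖ * |t| ^ (4 * s.re - 1) := by
  have h0 : 0 < |t| := abs_pos.2 ht
  rw [lineKernel, norm_div, norm_mul, Complex.norm_cpow_eq_rpow_re_of_pos h0, Complex.norm_real,
    Real.norm_eq_abs, abs_abs, Real.rpow_sub_one h0.ne', mul_div_assoc]
  simp

/-- A pointwise bound of the line kernel. -/
theorem norm_lineKernel_le {b M : ℝ} (hM : ∀ w, ‖Φ w‖ ≤ M)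
    (hb : ∀ w, Φ w ≠ 0 → ‖w‖ ≤ b) {s : ℂ} (hs : 1 ≤ 4 * s.re) {w : Fin 4 → ℝ} (hw : w ≠ 0) (t : ℝ) :
    ‖lineKernel Φ s w t‖ ≤ (Metric.closedBall (0 : ℝ) (b / ‖w‖)).indicator
      (fun _ => M * (b / ‖w‖) ^ (4 * s.re - 1)) t := by
  have hpos : 0 < ‖w‖ := norm_pos_iff.2 hw
  have hM0 : 0 ≤ M := (norm_nonneg _).trans (hM 0)
  by_cases h0 : lineKernel Φ s w t = 0
  · rw [h0, norm_zero]
    by_cases ht : t ∈ Metric.closedBall (0 : ℝ) (b / ‖w‖)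
    · rw [Set.indicator_of_mem ht]
      have : 0 ≤ b / ‖w‖ := dist_nonneg.trans ht
      positivity
    · rw [Set.indicator_of_notMem ht]
  have ht0 : t ≠ 0 := by rintro rfl; simp [lineKernel] at h0
  have hΦ : Φ (t • w) ≠ 0 := by intro h; simp [lineKernel, h] at h0
  have ht : |t| ≤ b / ‖w‖ := by
    rw [le_div_iff₀ hpos]
    simpa [norm_smul] using hb _ hΦ
  rw [Set.indicator_of_mem (by simpa using ht), norm_lineKernel s w ht0]
  exact mul_le_mul (hM _) (Real.rpow_le_rpow (abs_nonneg _) ht (by linarith)) (by positivity) hM0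

theorem measurable_lineKernel (hΦ : Continuous Φ) (s : ℂ) :
    Measurable fun p : (Fin 4 → ℝ) × ℝ => lineKernel Φ s p.1 p.2 := by
  unfold lineKernel
  have h1 : Measurable fun p : (Fin 4 → ℝ) × ℝ => Φ (p.2 • p.1) :=
    (hΦ.comp (continuous_snd.smul continuous_fst)).measurable
  have h2 : Measurable fun p : (Fin 4 → ℝ) × ℝ => ((|p.2| : ℝ) : ℂ) :=
    (Complex.continuous_ofReal.comp continuous_snd.abs).measurable
  exact (h1.mul (h2.pow_const _)).div h2

/-- By compact support of `Φ` the kernel lives on `|t| ≤ b/‖w‖`, so its absolute integral over `t`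
is at most a constant times `‖w‖^{-4 Re s}`. It vanishes for `w` off the cone over the support, and
on the cone `RapidOnCone.exists_bound` applies. -/
theorem integrable_mul_lineKernel (hU : MeasurableSet U) (hU0 : (0 : Fin 4 → ℝ) ∉ U)
    (hh : ContinuousOn h U) (hΦ : Continuous Φ) (hc : HasCompactSupport Φ)
    (hr : RapidOnCone (tsupport Φ) r h) {s : ℂ} (hs : (r + 5 : ℝ) ≤ 4 * s.re) :
    Integrable (fun p : (Fin 4 → ℝ) × ℝ => h p.1 * lineKernel Φ s p.1 p.2)
      ((volume.restrict U).prod volume) := by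
  obtain ⟨M, hM⟩ := hc.exists_bound_of_continuous hΦ
  obtain ⟨b, hb⟩ := hc.isCompact.isBounded.exists_norm_le
  have hb' : ∀ w, Φ w ≠ 0 → ‖w‖ ≤ b := fun w hw => hb w (subset_tsupport Φ hw)
  have hM0 : 0 ≤ M := (norm_nonneg _).trans (hM 0)
  have hs1 : 1 ≤ 4 * s.re := by
    have : (0 : ℝ) ≤ r := Nat.cast_nonneg r
    linarith
  have hmeas : AEStronglyMeasurable (fun p : (Fin 4 → ℝ) × ℝ => h p.1 * lineKernel Φ s p.1 p.2)
      ((volume.restrict U).prod volume) :=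
    (hh.aestronglyMeasurable hU).comp_fst.mul (measurable_lineKernel hΦ s).aestronglyMeasurable
  have hint : ∀ w : Fin 4 → ℝ, w ≠ 0 → Integrable (lineKernel Φ s w) := by
    intro w hw
    refine Integrable.mono' (g := (Metric.closedBall (0 : ℝ) (b / ‖w‖)).indicator
      (fun _ => M * (b / ‖w‖) ^ (4 * s.re - 1))) ?_ ?_ (Filter.Eventually.of_forall
        (norm_lineKernel_le hM hb' hs1 hw))
    · exact (integrableOn_const measure_closedBall_lt_top.ne).integrable_indicator
        measurableSet_closedBall
    · exact ((measurable_lineKernel hΦ s).comp measurable_prodMk_left).aestronglyMeasurable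
  rw [integrable_prod_iff hmeas]
  refine ⟨?_, ?_⟩
  · filter_upwards [ae_restrict_mem hU] with w hw
    exact (hint w (fun h => hU0 (h ▸ hw))).const_mul _
  · obtain ⟨C, hC, hCb⟩ := hr.exists_bound hs
    have hJ : Integrable (fun w : Fin 4 → ℝ => (C * (2 * M * |b| ^ (4 * s.re))) * (1 + ‖w‖) ^ (-5 : ℝ))
        (volume.restrict U) :=
      ((integrable_one_add_norm (by simp; norm_num)).const_mul _).mono_measure Measure.restrict_le_self
    refine hJ.mono' hmeas.norm.integral_prod_right' ?_
    filter_upwards [ae_restrict_mem hU] with w hw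
    have hw0 : w ≠ 0 := fun h => hU0 (h ▸ hw)
    have hpos : 0 < ‖w‖ := norm_pos_iff.2 hw0
    rw [Real.norm_of_nonneg (integral_nonneg fun _ => norm_nonneg _)]
    by_cases hcone : ∃ t : ℝ, t • w ∈ tsupport Φ
    · have hb0 : 0 ≤ b := by
        obtain ⟨t, ht⟩ := hcone
        exact (norm_nonneg _).trans (hb _ ht)
      rw [abs_of_nonneg hb0]
      have hI : ∫ t, ‖lineKernel Φ s w t‖ ≤ 2 * M * b ^ (4 * s.re) * ‖w‖ ^ (-(4 * s.re)) := by
        have hbw : 0 ≤ b / ‖w‖ := by positivity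
        calc _ ≤ ∫ t, (Metric.closedBall (0 : ℝ) (b / ‖w‖)).indicator
              (fun _ => M * (b / ‖w‖) ^ (4 * s.re - 1)) t :=
              integral_mono (hint w hw0).norm ((integrableOn_const
                measure_closedBall_lt_top.ne).integrable_indicator measurableSet_closedBall)
                (norm_lineKernel_le hM hb' hs1 hw0)
          _ = 2 * (b / ‖w‖) * (M * (b / ‖w‖) ^ (4 * s.re - 1)) := by
              rw [integral_indicator measurableSet_closedBall, setIntegral_const, measureReal_def,
                Real.volume_closedBall, ENNReal.toReal_ofReal (by positivity), smul_eq_mul]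
          _ = 2 * M * ((b / ‖w‖) * (b / ‖w‖) ^ (4 * s.re - 1)) := by ring
          _ = 2 * M * (b / ‖w‖) ^ (4 * s.re) := by
              rcases eq_or_lt_of_le hbw with h0 | h0
              · rw [← h0, zero_mul, Real.zero_rpow (by linarith)]
              · rw [Real.rpow_sub_one h0.ne', mul_div_cancel₀ _ h0.ne']
          _ = _ := by
              rw [Real.div_rpow hb0 hpos.le, Real.rpow_neg hpos.le]; ring
      simp only [norm_mul]
      rw [integral_const_mul]
      calc _ ≤ ‖h w‖ * (2 * M * b ^ (4 * s.re) * ‖w‖ ^ (-(4 * s.re))) :=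
            mul_le_mul_of_nonneg_left hI (norm_nonneg _)
        _ = (2 * M * b ^ (4 * s.re)) * (‖h w‖ * ‖w‖ ^ (-(4 * s.re))) := by ring
        _ ≤ (2 * M * b ^ (4 * s.re)) * (C * (1 + ‖w‖) ^ (-5 : ℝ)) :=
            mul_le_mul_of_nonneg_left (hCb w hcone hw0) (by positivity)
        _ = _ := by ring
    · have h0 : ∀ t, lineKernel Φ s w t = 0 := by
        intro t
        have : Φ (t • w) = 0 := by
          by_contra h
          exact hcone ⟨t, subset_tsupport Φ h⟩
        simp [lineKernel, this]
      simp only [h0, mul_zero, norm_zero, integral_zero]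
      positivity

/-- The average of `h` over the dilates of the weight `Φ`. -/
noncomputable def dilationAverage (h Φ : (Fin 4 → ℝ) → ℂ) (t : ℝ) : ℂ := ∫ k, h (t⁻¹ • k) * Φ k

/-- Substitution `k = tw`. The Jacobian `t⁻⁴` and the factor `1/t` of the kernel turn `t^{4s}` into
the Mellin weight at `4s - 4`. -/
theorem integral_mul_lineKernel (hUs : ∀ (t : ℝ) w, t • w ∈ U → w ∈ U)
    (hΦU : tsupport Φ ⊆ U) (s : ℂ) {t : ℝ} (ht : 0 < t) :
    ∫ w in U, h w * lineKernel Φ s w t = (t : ℂ) ^ (4 * s - 4 - 1) • dilationAverage h Φ t := by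
  have h1 : ∫ w in U, h w * lineKernel Φ s w t = ∫ w, h w * lineKernel Φ s w t := by
    refine setIntegral_eq_integral_of_forall_compl_eq_zero fun w hw => ?_
    have : Φ (t • w) = 0 := by
      by_contra h
      exact hw (hUs t w (hΦU (subset_tsupport Φ h)))
    simp [lineKernel, this]
  have h2 : ∀ w, h w * lineKernel Φ s w t =
      ((t : ℂ) ^ (4 * s) / t) * ((fun k => h (t⁻¹ • k) * Φ k) (t • w)) := by
    intro w
    simp only [lineKernel, abs_of_pos ht]
    rw [inv_smul_smul₀ ht.ne']
    ring
  rw [h1]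
  simp_rw [h2]
  rw [integral_const_mul, Measure.integral_comp_smul volume (fun k => h (t⁻¹ • k) * Φ k),
    dilationAverage]
  have htc : (t : ℂ) ≠ 0 := Complex.ofReal_ne_zero.2 ht.ne'
  have h4 : ((4 : ℕ) : ℂ) = 4 := by norm_num
  rw [Module.finrank_fin_fun, abs_of_pos (by positivity), Complex.real_smul, smul_eq_mul,
    Complex.cpow_sub _ _ htc, Complex.cpow_sub _ _ htc, Complex.cpow_one, ← h4,
    Complex.cpow_natCast]
  push_cast
  field_simp

theorem integral_even {F : ℝ → ℂ} (hF : Integrable F) (he : ∀ t, F (-t) = F t) :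
    ∫ t, F t = 2 * ∫ t in Set.Ioi 0, F t := by
  rw [← intervalIntegral.integral_Iic_add_Ioi (b := 0) hF.integrableOn hF.integrableOn]
  have := integral_comp_neg_Iic (0 : ℝ) F
  simp only [he, neg_zero] at this
  rw [this, two_mul]

/-- The integral over `U` and all lines is a Mellin transform. -/
theorem integral_eq_mellin (hU : MeasurableSet U) (hU0 : (0 : Fin 4 → ℝ) ∉ U)
    -- Stability of `U` under dilations, together with evenness of `h`, lets the integral over the
    -- whole line in `t` be folded onto the positive half-line; this produces the factor `2`.
    (hUs : ∀ (t : ℝ) w, t • w ∈ U → w ∈ U) (hΦU : tsupport Φ ⊆ U)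
    (hh : ContinuousOn h U) (heven : ∀ w, h (-w) = h w) (hneg : ∀ w ∈ U, -w ∈ U)
    (hΦ : Continuous Φ) (hc : HasCompactSupport Φ)
    (hr : RapidOnCone (tsupport Φ) r h) {s : ℂ} (hs : (r + 5 : ℝ) ≤ 4 * s.re) :
    MellinConvergent (dilationAverage h Φ) (4 * s - 4) ∧
    ∫ w in U, h w * ∫ t, lineKernel Φ s w t = 2 * mellin (dilationAverage h Φ) (4 * s - 4) := by
  have hint := integrable_mul_lineKernel hU hU0 hh hΦ hc hr hs
  have hF : Integrable fun t => ∫ w in U, h w * lineKernel Φ s w t := hint.integral_prod_right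
  have he : ∀ t, ∫ w in U, h w * lineKernel Φ s w (-t) = ∫ w in U, h w * lineKernel Φ s w t := by
    intro t
    have hpre : (fun w : Fin 4 → ℝ => -w) ⁻¹' U = U := by
      ext w
      exact ⟨fun hw => by simpa using hneg _ hw, fun hw => hneg w hw⟩
    have hmp := (Measure.measurePreserving_neg (volume : Measure (Fin 4 → ℝ))).restrict_preimage hU
    rw [hpre] at hmp
    rw [← hmp.integral_comp (Homeomorph.neg (Fin 4 → ℝ)).measurableEmbedding]
    refine integral_congr_ae (Filter.Eventually.of_forall fun w => ?_)
    simp [lineKernel, heven]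
  have hcongr : ∀ t ∈ Set.Ioi (0 : ℝ), ∫ w in U, h w * lineKernel Φ s w t =
      (t : ℂ) ^ (4 * s - 4 - 1) • dilationAverage h Φ t :=
    fun t ht => integral_mul_lineKernel hUs hΦU s ht
  refine ⟨(integrableOn_congr_fun hcongr measurableSet_Ioi).1 hF.integrableOn, ?_⟩
  calc _ = ∫ w in U, ∫ t, h w * lineKernel Φ s w t := by simp only [integral_const_mul]
    _ = ∫ t, ∫ w in U, h w * lineKernel Φ s w t := integral_integral_swap hint
    _ = 2 * ∫ t in Set.Ioi 0, ∫ w in U, h w * lineKernel Φ s w t := integral_even hF he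
    _ = _ := by rw [mellin, setIntegral_congr_fun measurableSet_Ioi hcongr]

/-- The continuity hypothesis of Mellin inversion. The integrand is jointly continuous for `t > 0`
and supported in the fixed compact set `tsupport Φ`; off that set it vanishes locally, whatever `h`
does outside `U`. -/
theorem continuousAt_dilationAverage (hU : IsOpen U) (hUs : ∀ (t : ℝ) w, t • w ∈ U → w ∈ U)
    (hΦU : tsupport Φ ⊆ U) (hh : ContinuousOn h U) (hΦ : Continuous Φ) (hc : HasCompactSupport Φ) :
    ContinuousAt (dilationAverage h Φ) 1 := by
  have hcont : ContinuousOn (dilationAverage h Φ) (Set.Ioi 0) := by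
    refine continuousOn_integral_of_compact_support (k := tsupport Φ) hc.isCompact ?_ ?_
    · rintro ⟨t, k⟩ ⟨ht, -⟩
      have ht' : (0 : ℝ) < t := ht
      refine ContinuousAt.continuousWithinAt ?_
      by_cases hk : k ∈ tsupport Φ
      · have h1 : t⁻¹ • k ∈ U := hUs t _ (by rw [smul_inv_smul₀ ht'.ne']; exact hΦU hk)
        have h2 : ContinuousAt (fun p : ℝ × (Fin 4 → ℝ) => p.1⁻¹ • p.2) (t, k) :=
          (continuousAt_fst.inv₀ ht'.ne').smul continuousAt_snd
        have h3 : ContinuousAt (fun p : ℝ × (Fin 4 → ℝ) => h (p.1⁻¹ • p.2)) (t, k) :=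
          ContinuousAt.comp (g := h) (hh.continuousAt (hU.mem_nhds h1)) h2
        exact h3.mul (hΦ.continuousAt.comp continuousAt_snd)
      · have h1 : ∀ᶠ p : ℝ × (Fin 4 → ℝ) in 𝓝 (t, k), p.2 ∈ (tsupport Φ)ᶜ :=
          continuousAt_snd.eventually ((isClosed_tsupport Φ).isOpen_compl.mem_nhds hk)
        refine (continuousAt_const (y := (0 : ℂ))).congr ?_
        filter_upwards [h1] with p hp
        simp [Function.uncurry, image_eq_zero_of_notMem_tsupport hp]
    · intro t k _ hk
      simp [image_eq_zero_of_notMem_tsupport hk]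
  exact hcont.continuousAt (Ioi_mem_nhds one_pos)

/-- If the integrals vanish for all large `s` then so does the average at `1`. -/
theorem dilationAverage_one_eq_zero (hU : IsOpen U) (hU0 : (0 : Fin 4 → ℝ) ∉ U)
    (hUs : ∀ (t : ℝ) w, t • w ∈ U → w ∈ U) (hΦU : tsupport Φ ⊆ U)
    (hh : ContinuousOn h U) (heven : ∀ w, h (-w) = h w) (hneg : ∀ w ∈ U, -w ∈ U)
    (hΦ : Continuous Φ) (hc : HasCompactSupport Φ) (hr : RapidOnCone (tsupport Φ) r h) {σ : ℝ}
    (hσ : (r + 5 : ℝ) ≤ 4 * σ)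
    (hz : ∀ s : ℂ, σ < s.re → ∫ w in U, h w * ∫ t, lineKernel Φ s w t = 0) :
    dilationAverage h Φ 1 = 0 := by
  have hmel : ∀ y : ℝ, mellin (dilationAverage h Φ) ((4 * σ : ℝ) + y * Complex.I) = 0 := by
    intro y
    -- Chosen so that `4s - 4` runs over the vertical line of real part `4σ`; then `Re s = σ + 1`
    -- lies in the range of the hypothesis.
    let s : ℂ := ((4 * σ : ℝ) + y * Complex.I + 4) / 4
    have hre : s.re = σ + 1 := by
      simp [s]; ring
    have h1 := (integral_eq_mellin hU.measurableSet hU0 hUs hΦU hh heven hneg hΦ hc hr (s := s)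
      (by rw [hre]; linarith)).2
    rw [hz s (by rw [hre]; linarith)] at h1
    have h2 : 4 * s - 4 = (4 * σ : ℝ) + y * Complex.I := by simp only [s]; ring
    rw [h2] at h1
    simpa using h1.symm
  have hconv : MellinConvergent (dilationAverage h Φ) ((4 * σ : ℝ) : ℂ) := by
    have h1 := (integral_eq_mellin hU.measurableSet hU0 hUs hΦU hh heven hneg hΦ hc hr
      (s := ((σ + 1 : ℝ) : ℂ)) (by rw [Complex.ofReal_re]; linarith)).1
    have h2 : 4 * ((σ + 1 : ℝ) : ℂ) - 4 = ((4 * σ : ℝ) : ℂ) := by push_cast; ring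
    rwa [h2] at h1
  -- The Mellin transform vanishes identically on this line, so no decay estimate is needed for the
  -- inversion.
  have hvert : Complex.VerticalIntegrable (mellin (dilationAverage h Φ)) (4 * σ) := by
    unfold Complex.VerticalIntegrable
    simp only [hmel]
    exact integrable_zero _ _ _
  rw [← mellinInv_mellin_eq (4 * σ) (dilationAverage h Φ) one_pos hconv hvert
    (continuousAt_dilationAverage hU hUs hΦU hh hΦ hc), mellinInv]
  simp only [hmel, smul_zero, integral_zero]

end

/-! ### The section of the big cell -/

theorem J4_transpose_J4 (M : Matrix (Fin 4) (Fin 4) ℝ) :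
    J4 ℝ * Mᵀ * (-J4 ℝ) = !![M 2 2, M 3 2, -M 0 2, -M 1 2; M 2 3, M 3 3, -M 0 3, -M 1 3;
      -M 2 0, -M 3 0, M 0 0, M 1 0; -M 2 1, -M 3 1, M 0 1, M 1 1] := by
  ext i j
  fin_cases i <;> fin_cases j <;>
    simp [J4, Matrix.mul_apply, Matrix.vecMul, dotProduct, Fin.sum_univ_four]

theorem abs_inv_apply {g : GSp4 ℝ} (hg : |simil g| = 1) (i j : Fin 4) :
    |(g⁻¹).1.1 i j| = |(J4 ℝ * (g.1.1 : Matrix (Fin 4) (Fin 4) ℝ)ᵀ * (-J4 ℝ)) i j| := by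
  rw [← simil_smul_inv, Matrix.smul_apply, smul_eq_mul, abs_mul, hg, one_mul]

theorem height_eq_two_mul {g : GSp4 ℝ} (hg : |simil g| = 1) : height g = 2 * entrySum g.1.1 := by
  have h : entrySum (g⁻¹).1.1 = entrySum g.1.1 := by
    unfold entrySum
    simp only [abs_inv_apply hg, J4_transpose_J4]
    simp [Fin.sum_univ_four]
    ring
  rw [height_eq, h, two_mul]

/-- The matrix `g⁻¹Xg` is the product of the second column of `g⁻¹` and the last row of `g`. When
`|ν| = 1` that column is, up to signs and order, again the last row, so the entries are quadratic in
it. All decay at the origin comes from here. -/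
theorem entrySum_siegelLieConj_le {g : GSp4 ℝ} (hg : |simil g| = 1) :
    entrySum (siegelLieConj g).1 ≤ 16 * ‖(g.1.1 : Matrix (Fin 4) (Fin 4) ℝ) 3‖ ^ 2 := by
  have h1 : ∀ i j, (siegelLieConj g).1 i j = (g⁻¹).1.1 i 1 * g.1.1 3 j := by
    intro i j
    rw [siegelLieConj_val]
    simp [Matrix.mul_apply, Matrix.single, Fin.sum_univ_four]
  have hw : ∀ j, |g.1.1 3 j| ≤ ‖(g.1.1 : Matrix (Fin 4) (Fin 4) ℝ) 3‖ := fun j =>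
    norm_le_pi_norm ((g.1.1 : Matrix (Fin 4) (Fin 4) ℝ) 3) j
  have hi : ∀ i, |(g⁻¹).1.1 i 1| ≤ ‖(g.1.1 : Matrix (Fin 4) (Fin 4) ℝ) 3‖ := by
    intro i
    rw [abs_inv_apply hg, J4_transpose_J4]
    fin_cases i
    · simpa using hw 2
    · simpa using hw 3
    · simpa using hw 0
    · simpa using hw 1
  calc entrySum (siegelLieConj g).1
      ≤ ∑ _i : Fin 4, ∑ _j : Fin 4, ‖(g.1.1 : Matrix (Fin 4) (Fin 4) ℝ) 3‖ ^ 2 := by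
        refine Finset.sum_le_sum fun i _ => Finset.sum_le_sum fun j _ => ?_
        rw [h1, abs_mul, pow_two]
        exact mul_le_mul (hi i) (hw j) (abs_nonneg _) (norm_nonneg _)
    _ = _ := by simp; ring

/-- The norm form of the first component of a row vector. -/
def bigCellNorm (D : ℤ) (w : Fin 4 → ℝ) : ℝ :=
  w 0 ^ 2 + quadB D * (w 0 * w 1) - quadA D * w 1 ^ 2

theorem ringInverse_eq (D : ℤ) {w : Fin 4 → ℝ} (hw : w ∈ bigCell D) :
    Ring.inverse (⟨w 0, w 1⟩ : LAlg D ℝ) =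
      ⟨(w 0 + quadB D * w 1) / bigCellNorm D w, -w 1 / bigCellNorm D w⟩ := by
  have hN : bigCellNorm D w ≠ 0 := (isUnit_iff_sq D w).1 hw
  have h1 : (⟨w 0, w 1⟩ : LAlg D ℝ) *
      ⟨(w 0 + quadB D * w 1) / bigCellNorm D w, -w 1 / bigCellNorm D w⟩ = 1 := by
    ext
    · simp only [QuadraticAlgebra.re_mul, QuadraticAlgebra.re_one]
      field_simp
      simp only [bigCellNorm]; ring
    · simp only [QuadraticAlgebra.im_mul, QuadraticAlgebra.im_one]
      field_simp
      ring
  rw [← mul_one (Ring.inverse _), ← h1, ← mul_assoc, Ring.inverse_mul_cancel _ hw, one_mul]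

theorem isOpen_bigCell (D : ℤ) : IsOpen (bigCell D) := by
  have : bigCell D = {w : Fin 4 → ℝ | bigCellNorm D w ≠ 0} := by
    ext w; exact isUnit_iff_sq D w
  rw [this]
  exact isOpen_ne_fun (by unfold bigCellNorm; fun_prop) continuous_const

theorem smul_mem_bigCell_iff (D : ℤ) {c : ℝ} (hc : c ≠ 0) (w : Fin 4 → ℝ) :
    c • w ∈ bigCell D ↔ w ∈ bigCell D := by
  rw [isUnit_iff_sq, isUnit_iff_sq]
  have : (c • w) 0 ^ 2 + quadB D * ((c • w) 0 * (c • w) 1) - quadA D * (c • w) 1 ^ 2 =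
      c ^ 2 * (w 0 ^ 2 + quadB D * (w 0 * w 1) - quadA D * w 1 ^ 2) := by
    simp; ring
  rw [this]
  simp [hc]

theorem zero_notMem_bigCell (D : ℤ) : (0 : Fin 4 → ℝ) ∉ bigCell D := by
  rw [isUnit_iff_sq]; simp

theorem mem_bigCell_of_smul_mem (D : ℤ) (t : ℝ) (w : Fin 4 → ℝ) (h : t • w ∈ bigCell D) :
    w ∈ bigCell D := by
  have ht : t ≠ 0 := by
    rintro rfl
    rw [zero_smul] at h
    exact zero_notMem_bigCell D h
  exact (smul_mem_bigCell_iff D ht w).1 h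

/-- The image of the section in `GSp₄(ℝ)`. -/
noncomputable def sectG (D : ℤ) (ε : ℤˣ) (w : Fin 4 → ℝ) : GSp4 ℝ := toGSp4 D ℝ (sect D ε w)

theorem sectG_val (D : ℤ) (ε : ℤˣ) {w : Fin 4 → ℝ} (hw : w ∈ bigCell D) :
    ((sectG D ε w).1.1 : Matrix (Fin 4) (Fin 4) ℝ) =
      let b : ℝ := quadB D
      let a : ℝ := quadA D
      let p : ℝ := -((ε : ℤ) : ℝ) * ((w 0 + b * w 1) / bigCellNorm D w)
      let q : ℝ := -((ε : ℤ) : ℝ) * (-w 1 / bigCellNorm D w)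
      !![0, 0, q, p + b * q; 0, 0, p + b * q, a * q + b * (p + b * q);
        a * w 1 - b * w 0, w 0, w 3 - b * w 2, a * w 2; w 0, w 1, w 2, w 3] := by
  change embedMatrix D ℝ ((sect D ε w).1 : Matrix (Fin 2) (Fin 2) (LAlg D ℝ)) = _
  rw [sect_val _ _ _ hw]
  unfold sectMatrix
  rw [ringInverse_eq D hw]
  ext i j
  fin_cases i <;> fin_cases j <;> simp [embedMatrix]

theorem simil_sectG (D : ℤ) (ε : ℤˣ) (w : Fin 4 → ℝ) (hw : w ∈ bigCell D) :
    simil (sectG D ε w) = ((ε : ℤ) : ℝ) := by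
  have h := embedMatrix_mul_J4 D ℝ ((sect D ε w).1 : Matrix (Fin 2) (Fin 2) (LAlg D ℝ))
    ((ε : ℤ) : ℝ) (by rw [sect_val _ _ _ hw, sectMatrix_det _ _ _ hw]; simp)
  have h2 := congrFun (congrFun h 0) 2
  change simil (sectG D ε w) = _ at h2
  rw [h2]
  simp [J4]

theorem abs_simil_sectG (D : ℤ) (ε : ℤˣ) (w : Fin 4 → ℝ) (hw : w ∈ bigCell D) :
    |simil (sectG D ε w)| = 1 := by
  rw [simil_sectG D ε w hw]
  rcases Int.units_eq_one_or ε with rfl | rfl <;> simp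

/-- The upper rows depend on `w` through the inverse of `w 0 + w 1 α`, homogeneous of degree `-1`,
and the lower rows are linear in `w`. -/
theorem sectG_smul_val (D : ℤ) (ε : ℤˣ) {w : Fin 4 → ℝ} (hw : w ∈ bigCell D) {c : ℝ} (hc : c ≠ 0) :
    ((sectG D ε (c • w)).1.1 : Matrix (Fin 4) (Fin 4) ℝ) =
      Matrix.diagonal ![c⁻¹, c⁻¹, c, c] * (sectG D ε w).1.1 := by
  rw [sectG_val D ε hw, sectG_val D ε ((smul_mem_bigCell_iff D hc w).2 hw)]
  have hN : bigCellNorm D w ≠ 0 := (isUnit_iff_sq D w).1 hw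
  have hN' : bigCellNorm D (c • w) = c ^ 2 * bigCellNorm D w := by
    simp [bigCellNorm]; ring
  simp only [hN', Pi.smul_apply, smul_eq_mul]
  ext i j
  rw [Matrix.diagonal_mul]
  fin_cases i <;> fin_cases j <;> simp <;> field_simp

theorem continuous_sectG (D : ℤ) (ε : ℤˣ) :
    Continuous fun w : bigCell D => sectG D ε w := by
  have hN : Continuous fun w : bigCell D => bigCellNorm D w :=
    (show Continuous (bigCellNorm D) by unfold bigCellNorm; fun_prop).comp continuous_subtype_val
  have hN0 : ∀ w : bigCell D, bigCellNorm D w ≠ 0 := fun w => (isUnit_iff_sq D w).1 w.2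
  have hval : Continuous fun w : bigCell D =>
      ((sectG D ε w).1.1 : Matrix (Fin 4) (Fin 4) ℝ) := by
    have he : ∀ w : bigCell D, ((sectG D ε w).1.1 : Matrix (Fin 4) (Fin 4) ℝ) = _ :=
      fun w => sectG_val D ε w.2
    simp only [he]
    have hw : ∀ i, Continuous fun w : bigCell D => (w : Fin 4 → ℝ) i :=
      fun i => (continuous_apply i).comp continuous_subtype_val
    have hp : Continuous fun w : bigCell D =>
        -((ε : ℤ) : ℝ) * (((w : Fin 4 → ℝ) 0 + quadB D * (w : Fin 4 → ℝ) 1) / bigCellNorm D w) :=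
      continuous_const.mul (((hw 0).add (continuous_const.mul (hw 1))).div hN hN0)
    have hq : Continuous fun w : bigCell D =>
        -((ε : ℤ) : ℝ) * (-(w : Fin 4 → ℝ) 1 / bigCellNorm D w) :=
      continuous_const.mul ((hw 1).neg.div hN hN0)
    have hpq := hp.add ((continuous_const (y := (quadB D : ℝ))).mul hq)
    refine continuous_matrix fun i j => ?_
    fin_cases i <;> fin_cases j
    · exact continuous_const
    · exact continuous_const
    · exact hq
    · exact hpq
    · exact continuous_const
    · exact continuous_const
    · exact hpq
    · exact (continuous_const.mul hq).add (continuous_const.mul hpq)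
    · exact (continuous_const.mul (hw 1)).sub (continuous_const.mul (hw 0))
    · exact hw 0
    · exact (hw 3).sub (continuous_const.mul (hw 2))
    · exact continuous_const.mul (hw 2)
    · exact hw 0
    · exact hw 1
    · exact hw 2
    · exact hw 3
  refine Continuous.subtype_mk (Units.continuous_iff.2 ⟨hval, ?_⟩) _
  have hinv : ∀ w : bigCell D, ((sectG D ε w)⁻¹).1.1 =
      ((ε : ℤ) : ℝ)⁻¹ • (J4 ℝ * ((sectG D ε w).1.1 : Matrix (Fin 4) (Fin 4) ℝ)ᵀ * (-J4 ℝ)) := by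
    intro w
    rw [← simil_smul_inv, simil_sectG D ε w w.2, smul_smul, inv_mul_cancel₀ (by simp), one_smul]
  have h2 : Continuous fun w : bigCell D => ((ε : ℤ) : ℝ)⁻¹ •
      (J4 ℝ * ((sectG D ε w).1.1 : Matrix (Fin 4) (Fin 4) ℝ)ᵀ * (-J4 ℝ)) := by fun_prop
  exact h2.congr fun w => (hinv w).symm

/-- On `K` the height is bounded by continuity of the section. Passing from `tw ∈ K` to `w` costs a
diagonal factor of size `|t| + |t|⁻¹`, comparable to `‖w‖ + ‖w‖⁻¹` because `‖tw‖` stays between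
positive constants on `K`. -/
theorem exists_height_sectG_le (D : ℤ) (ε : ℤˣ) {K : Set (Fin 4 → ℝ)} (hK : IsCompact K)
    (hKU : K ⊆ bigCell D) : ∃ P, 0 ≤ P ∧ ∀ w, (∃ t : ℝ, t • w ∈ K) →
      height (sectG D ε w) ≤ P * (‖w‖ + ‖w‖⁻¹) := by
  have hK0 : ∀ k ∈ K, k ≠ 0 := fun k hk h => zero_notMem_bigCell D (h ▸ hKU hk)
  have hcomp : IsCompact ((↑) ⁻¹' K : Set (bigCell D)) := by
    rw [Topology.IsInducing.subtypeVal.isCompact_preimage_iff (by simpa using hKU)]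
    exact hK
  obtain ⟨M, hM⟩ := hcomp.bddAbove_image (f := fun w : bigCell D => height (sectG D ε w))
    (continuous_height.comp (continuous_sectG D ε)).continuousOn
  obtain ⟨b, hb⟩ := hK.bddAbove_image (f := fun k => ‖k‖ + ‖k‖⁻¹)
    (continuousOn_id.norm.add (continuousOn_id.norm.inv₀ fun k hk => norm_ne_zero_iff.2 (hK0 k hk)))
  have hP : ∀ w, (∃ t : ℝ, t • w ∈ K) → height (sectG D ε w) ≤ 2 * b * M * (‖w‖ + ‖w‖⁻¹) := by
    rintro w ⟨t, htw⟩
    have hU := hKU htw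
    have ht : t ≠ 0 := by
      rintro rfl
      exact hK0 _ htw (zero_smul _ _)
    have hwU := mem_bigCell_of_smul_mem D t w hU
    have hwpos : 0 < ‖w‖ := norm_pos_iff.2 fun h => zero_notMem_bigCell D (h ▸ hwU)
    have hkpos : 0 < ‖t • w‖ := norm_pos_iff.2 (hK0 _ htw)
    have h1 := sectG_smul_val D ε hU (inv_ne_zero ht)
    rw [inv_smul_smul₀ ht] at h1
    have h2 : height (sectG D ε (t • w)) ≤ M :=
      hM ⟨⟨t • w, hU⟩, htw, rfl⟩
    have h3 : ‖t • w‖ + ‖t • w‖⁻¹ ≤ b := hb ⟨t • w, htw, rfl⟩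
    have h4 : entrySum (Matrix.diagonal ![(t⁻¹)⁻¹, (t⁻¹)⁻¹, t⁻¹, t⁻¹]) = 2 * (|t| + |t|⁻¹) := by
      simp [entrySum, Fin.sum_univ_four]; ring
    have ht1 : |t| = ‖t • w‖ * ‖w‖⁻¹ := by
      rw [norm_smul, Real.norm_eq_abs, mul_assoc, mul_inv_cancel₀ hwpos.ne', mul_one]
    have hM0 : 0 ≤ M := (height_nonneg _).trans h2
    have ht2 : |t| + |t|⁻¹ ≤ b * (‖w‖ + ‖w‖⁻¹) := by
      have h5 : |t|⁻¹ = ‖t • w‖⁻¹ * ‖w‖ := by rw [ht1, mul_inv, inv_inv]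
      rw [h5, ht1]
      have h6 : 0 < ‖w‖⁻¹ := inv_pos.2 hwpos
      have h7 : 0 < ‖t • w‖⁻¹ := inv_pos.2 hkpos
      nlinarith
    rw [height_eq_two_mul (abs_simil_sectG D ε w hwU), h1]
    rw [height_eq_two_mul (abs_simil_sectG D ε _ hU)] at h2
    have h8 := entrySum_mul_le (Matrix.diagonal ![(t⁻¹)⁻¹, (t⁻¹)⁻¹, t⁻¹, t⁻¹])
      (sectG D ε (t • w)).1.1
    rw [h4] at h8
    have h9 := entrySum_nonneg (sectG D ε (t • w)).1.1
    have h10 : (|t| + |t|⁻¹) * (2 * entrySum (sectG D ε (t • w)).1.1) ≤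
        (b * (‖w‖ + ‖w‖⁻¹)) * M :=
      mul_le_mul ht2 h2 (by positivity) ((by positivity : (0 : ℝ) ≤ |t| + |t|⁻¹).trans ht2)
    nlinarith
  refine ⟨|2 * b * M|, abs_nonneg _, fun w hw => (hP w hw).trans ?_⟩
  exact mul_le_mul_of_nonneg_right (le_abs_self _) (by positivity)

/-- Scaling by `-1` gives the scalar matrix `-1`. With the trivial central character this makes the
coefficient even in `w`. -/
theorem sectG_neg (D : ℤ) (ε : ℤˣ) {w : Fin 4 → ℝ} (hw : w ∈ bigCell D) :
    sectG D ε (-w) = GSp4.center (-1) * sectG D ε w := by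
  apply Subtype.ext; apply Units.ext
  change (sectG D ε (-w)).1.1 = algebraMap ℝ (Matrix (Fin 4) (Fin 4) ℝ) ((-1 : ℝˣ) : ℝ) * (sectG D ε w).1.1
  have h := sectG_smul_val D ε hw (c := -1) (by norm_num)
  rw [neg_one_smul] at h
  rw [h, Matrix.algebraMap_eq_diagonal]
  congr 2
  funext i
  fin_cases i <;> norm_num

theorem realCoeff_center {φ : GSp4A → ℂ} (hφ : IsCuspForm φ) (D : ℤ) (ψ : AddChar AdeleQ Circle)
    (z : ℝˣ) (g : GSp4 ℝ) : realCoeff D ψ φ (GSp4.center z * g) = realCoeff D ψ φ g := by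
  have hc : ∀ u : GSp4 ℝ, u * GSp4.center z = GSp4.center z * u := by
    intro u
    apply Subtype.ext; apply Units.ext
    exact (Algebra.commutes (z : ℝ) (u.1.1 : Matrix (Fin 4) (Fin 4) ℝ)).symm
  have h1 : (GSp4.center (1 : FinAdeleˣ)) = 1 := by
    apply Subtype.ext; apply Units.ext
    exact map_one (algebraMap FinAdele (Matrix (Fin 4) (Fin 4) FinAdele))
  unfold realCoeff
  congr 1
  funext x
  rw [translateU, translateU, ← hφ.central z 1 (siegelU x.1.1 x.2.1.1 x.2.2.1 * g, _), h1,
    Prod.mk_mul_mk, one_mul, ← mul_assoc, ← mul_assoc, hc]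

/-- The Fourier coefficient along the section is rapidly decreasing on compactly generated cones in
the big cell. -/
theorem rapidOnCone_realCoeff {ψ : AddChar AdeleQ Circle} (hψ : IsStandardAddChar ψ) {r : ℕ}
    {φ : GSp4A → ℂ} (hφ : PeriodicWithGrowth r φ) (D : ℤ) (ε : ℤˣ) {K : Set (Fin 4 → ℝ)}
    (hK : IsCompact K) (hKU : K ⊆ bigCell D) :
    RapidOnCone K r fun w => realCoeff D ψ φ (sectG D ε w) := by
  obtain ⟨P, hP0, hP⟩ := exists_height_sectG_le D ε hK hKU
  have hmem : ∀ w, (∃ t : ℝ, t • w ∈ K) → w ∈ bigCell D := fun w ⟨t, ht⟩ =>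
    mem_bigCell_of_smul_mem D t w (hKU ht)
  have hpos : ∀ w, (∃ t : ℝ, t • w ∈ K) → 0 < ‖w‖ := fun w hw =>
    norm_pos_iff.2 fun h => zero_notMem_bigCell D (h ▸ hmem w hw)
  have hgen : ∀ n : ℕ, ∃ C, 0 ≤ C ∧ ∀ w, (∃ t : ℝ, t • w ∈ K) →
      ‖realCoeff D ψ φ (sectG D ε w)‖ ≤
        C * (16 * ‖w‖ ^ 2) ^ n * (P * (‖w‖ + ‖w‖⁻¹)) ^ r := by
    intro n
    obtain ⟨C, hC, h⟩ := norm_realCoeff_le_pow hψ hφ D n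
    refine ⟨C, hC, fun w hw => (h _).trans ?_⟩
    have h1 := entrySum_siegelLieConj_le (abs_simil_sectG D ε w (hmem w hw))
    have hrow : (sectG D ε w).1.1 3 = w := toGSp4_sect D ε w (hmem w hw)
    rw [hrow] at h1
    exact mul_le_mul (mul_le_mul_of_nonneg_left (pow_le_pow_left₀ (entrySum_nonneg _) h1 n) hC)
      (pow_le_pow_left₀ (height_nonneg _) (hP w hw) r) (pow_nonneg (height_nonneg _) r)
      (by positivity)
  refine ⟨fun n => ?_, ?_⟩
  -- With `n + r` derivatives the gain is `‖w‖^{2(n+r)}`: a factor `‖w‖^r` cancels the height,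
  -- `‖w‖^n` is the required decay, and the remaining `‖w‖^{n+r}` is at most `1`.
  · obtain ⟨C, hC, h⟩ := hgen (n + r)
    refine ⟨C * 16 ^ (n + r) * (2 * P) ^ r, fun w hw hw1 => (h w hw).trans ?_⟩
    have h0 := hpos w hw
    have h2 : ‖w‖ + ‖w‖⁻¹ ≤ 2 * ‖w‖⁻¹ := by
      have : 1 ≤ ‖w‖⁻¹ := (one_le_inv₀ h0).2 hw1
      linarith
    calc _ ≤ C * (16 * ‖w‖ ^ 2) ^ (n + r) * (P * (2 * ‖w‖⁻¹)) ^ r := by gcongr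
      _ = C * 16 ^ (n + r) * (2 * P) ^ r * ‖w‖ ^ n * ‖w‖ ^ (n + r) * (‖w‖ * ‖w‖⁻¹) ^ r := by
          simp only [mul_pow, pow_add]; ring
      _ = C * 16 ^ (n + r) * (2 * P) ^ r * ‖w‖ ^ n * ‖w‖ ^ (n + r) := by
          rw [mul_inv_cancel₀ h0.ne', one_pow, mul_one]
      _ ≤ C * 16 ^ (n + r) * (2 * P) ^ r * ‖w‖ ^ n * 1 :=
          mul_le_mul_of_nonneg_left (pow_le_one₀ h0.le hw1) (by positivity)
      _ = _ := mul_one _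
  · obtain ⟨C, hC, h⟩ := hgen 0
    refine ⟨C * (2 * P) ^ r, fun w hw hw1 => (h w hw).trans ?_⟩
    have h2 : ‖w‖ + ‖w‖⁻¹ ≤ 2 * ‖w‖ := by
      have : ‖w‖⁻¹ ≤ 1 := inv_le_one_of_one_le₀ hw1
      linarith
    calc _ ≤ C * (16 * ‖w‖ ^ 2) ^ 0 * (P * (2 * ‖w‖)) ^ r := by gcongr
      _ = _ := by simp only [mul_pow, pow_zero]; ring

/-! ### Non-vanishing of the archimedean integral -/

theorem RapidOnCone.sum {E ι : Type*} [NormedAddCommGroup E] [NormedSpace ℝ E] [Fintype ι]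
    {K : Set E} {r : ℕ} {h : ι → E → ℂ} (hh : ∀ i, RapidOnCone K r (h i)) :
    RapidOnCone K r fun w => ∑ i, h i w := by
  refine ⟨fun n => ?_, ?_⟩
  · choose C hC using fun i => (hh i).near n
    refine ⟨∑ i, C i, fun w hw hw1 => (norm_sum_le _ _).trans ?_⟩
    rw [Finset.sum_mul]
    exact Finset.sum_le_sum fun i _ => hC i w hw hw1
  · choose C hC using fun i => (hh i).far
    refine ⟨∑ i, C i, fun w hw hw1 => (norm_sum_le _ _).trans ?_⟩
    rw [Finset.sum_mul]
    exact Finset.sum_le_sum fun i _ => hC i w hw hw1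

/-- A Schwartz function with compact support in an open set that detects a nonzero value. -/
theorem exists_schwartz_integral_ne_zero {U : Set (Fin 4 → ℝ)} (hU : IsOpen U)
    {h : (Fin 4 → ℝ) → ℂ} (hh : ContinuousOn h U) {k₀ : Fin 4 → ℝ} (hk₀ : k₀ ∈ U) (h0 : h k₀ ≠ 0) :
    ∃ Φ : 𝓢(Fin 4 → ℝ, ℂ), HasCompactSupport Φ ∧ tsupport Φ ⊆ U ∧ ∫ k, h k * Φ k ≠ 0 := by
  -- Rotating by the conjugate of `h k₀` and taking real parts gives a real function that is
  -- positive near `k₀`, so its integral against a bump is positive.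
  let q : (Fin 4 → ℝ) → ℝ := fun k => (h k * (starRingEnd ℂ) (h k₀)).re
  have hq : ContinuousOn q U :=
    Complex.continuous_re.comp_continuousOn (hh.mul continuousOn_const)
  have hq0 : 0 < q k₀ := by
    simp only [q, Complex.mul_conj, Complex.ofReal_re]
    exact Complex.normSq_pos.2 h0
  have hnear : ∀ᶠ k in 𝓝 k₀, k ∈ U ∧ 0 < q k :=
    Filter.Eventually.and (hU.mem_nhds hk₀) ((hq.continuousAt (hU.mem_nhds hk₀)).eventually (lt_mem_nhds hq0))
  obtain ⟨R, hR, hball⟩ := Metric.eventually_nhds_iff_ball.1 hnear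
  let β : ContDiffBump k₀ := ⟨R / 4, R / 2, by linarith, by linarith⟩
  have hts : tsupport β ⊆ Metric.ball k₀ R := by
    rw [β.tsupport_eq]
    exact Metric.closedBall_subset_ball (by change R / 2 < R; linarith)
  have hcs : HasCompactSupport fun k => ((β k : ℝ) : ℂ) :=
    β.hasCompactSupport.comp_left Complex.ofReal_zero
  have hts' : tsupport (fun k => ((β k : ℝ) : ℂ)) ⊆ tsupport β :=
    closure_mono fun k hk => by
      simpa using hk
  have hsm : ContDiff ℝ ∞ fun k => ((β k : ℝ) : ℂ) := Complex.ofRealCLM.contDiff.comp β.contDiff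
  refine ⟨hcs.toSchwartzMap hsm, hcs, fun k hk => (hball k (hts (hts' hk))).1, fun hz => ?_⟩
  have hcont : Continuous fun k => h k * ((β k : ℝ) : ℂ) := by
    rw [continuous_iff_continuousAt]
    intro k
    by_cases hk : k ∈ tsupport β
    · exact (hh.continuousAt (hU.mem_nhds (hball k (hts hk)).1)).mul hsm.continuous.continuousAt
    · refine (continuousAt_const (y := (0 : ℂ))).congr ?_
      filter_upwards [(isClosed_tsupport β).isOpen_compl.mem_nhds hk] with x hx
      simp [image_eq_zero_of_notMem_tsupport hx]
  have hint : Integrable fun k => h k * ((β k : ℝ) : ℂ) :=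
    hcont.integrable_of_hasCompactSupport hcs.mul_left
  have hqβ : ∀ k, (h k * ((β k : ℝ) : ℂ) * (starRingEnd ℂ) (h k₀)).re = q k * β k := by
    intro k
    rw [mul_right_comm, Complex.re_mul_ofReal]
  have hzero : ∫ k, q k * β k = 0 := by
    have h1 := integral_re (𝕜 := ℂ) (hint.mul_const ((starRingEnd ℂ) (h k₀)))
    simp only [RCLike.re_eq_complex_re, hqβ] at h1
    rw [h1, integral_mul_const]
    change (((∫ k, h k * ((β k : ℝ) : ℂ)) * _) : ℂ).re = 0
    have hz' : ∫ k, h k * ((β k : ℝ) : ℂ) = 0 := hz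
    rw [hz', zero_mul, Complex.zero_re]
  have hnn : ∀ k, 0 ≤ q k * β k := by
    intro k
    by_cases hk : k ∈ tsupport β
    · exact mul_nonneg (hball k (hts hk)).2.le β.nonneg
    · simp [image_eq_zero_of_notMem_tsupport hk]
  have hqc : Continuous fun k => q k * β k := by
    have : (fun k => q k * β k) = fun k => (h k * ((β k : ℝ) : ℂ) * (starRingEnd ℂ) (h k₀)).re :=
      funext fun k => (hqβ k).symm
    rw [this]
    exact Complex.continuous_re.comp (hcont.mul continuous_const)
  have hpos : 0 < ∫ k, q k * β k := by
    refine hqc.integral_pos_of_hasCompactSupport_nonneg_nonzero β.hasCompactSupport.mul_left hnn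
      (x := k₀) ?_
    rw [β.one_of_mem_closedBall (Metric.mem_closedBall_self (by positivity)), mul_one]
    exact hq0.ne'
  exact hpos.ne' hzero

theorem fInfty_sectG (Φ : 𝓢(Fin 4 → ℝ, ℂ)) (D : ℤ) (ε : ℤˣ) {w : Fin 4 → ℝ} (hw : w ∈ bigCell D)
    (s : ℂ) : fInfty Φ (sectG D ε w) s = ∫ t, lineKernel Φ s w t := by
  have hrow : (sectG D ε w).1.1 3 = w := toGSp4_sect D ε w hw
  rw [fInfty, abs_simil_sectG D ε w hw, hrow]
  simp [lineKernel]

theorem sect_eq_sect_of_notMem (D : ℤ) (ε : ℤˣ) {w : Fin 4 → ℝ} (hw : w ∉ bigCell D) :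
    sect D ε w = 1 := dif_neg hw

/-- For a cusp form whose Fourier coefficient is nonzero at a point of the big cell, summed over the
two signs, some archimedean integral does not vanish. -/
theorem IsCuspForm.exists_JInfty_ne_zero {ψ : AddChar AdeleQ Circle} (hψ : IsStandardAddChar ψ)
    {φ : GSp4A → ℂ} (hφ : IsCuspForm φ) (D : ℤ) {k₀ : Fin 4 → ℝ} (hk₀ : k₀ ∈ bigCell D)
    (h0 : ∑ ε : ℤˣ, realCoeff D ψ φ (sectG D ε k₀) ≠ 0) :
    ∃ (Φ : 𝓢(Fin 4 → ℝ, ℂ)) (σ : ℝ), 0 < σ ∧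
      (∀ s : ℂ, σ < s.re → ArchIntegrable D (archIntegrand D ψ Φ φ s)) ∧
      ∃ s : ℂ, σ < s.re ∧ JInfty D ψ Φ φ s ≠ 0 := by
  obtain ⟨r, hr⟩ := hφ.exists_periodicWithGrowth
  let h : ℤˣ → (Fin 4 → ℝ) → ℂ := fun ε w => realCoeff D ψ φ (sectG D ε w)
  have hcont : ∀ ε, ContinuousOn (h ε) (bigCell D) := fun ε =>
    continuousOn_iff_continuous_domRestrict.2
      (continuous_realCoeff_comp hψ.continuous hr (continuous_sectG D ε))
  have hneg : ∀ w ∈ bigCell D, -w ∈ bigCell D := fun w hw => by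
    rw [← neg_one_smul ℝ w]
    exact (smul_mem_bigCell_iff D (by norm_num) w).2 hw
  have heven : ∀ ε w, h ε (-w) = h ε w := by
    intro ε w
    by_cases hw : w ∈ bigCell D
    · simp only [h, sectG_neg D ε hw, realCoeff_center hφ]
    -- Off the big cell both section values are the default `1`, so evenness holds there too.
    · have hw' : -w ∉ bigCell D := fun hw' => hw (by simpa using hneg _ hw')
      simp only [h, sectG, sect_eq_sect_of_notMem D ε hw, sect_eq_sect_of_notMem D ε hw']
  have hcont' : ContinuousOn (fun w => ∑ ε, h ε w) (bigCell D) :=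
    continuousOn_finsetSum _ fun ε _ => hcont ε
  obtain ⟨Φ, hc, hΦU, hΦ0⟩ := exists_schwartz_integral_ne_zero (isOpen_bigCell D) hcont' hk₀ h0
  have hrap : ∀ ε, RapidOnCone (tsupport Φ) r (h ε) := fun ε =>
    rapidOnCone_realCoeff hψ hr D ε hc.isCompact hΦU
  have hint : ∀ s : ℂ, (r + 5 : ℝ) ≤ 4 * s.re → ∀ ε,
      IntegrableOn (fun w => h ε w * ∫ t, lineKernel Φ s w t) (bigCell D) := by
    intro s hs ε
    have := (integrable_mul_lineKernel (isOpen_bigCell D).measurableSet (zero_notMem_bigCell D)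
      (hcont ε) Φ.continuous hc (hrap ε) hs).integral_prod_left
    simp only [integral_const_mul] at this
    exact this
  have hval : ∀ s ε, ∀ w ∈ bigCell D, archIntegrand D ψ Φ φ s (sect D ε w) =
      h ε w * ∫ t, lineKernel Φ s w t := by
    intro s ε w hw
    rw [archIntegrand, functionalH_rightTranslate, ← fInfty_sectG Φ D ε hw]
    rfl
  have hmeas := (isOpen_bigCell D).measurableSet
  have hσ : (r + 5 : ℝ) ≤ 4 * ((r + 5 : ℝ) / 4) := by linarith
  refine ⟨Φ, (r + 5 : ℝ) / 4, by positivity, fun s hs ε => ?_, ?_⟩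
  · exact (integrableOn_congr_fun (hval s ε) hmeas).2 (hint s (by linarith) ε)
  · by_contra! hz
    refine hΦ0 ?_
    -- The two signs are combined before Mellin inversion: the inversion is applied to `∑ h_ε`, and
    -- at `t = 1` it contradicts the choice of `Φ`.
    have h1 := dilationAverage_one_eq_zero (isOpen_bigCell D) (zero_notMem_bigCell D)
      (mem_bigCell_of_smul_mem D) hΦU hcont' (fun w => Finset.sum_congr rfl fun ε _ => heven ε w)
      hneg Φ.continuous hc (RapidOnCone.sum hrap) hσ (fun s hs => by
        rw [← hz s hs, JInfty, archIntegral]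
        simp_rw [Finset.sum_mul]
        rw [integral_finsetSum _ fun ε _ => hint s (by linarith) ε]
        exact Finset.sum_congr rfl fun ε _ => (setIntegral_congr_fun hmeas (hval s ε)).symm)
    simpa [dilationAverage] using h1

/-! ### Separating the two signs of the determinant -/

/-- The base point `c₁` of the big cell. -/
def basePoint : Fin 4 → ℝ := ![1, 0, 0, 0]

theorem basePoint_mem (D : ℤ) : basePoint ∈ bigCell D := by
  rw [isUnit_iff_sq]; simp [basePoint]

/-- The elements `sect D 1` and `sect D (-1)` at the base point differ by an element inverting `U`. -/
theorem sectG_neg_one_mul (D : ℤ) (z : ℝ) :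
    sectG D (-1) basePoint * (sectG D 1 basePoint)⁻¹ * siegelU 0 0 z =
      siegelU 0 0 (-z) * (sectG D (-1) basePoint * (sectG D 1 basePoint)⁻¹) := by
  set d := sectG D (-1) basePoint * (sectG D 1 basePoint)⁻¹ with hd
  have h1 : (d.1.1 : Matrix (Fin 4) (Fin 4) ℝ) = Matrix.diagonal ![-1, -1, 1, 1] := by
    have h2 : (sectG D (-1) basePoint).1.1 =
        Matrix.diagonal ![-1, -1, 1, 1] * (sectG D 1 basePoint).1.1 := by
      rw [sectG_val D _ (basePoint_mem D), sectG_val D _ (basePoint_mem D)]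
      ext i j
      rw [Matrix.diagonal_mul]
      fin_cases i <;> fin_cases j <;> simp [basePoint, bigCellNorm]
    rw [hd, GSp4.val_mul, h2, mul_assoc, GSp4.mul_inv_val, mul_one]
  apply Subtype.ext; apply Units.ext
  change d.1.1 * !![1, 0, 0, 0; 0, 1, 0, z; 0, 0, 1, 0; 0, 0, 0, 1] =
    !![1, 0, 0, 0; 0, 1, 0, -z; 0, 0, 1, 0; 0, 0, 0, 1] * d.1.1
  rw [h1]
  ext i j
  rw [Matrix.diagonal_mul, Matrix.mul_diagonal]
  fin_cases i <;> fin_cases j <;> simp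

/-- For `g₀ = (sectG D 1 basePoint)⁻¹ u(z)` the sum is `e(z) a + e(-z) b`, where `a ≠ 0` is the
coefficient at `1`. Vanishing at `z = 0` and `z = 1/4` would give `a + b = 0` and `a - b = 0`, hence
`a = 0`. -/
theorem exists_sum_realCoeff_ne_zero {ψ : AddChar AdeleQ Circle} (hψ : IsStandardAddChar ψ) {r : ℕ}
    {φ : GSp4A → ℂ} (hφ : PeriodicWithGrowth r φ) (D : ℤ) (h1 : realCoeff D ψ φ 1 ≠ 0) :
    ∃ g₀ : GSp4 ℝ, ∑ ε : ℤˣ, realCoeff D ψ φ (sectG D ε basePoint * g₀) ≠ 0 := by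
  set d := sectG D (-1) basePoint * (sectG D 1 basePoint)⁻¹ with hd
  have key : ∀ z : ℝ, ∑ ε : ℤˣ, realCoeff D ψ φ
      (sectG D ε basePoint * ((sectG D 1 basePoint)⁻¹ * siegelU 0 0 z)) =
      Complex.exp (2 * Real.pi * Complex.I * z) * realCoeff D ψ φ 1 +
        Complex.exp (2 * Real.pi * Complex.I * (-z : ℝ)) * realCoeff D ψ φ d := by
    intro z
    have hu : (Finset.univ : Finset ℤˣ) = {1, -1} := rfl
    rw [hu, Finset.sum_pair (by decide), mul_inv_cancel_left, ← mul_assoc, sectG_neg_one_mul, ← hd,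
      realCoeff_siegelU hψ hφ, ← realCoeff_siegelU hψ hφ z 1, mul_one]
  by_contra! hz
  have e0 := hz ((sectG D 1 basePoint)⁻¹ * siegelU 0 0 (0 : ℝ))
  have e1 := hz ((sectG D 1 basePoint)⁻¹ * siegelU 0 0 (1 / 4 : ℝ))
  rw [key] at e0 e1
  have i1 : Complex.exp (2 * Real.pi * Complex.I * ((1 / 4 : ℝ) : ℂ)) = Complex.I := by
    refine (congrArg Complex.exp ?_).trans Complex.exp_pi_div_two_mul_I
    push_cast; ring
  have i2 : Complex.exp (2 * Real.pi * Complex.I * ((-(1 / 4) : ℝ) : ℂ)) = -Complex.I := by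
    refine (congrArg Complex.exp ?_).trans Complex.exp_neg_pi_div_two_mul_I
    push_cast; ring
  rw [i1, i2] at e1
  simp only [Complex.ofReal_zero, mul_zero, Complex.exp_zero, one_mul, neg_zero] at e0
  apply h1
  have e2 : realCoeff D ψ φ 1 - realCoeff D ψ φ d = 0 := by
    have : Complex.I * (realCoeff D ψ φ 1 - realCoeff D ψ φ d) = 0 := by
      rw [← e1]; ring
    exact (mul_eq_zero.1 this).resolve_left Complex.I_ne_zero
  linear_combination (e0 + e2) / 2

theorem realCoeff_rightTranslate (D : ℤ) (ψ : AddChar AdeleQ Circle) (φ : GSp4A → ℂ)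
    (g₀ g : GSp4 ℝ) :
    realCoeff D ψ (rightTranslate (g₀, 1) φ) g = realCoeff D ψ φ (g * g₀) := by
  unfold realCoeff
  congr 1
  funext x
  simp [translateU, rightTranslate, mul_assoc]

end KS

/-! ### The proposition -/

open KS
theorem proposition3p6 (D : ℤ) (hD : Squarefree D)
    (ψ : AddChar AdeleQ Circle) (hψ : IsStandardAddChar ψ)
    (V : Submodule ℂ (GSp4A → ℂ)) (hV : IsCuspidalAutomorphicRep V)
    {E : Type*} [NormedAddCommGroup E] [InnerProductSpace ℂ E] [CompleteSpace E]
    {W : Type*} [AddCommGroup W] [Module ℂ W]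
    (πr : UnitaryIrrep E) (πf : SmoothIrrep W) (F : Factorization V πr πf)
    (vr : πr.smoothVectors) (vf : W)
    (hH : functionalH D ψ (F.iso (vr ⊗ₜ[ℂ] vf) : GSp4A → ℂ) ≠ 0) :
    ∃ (vr' : πr.smoothVectors) (Φ : 𝓢(Fin 4 → ℝ, ℂ)) (σ : ℝ), 0 < σ ∧
      (∀ s : ℂ, σ < s.re →
        ArchIntegrable D (archIntegrand D ψ Φ (F.iso (vr' ⊗ₜ[ℂ] vf) : GSp4A → ℂ) s)) ∧
      ∃ s : ℂ, σ < s.re ∧ JInfty D ψ Φ (F.iso (vr' ⊗ₜ[ℂ] vf) : GSp4A → ℂ) s ≠ 0 := by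
  obtain ⟨r, hr⟩ := (hV.isCuspForm _ (F.iso (vr ⊗ₜ[ℂ] vf)).2).exists_periodicWithGrowth
  have h1 : realCoeff D ψ (F.iso (vr ⊗ₜ[ℂ] vf) : GSp4A → ℂ) 1 ≠ 0 := by
    rw [← functionalH_rightTranslate]
    have : rightTranslate ((1 : GSp4 ℝ), 1) (F.iso (vr ⊗ₜ[ℂ] vf) : GSp4A → ℂ) =
        F.iso (vr ⊗ₜ[ℂ] vf) := by
      funext g
      exact congrArg _ (mul_one g)
    rwa [this]
  obtain ⟨g₀, hg₀⟩ := exists_sum_realCoeff_ne_zero hψ hr D h1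
  -- Translation by an element with trivial finite component moves only the archimedean tensor
  -- factor, so `vf` is kept.
  have heq : (F.iso (πr.smoothAct g₀ vr ⊗ₜ[ℂ] vf) : GSp4A → ℂ) =
      rightTranslate (g₀, 1) (F.iso (vr ⊗ₜ[ℂ] vf)) := by
    rw [← F.equivariant]
    simp
  refine ⟨πr.smoothAct g₀ vr,
    (hV.isCuspForm _ (F.iso (πr.smoothAct g₀ vr ⊗ₜ[ℂ] vf)).2).exists_JInfty_ne_zero hψ D
      (basePoint_mem D) ?_⟩
  rw [heq]
  simpa only [realCoeff_rightTranslate] using hg₀
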